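/- **Conventions.** $r$ and $\hbar$ are formal parameters. Over a base ring $R\in\{\mathbb C,\mathbb C[[r]],\mathbb C[[\hbar]],\mathbb C[[r,\hbar]]\}$ with maximal ideal $\mathfrak m$, a *Hopf algebra* is an $\mathfrak m$-adically complete $R$-algebra $A$ with an algebra map $\Delta:A\to A\hat\otimes A=\varprojlim_n (A/\mathfrak m^nA)\otimes_R(A/\mathfrak m^nA)$, a counit $A\to R$ and an antipode satisfying the usual axioms. Let $z$ be one of the parameters, $R\cong k[[z]]$. A *Hopf deformation* with parameter $z$ of a Hopf algebra $B$ over $k$ is a Hopf algebra $A$ over $R$ with a map $\pi:A\to B$, linear over $R\to R/zR=k$, such that (i) there is a $k[[z]]$-module isomorphism $A\cong B[[z]]$ under which $\pi$ is reduction mod $z$; (ii) product and coproduct of $A$ reduce mod $z$ to those of $B$, i.e. $\pi$ is a unital algebra map and $(\pi\hat\otimes\pi)\circ\Delta_A=\Delta_B\circ\pi$. If $B$ is commutative with a Poisson bracket $\{\cdot,\cdot\}$, then $(A,\pi)$ is a *quantization* of $B$ if moreover $ab-ba\in zA$ and $\pi\big(\tfrac{ab-ba}{z}\big)=\{\pi(a),\pi(b)\}$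 for all $a,b\in A$. **The four algebras** (completed in the parameters they involve). - $\mathcal U_q^\hbar(\mathfrak{sl}_2)$, $q=e^{-r}$: topologically generated over $\mathbb C[[r,\hbar]]$ by $H,E,F$ subject to (the closed two-sided ideal of) $[H,E]=2\hbar E$, $[H,F]=-2\hbar F$, $EF-FE=\hbar\,\frac{e^{rH}-e^{-rH}}{2r}$. - $\mathcal U^\hbar(\mathfrak{sl}_2)=T(\mathfrak{sl}_2)[[\hbar]]$ modulo the closed two-sided ideal generated by $x\otimes y-y\otimes x-\hbar[x,y]$, $x,y\in\mathfrak{sl}_2$. - $\mathbb C[(SU_2^*)_r]=\mathbb C[H,E,F][[r]]$, the algebra of coordinate functions, containing $e^{\pm\frac12 rH}$, of the pairs of triangular matrices $$b=\begin{pmatrix}e^{\frac12rH}&0\\2rF&e^{-\frac12rH}\end{pmatrix},\qquad b^+=\begin{pmatrix}e^{-\frac12rH}&2rE\\0&e^{\frac12rH}\end{pmatrix}.$$ - $\mathbb C[\mathfrak{su}_2^*]=\mathbb C[H,E,F]$, where $x\in\mathfrak{sl}_2=\mathfrak{su}_2\otimes\mathbb C$ is identified with the linear function $f_x$ on $\mathfrak{su}_2^*$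 ($H,E,F\in\mathfrak{sl}_2$ being the standard basis). **Theorem.** In $\mathcal U_q^\hbar(\mathfrak{sl}_2)$ the invertible element $K^{1/2}=e^{-\frac12rH}$, with inverse $K^{-1/2}=e^{\frac12rH}$, satisfies $K^{1/2}EK^{-1/2}=q^{\hbar}E$, $K^{1/2}FK^{-1/2}=q^{-\hbar}F$, $2r(EF-FE)=\hbar(K^{-1}-K)$. The following structures exist. 1. *Hopf structures.* $\mathcal U_q^\hbar(\mathfrak{sl}_2)$ and $\mathbb C[(SU_2^*)_r]$ are Hopf algebras over $\mathbb C[[r,\hbar]]$ and $\mathbb C[[r]]$ with coproduct $\Delta_r$ given by $$\Delta_r(e^{\pm\frac12rH})=e^{\pm\frac12rH}\otimes e^{\pm\frac12rH},\quad \Delta_r(H)=H\otimes1+1\otimes H,\quad \Delta_r(Y)=Y\otimes e^{\frac12rH}+e^{-\frac12rH}\otimes Y\ \ (Y=E,F);$$ on $\mathbb C[(SU_2^*)_r]$ it is dual to matrix multiplication: $\Delta_r(b_{ij})=\sum_k b_{ik}\otimes b_{kj}$ and $\Delta_r(b^+_{ij})=\sum_k b^+_{ik}\otimes b^+_{kj}$.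 $\mathcal U^\hbar(\mathfrak{sl}_2)$ and $\mathbb C[\mathfrak{su}_2^*]$ are Hopf algebras over $\mathbb C[[\hbar]]$ and $\mathbb C$ with coproduct $\Delta_0(x)=x\otimes1+1\otimes x$ for $x\in\mathfrak{sl}_2$. 2. *Real forms.* Each of the four carries an involution $\dagger$, antilinear (with $r^\dagger=r$, $\hbar^\dagger=\hbar$), antimultiplicative, compatible with coproduct and counit, with $H^\dagger=H$, $E^\dagger=F$, $F^\dagger=E$ (so $K^\dagger=K$). 3. *Poisson brackets.* There is a $\mathbb C[[r]]$-bilinear Poisson bracket on $\mathbb C[(SU_2^*)_r]$ with $\{H,E\}_r=2E$, $\{H,F\}_r=-2F$, $\{E,F\}_r=\frac{e^{rH}-e^{-rH}}{2r}$, and the KKS bracket $\{f_x,f_y\}_0=f_{[x,y]}$ ($x,y\in\mathfrak{sl}_2$) is a Poisson bracket on $\mathbb C[\mathfrak{su}_2^*]$. 4. *Commuting square.* There are maps, compatible with the involutions $\dagger$ and sending $H,E,F$ to $H,E,F$ (the upper one also sends $e^{trH}$ to $e^{trH}$, $t\in\mathbb C$), which form a commutative square $$\begin{array}{ccc} \big((\mathcal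 U_q^\hbar(\mathfrak{sl}_2),\dagger),\Delta_r\big)&\xrightarrow{\ \bmod \hbar\ }&\big(\mathbb C[(SU_2^*)_r],\{\cdot,\cdot\}_r,\Delta_r\big)\\ {\scriptstyle \bmod r}\downarrow&&\downarrow{\scriptstyle \bmod r}\\ \big((\mathcal U^\hbar(\mathfrak{sl}_2),\dagger),\Delta_0\big)&\xrightarrow{\ \bmod \hbar\ }&\big(\mathbb C[\mathfrak{su}_2^*],\{\cdot,\cdot\}_0,\Delta_0\big) \end{array}$$ The vertical arrows exhibit Hopf deformations with parameter $r$, and the horizontal arrows exhibit quantizations of Poisson algebras with parameter $\hbar$. -/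

import Mathlib

open scoped TensorProduct PowerSeries

noncomputable section

namespace CurvedQuantum

/-! ### Adically complete algebras and completed tensor squares

The base rings are the local rings `ℂ`, `ℂ⟦r⟧`, `ℂ⟦ħ⟧` and `ℂ⟦r⟧⟦ħ⟧`. An algebra over one of them
carries the adic topology of the maximal ideal `𝔪` (generated by the formal parameters). -/

section Adic

variable (R A : Type*) [CommRing R] [IsLocalRing R] [Ring A] [Algebra R A]

/-- The ideal `𝔪ⁿ A` of an `R`-algebra `A`, where `𝔪` is the maximal ideal of `R`. -/
def adicIdeal (n : ℕ) : Ideal A :=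
  { (IsLocalRing.maximalIdeal R ^ n • ⊤ : Submodule R A) with
    smul_mem' := by
      intro a x hx
      change x ∈ (IsLocalRing.maximalIdeal R ^ n • ⊤ : Submodule R A) at hx
      change a * x ∈ (IsLocalRing.maximalIdeal R ^ n • ⊤ : Submodule R A)
      refine Submodule.smul_induction_on hx (fun r hr y _ => ?_) (fun y z hy hz => ?_)
      · rw [mul_smul_comm]
        exact Submodule.smul_mem_smul hr Submodule.mem_top
      · rw [mul_add]
        exact add_mem hy hz }

variable {R A} in
theorem mem_adicIdeal {n : ℕ} {x : A} :
    x ∈ adicIdeal R A n ↔ x ∈ (IsLocalRing.maximalIdeal R ^ n • ⊤ : Submodule R A) := Iff.rfl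

instance adicIdeal_isTwoSided (n : ℕ) : (adicIdeal R A n).IsTwoSided where
  mul_mem_of_left b hx := by
    rw [mem_adicIdeal] at hx ⊢
    refine Submodule.smul_induction_on hx (fun r hr y _ => ?_) (fun y z hy hz => ?_)
    · rw [smul_mul_assoc]
      exact Submodule.smul_mem_smul hr Submodule.mem_top
    · rw [add_mul]
      exact add_mem hy hz

theorem adicIdeal_succ_le (n : ℕ) : adicIdeal R A (n + 1) ≤ adicIdeal R A n :=
  fun _ hx => Submodule.smul_mono_left (Ideal.pow_le_pow_right n.le_succ) hx

/-- The truncation `A / 𝔪ⁿ A`. -/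
def Trunc (n : ℕ) : Type _ := A ⧸ adicIdeal R A n

instance (n : ℕ) : Ring (Trunc R A n) := inferInstanceAs (Ring (A ⧸ adicIdeal R A n))

instance (n : ℕ) : Algebra R (Trunc R A n) := inferInstanceAs (Algebra R (A ⧸ adicIdeal R A n))

/-- The quotient map `A → A / 𝔪ⁿ A`. -/
def Trunc.mk (n : ℕ) : A →ₐ[R] Trunc R A n := Ideal.Quotient.mkₐ R (adicIdeal R A n)

variable {R A} in
theorem Trunc.mk_surjective (n : ℕ) : Function.Surjective (Trunc.mk R A n) :=
  Ideal.Quotient.mk_surjective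

variable {R A} in
theorem Trunc.mk_eq_zero {n : ℕ} {a : A} : Trunc.mk R A n a = 0 ↔ a ∈ adicIdeal R A n :=
  Ideal.Quotient.eq_zero_iff_mem

/-- The projection `A / 𝔪ⁿ⁺¹ A → A / 𝔪ⁿ A`. -/
def transition (n : ℕ) : Trunc R A (n + 1) →ₐ[R] Trunc R A n :=
  Ideal.Quotient.factorₐ R (adicIdeal_succ_le R A n)

/-- The completed tensor square `A ⊗̂ A = lim_n (A / 𝔪ⁿ A) ⊗ (A / 𝔪ⁿ A)`, an `R`-algebra. -/
def CTensor : Subalgebra R (∀ n, Trunc R A n ⊗[R] Trunc R A n) :=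
  ⨅ n, AlgHom.equalizer
    ((Algebra.TensorProduct.map (transition R A n) (transition R A n)).comp
      (Pi.evalAlgHom R (fun n => Trunc R A n ⊗[R] Trunc R A n) (n + 1)))
    (Pi.evalAlgHom R (fun n => Trunc R A n ⊗[R] Trunc R A n) n)

variable {R A}

theorem mem_CTensor {x : ∀ n, Trunc R A n ⊗[R] Trunc R A n} :
    x ∈ CTensor R A ↔ ∀ n, Algebra.TensorProduct.map (transition R A n) (transition R A n)
      (x (n + 1)) = x n := by
  simp [CTensor, Algebra.mem_iInf, AlgHom.mem_equalizer]

variable (R) in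
/-- The pure tensor `a ⊗ b` in the completed tensor square. -/
def ctmul (a b : A) : CTensor R A :=
  ⟨fun n => Trunc.mk R A n a ⊗ₜ Trunc.mk R A n b, mem_CTensor.2 fun _ => rfl⟩

section Semilinear

variable {S B : Type*} [CommRing S] [IsLocalRing S] [Ring B] [Algebra S B]
  {σ : R →+* S} [IsLocalHom σ]

theorem map_mem_adicIdeal (f : A →ₛₗ[σ] B) (n : ℕ) {x : A} (hx : x ∈ adicIdeal R A n) :
    f x ∈ adicIdeal S B n := by
  rw [mem_adicIdeal] at hx ⊢
  refine Submodule.smul_induction_on hx (fun r hr y _ => ?_) (fun y z hy hz => ?_)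
  · rw [map_smulₛₗ]
    refine Submodule.smul_mem_smul ?_ Submodule.mem_top
    have h1 : Ideal.map σ (IsLocalRing.maximalIdeal R) ≤ IsLocalRing.maximalIdeal S :=
      Ideal.map_le_iff_le_comap.2 fun a ha => map_nonunit σ a ha
    have h2 := Ideal.mem_map_of_mem σ hr
    rw [Ideal.map_pow] at h2
    exact Ideal.pow_right_mono h1 n h2
  · rw [map_add]
    exact add_mem hy hz

/-- The map `A / 𝔪ⁿ A → B / 𝔪ⁿ B` induced by a (semi)linear map over a local homomorphism. -/
def truncMap (f : A →ₛₗ[σ] B) (n : ℕ) : Trunc R A n →ₛₗ[σ] Trunc S B n where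
  toFun := Quotient.map' f fun x y h => by
    rw [Submodule.quotientRel_def] at h ⊢
    rw [← map_sub]
    exact map_mem_adicIdeal f n h
  map_add' := by
    rintro ⟨x⟩ ⟨y⟩
    exact congrArg (Trunc.mk S B n) (map_add f x y)
  map_smul' := by
    rintro c ⟨x⟩
    exact congrArg (Trunc.mk S B n) (map_smulₛₗ f c x)

theorem truncMap_mk (f : A →ₛₗ[σ] B) (n : ℕ) (a : A) :
    truncMap f n (Trunc.mk R A n a) = Trunc.mk S B n (f a) := rfl

/-- The map `f ⊗̂ f : A ⊗̂ A → B ⊗̂ B` induced by a (semi)linear map `f : A → B`. -/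
def ctMap (f : A →ₛₗ[σ] B) (x : CTensor R A) : CTensor S B :=
  ⟨fun n => TensorProduct.map (truncMap f n) (truncMap f n) (x.1 n), by
    rw [mem_CTensor]
    intro n
    rw [← mem_CTensor.1 x.2 n]
    generalize x.1 (n + 1) = t
    induction t with
    | zero => simp
    | add a b ha hb => simp only [map_add, ha, hb]
    | tmul a b =>
      obtain ⟨a, rfl⟩ := Trunc.mk_surjective (n + 1) a
      obtain ⟨b, rfl⟩ := Trunc.mk_surjective (n + 1) b
      rfl⟩

end Semilinear

theorem smul_trunc_tensor {n : ℕ} {r : R} (hr : r ∈ IsLocalRing.maximalIdeal R ^ n)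
    (t : Trunc R A n ⊗[R] Trunc R A n) : r • t = 0 := by
  have h : ∀ a : Trunc R A n, r • a = 0 := fun a => by
    obtain ⟨a, rfl⟩ := Trunc.mk_surjective n a
    rw [← map_smul, Trunc.mk_eq_zero, mem_adicIdeal]
    exact Submodule.smul_mem_smul hr Submodule.mem_top
  have h' : LinearMap.lsmul R (Trunc R A n ⊗[R] Trunc R A n) r = 0 :=
    TensorProduct.ext' fun a b => by
      simp only [LinearMap.lsmul_apply, TensorProduct.smul_tmul', h, TensorProduct.zero_tmul,
        LinearMap.zero_apply]
  exact LinearMap.congr_fun h' t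

variable (R A) in
/-- The projection `A ⊗̂ A → (A / 𝔪ⁿ A) ⊗ (A / 𝔪ⁿ A)`. -/
def CTensor.proj (n : ℕ) : CTensor R A →ₐ[R] Trunc R A n ⊗[R] Trunc R A n :=
  (Pi.evalAlgHom R (fun n => Trunc R A n ⊗[R] Trunc R A n) n).comp (CTensor R A).val

theorem algHom_trunc_tensor_eq_zero {n : ℕ} (f : A →ₐ[R] Trunc R A n ⊗[R] Trunc R A n) (a : A)
    (ha : a ∈ adicIdeal R A n) : f a = 0 := by
  rw [mem_adicIdeal] at ha
  refine Submodule.smul_induction_on (p := fun a => f a = 0) ha (fun r hr y _ => ?_)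
    (fun y z hy hz => ?_)
  · exact (map_smul f r y).trans (smul_trunc_tensor hr (f y))
  · exact (map_add f y z).trans (by rw [hy, hz, add_zero])

/-- The map `Δₙ : A / 𝔪ⁿ A → (A / 𝔪ⁿ A) ⊗ (A / 𝔪ⁿ A)` induced by `Δ : A → A ⊗̂ A`. -/
def comulTrunc (Δ : A →ₐ[R] CTensor R A) (n : ℕ) :
    Trunc R A n →ₐ[R] Trunc R A n ⊗[R] Trunc R A n :=
  Ideal.Quotient.liftₐ (adicIdeal R A n) ((CTensor.proj R A n).comp Δ)
    (algHom_trunc_tensor_eq_zero _)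

variable (R A) in
/-- A (topological, adically complete) Hopf algebra over `R`: the algebra `A` is `𝔪`-adically
complete and carries a coproduct `Δ : A → A ⊗̂ A`, a counit and an antipode. As `A ⊗̂ A` and
`A ⊗̂ A ⊗̂ A` are the limits of their truncations, the axioms are the usual identities between
maps on `A / 𝔪ⁿ A`, for every `n`. -/
structure AdicHopf where
  complete : IsAdicComplete (IsLocalRing.maximalIdeal R) A
  comul : A →ₐ[R] CTensor R A
  counit : A →ₐ[R] R
  antipode : A →ₗ[R] A
  coassoc : ∀ n, (TensorProduct.assoc R _ _ _).toLinearMap ∘ₗ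
      (comulTrunc comul n).toLinearMap.rTensor (Trunc R A n) ∘ₗ (comulTrunc comul n).toLinearMap =
    (comulTrunc comul n).toLinearMap.lTensor (Trunc R A n) ∘ₗ (comulTrunc comul n).toLinearMap
  counit_left : ∀ n, LinearMap.mul' R (Trunc R A n) ∘ₗ
      (truncMap ((Algebra.ofId R A).comp counit).toLinearMap n).rTensor (Trunc R A n) ∘ₗ
      (comulTrunc comul n).toLinearMap = LinearMap.id
  counit_right : ∀ n, LinearMap.mul' R (Trunc R A n) ∘ₗ
      (truncMap ((Algebra.ofId R A).comp counit).toLinearMap n).lTensor (Trunc R A n) ∘ₗ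
      (comulTrunc comul n).toLinearMap = LinearMap.id
  antipode_left : ∀ n, LinearMap.mul' R (Trunc R A n) ∘ₗ
      (truncMap antipode n).rTensor (Trunc R A n) ∘ₗ (comulTrunc comul n).toLinearMap =
    truncMap ((Algebra.ofId R A).comp counit).toLinearMap n
  antipode_right : ∀ n, LinearMap.mul' R (Trunc R A n) ∘ₗ
      (truncMap antipode n).lTensor (Trunc R A n) ∘ₗ (comulTrunc comul n).toLinearMap =
    truncMap ((Algebra.ofId R A).comp counit).toLinearMap n

/-- An involution making a Hopf algebra over `R` a Hopf `*`-algebra: it is antilinear with respect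
to the conjugation `conj` of `R`, antimultiplicative, involutive, and compatible with the
coproduct and the counit. -/
structure IsHopfStar {conj : R →+* R} [IsLocalHom conj] (hA : AdicHopf R A)
    (dag : A →ₛₗ[conj] A) : Prop where
  involutive : ∀ a, dag (dag a) = a
  antimul : ∀ a b, dag (a * b) = dag b * dag a
  comul : ∀ a, hA.comul (dag a) = ctMap dag (hA.comul a)
  counit : ∀ a, hA.counit (dag a) = conj (hA.counit a)

end Adic

/-! ### Poisson brackets, Hopf deformations, quantizations -/

/-- A `k`-bilinear Poisson bracket on a commutative `k`-algebra. -/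
structure IsPoissonBracket {k A : Type*} [CommRing k] [CommRing A] [Algebra k A]
    (br : A →ₗ[k] A →ₗ[k] A) : Prop where
  self : ∀ a, br a a = 0
  leibniz : ∀ a b c, br a (b * c) = br a b * c + b * br a c
  jacobi : ∀ a b c, br a (br b c) + br b (br c a) + br c (br a b) = 0

instance isLocalHom_constantCoeff {k : Type*} [CommRing k] :
    IsLocalHom (PowerSeries.constantCoeff (R := k)) :=
  ⟨fun _ h => PowerSeries.isUnit_iff_constantCoeff.2 h⟩

section Deformation

variable {k R A B : Type*} [CommRing k] [CommRing R]

/-- If `R ≅ k⟦z⟧`, the reduction `R → k` modulo `z`. -/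
def redHom (e : R ≃+* k⟦X⟧) : R →+* k :=
  (PowerSeries.constantCoeff (R := k)).comp (e : R →+* k⟦X⟧)

instance isLocalHom_redHom (e : R ≃+* k⟦X⟧) : IsLocalHom (redHom e) :=
  inferInstanceAs (IsLocalHom ((PowerSeries.constantCoeff (R := k)).comp (e : R →+* k⟦X⟧)))

variable [IsLocalRing k] [IsLocalRing R] [Ring A] [Algebra R A] [Ring B] [Algebra k B]

/-- Let `R ≅ k⟦z⟧` via `e`. The map `π : A → B` exhibits the Hopf algebra `A` over `R` as a Hopf
deformation, with parameter `z`, of the Hopf algebra `B` over `k`: there is an isomorphism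
`A ≅ B⟦z⟧` of `k⟦z⟧`-modules under which `π` is the reduction modulo `z`, and products and
coproducts agree modulo `z`. -/
structure IsHopfDeformation (e : R ≃+* k⟦X⟧) (hA : AdicHopf R A) (hB : AdicHopf k B)
    (π : A →ₛₗ[redHom e] B) : Prop where
  free : ∃ φ : A ≃+ B⟦X⟧,
    (∀ s a, φ (s • a) = PowerSeries.map (algebraMap k B) (e s) * φ a) ∧
      ∀ a, PowerSeries.constantCoeff (φ a) = π a
  map_one : π 1 = 1
  map_mul : ∀ a b, π (a * b) = π a * π b
  map_comul : ∀ a, ctMap π (hA.comul a) = hB.comul (π a)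

end Deformation

/-- A Hopf deformation `A` of a commutative Hopf algebra `B` with Poisson bracket `br` is a
quantization of it if `(a b - b a) / z` reduces modulo `z` to the bracket of the reductions. -/
structure IsQuantization {k R A B : Type*} [CommRing k] [CommRing R] [IsLocalRing k]
    [IsLocalRing R] [Ring A] [Algebra R A] [CommRing B] [Algebra k B] (e : R ≃+* k⟦X⟧)
    (hA : AdicHopf R A) (hB : AdicHopf k B) (br : B →ₗ[k] B →ₗ[k] B)
    (π : A →ₛₗ[redHom e] B) : Prop extends IsHopfDeformation e hA hB π where
  poisson : IsPoissonBracket br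
  commutator : ∀ a b, ∃ c, a * b - b * a = e.symm PowerSeries.X • c ∧ π c = br (π a) (π b)

/-! ### The base rings -/

/-- `ℂ⟦r⟧`. -/
abbrev Cr : Type := ℂ⟦X⟧

/-- `ℂ⟦ħ⟧`. -/
abbrev Ch : Type := ℂ⟦X⟧

/-- `ℂ⟦r, ħ⟧ = ℂ⟦r⟧⟦ħ⟧`: the outer variable is `ħ`. -/
abbrev Crh : Type := ℂ⟦X⟧⟦X⟧

/-- The parameter `r` of `ℂ⟦r, ħ⟧`. -/
def rr : Crh := PowerSeries.C PowerSeries.X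

/-- The parameter `ħ` of `ℂ⟦r, ħ⟧`. -/
def hh : Crh := PowerSeries.X

/-- Exchange of the two variables: `ℂ⟦r⟧⟦ħ⟧ ≅ ℂ⟦ħ⟧⟦r⟧`. -/
def swapVars : ℂ⟦X⟧⟦X⟧ ≃+* ℂ⟦X⟧⟦X⟧ where
  toFun f := PowerSeries.mk fun i => PowerSeries.mk fun j => (f.coeff j).coeff i
  invFun f := PowerSeries.mk fun i => PowerSeries.mk fun j => (f.coeff j).coeff i
  left_inv f := by ext; simp
  right_inv f := by ext; simp
  map_add' f g := by ext; simp
  map_mul' f g := by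
    ext i j
    simp only [PowerSeries.coeff_mk, PowerSeries.coeff_mul, map_sum]
    rw [Finset.sum_comm]

/-- Complex conjugation of the coefficients on `ℂ⟦r⟧` and `ℂ⟦ħ⟧` (the parameter is real). -/
abbrev conj₁ : ℂ⟦X⟧ →+* ℂ⟦X⟧ := PowerSeries.map (starRingEnd ℂ)

/-- Complex conjugation of the coefficients on `ℂ⟦r, ħ⟧` (the parameters are real). -/
abbrev conj₂ : Crh →+* Crh := PowerSeries.map conj₁

/-! ### Formal exponentials -/

section Exp

variable {B : Type*} [Ring B] [Algebra ℂ B]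

/-- `e^{t X h} = ∑ₖ (tᵏ / k!) hᵏ Xᵏ` in `B⟦X⟧`, for `h ∈ B` and `t ∈ ℂ`. -/
def expS (t : ℂ) (h : B) : B⟦X⟧ := PowerSeries.mk fun k => (t ^ k / (k.factorial : ℂ)) • h ^ k

/-- `(e^{X h} - e^{-X h}) / (2 X)` in `B⟦X⟧`: half of the numerator, with coefficients shifted. -/
def sinhDiv (h : B) : B⟦X⟧ :=
  PowerSeries.mk fun k => (1 / 2 : ℂ) • (expS 1 h - expS (-1) h).coeff (k + 1)

theorem X_mul_two_mul_sinhDiv (h : B) :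
    PowerSeries.X * (2 * sinhDiv h) = expS 1 h - expS (-1) h := by
  ext k
  cases k with
  | zero => simp [expS]
  | succ k =>
    rw [PowerSeries.coeff_succ_X_mul, two_mul, map_add, sinhDiv, PowerSeries.coeff_mk, ← add_smul]
    norm_num

end Exp

/-! ### The four algebras -/

/-- Names of the generators. -/
inductive Gen
  | H
  | E
  | F

/-- `A⟦X⟧` is an `R⟦X⟧`-algebra for every (possibly noncommutative) `R`-algebra `A`. -/
abbrev seriesAlgebra (R A : Type*) [CommRing R] [Ring A] [Algebra R A] : Algebra R⟦X⟧ A⟦X⟧ :=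
  (PowerSeries.map (algebraMap R A)).toAlgebra' fun c x => by
    ext n
    simp only [PowerSeries.coeff_mul, PowerSeries.coeff_map]
    rw [← Finset.Nat.sum_antidiagonal_swap]
    exact Finset.sum_congr rfl fun p _ => Algebra.commutes _ _

section ClosedIdeal

variable (R : Type*) {A : Type*} [CommRing R] [IsLocalRing R] [Ring A] [Algebra R A]

/-- The closure, in the adic topology, of the two-sided ideal generated by `s`. -/
def closedIdeal (s : Set A) : Ideal A := ⨅ n, (TwoSidedIdeal.span s).asIdeal ⊔ adicIdeal R A n

instance closedIdeal_isTwoSided (s : Set A) : (closedIdeal R s).IsTwoSided where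
  mul_mem_of_left b hx := by
    rw [closedIdeal, Ideal.mem_iInf] at hx ⊢
    intro n
    obtain ⟨y, hy, z, hz, rfl⟩ := Submodule.mem_sup.1 (hx n)
    rw [add_mul]
    exact Submodule.add_mem_sup (Ideal.mul_mem_right _ _ hy) (Ideal.mul_mem_right _ _ hz)

end ClosedIdeal

/-- `ℂ⟨H, E, F⟩⟦r, ħ⟧`, with inner variable `r` and outer variable `ħ`. -/
def FreeQ : Type := (FreeAlgebra ℂ Gen)⟦X⟧⟦X⟧

instance : Ring FreeQ := inferInstanceAs (Ring (FreeAlgebra ℂ Gen)⟦X⟧⟦X⟧)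

instance : Algebra Crh FreeQ :=
  letI := seriesAlgebra ℂ (FreeAlgebra ℂ Gen)
  seriesAlgebra ℂ⟦X⟧ (FreeAlgebra ℂ Gen)⟦X⟧

/-- The inclusion of `ℂ⟨H, E, F⟩⟦r⟧`. -/
def FreeQ.ofSeries : (FreeAlgebra ℂ Gen)⟦X⟧ →+* FreeQ := PowerSeries.C

/-- The generators of the free algebra. -/
def FreeQ.gen (g : Gen) : FreeQ := FreeQ.ofSeries (PowerSeries.C (FreeAlgebra.ι ℂ g))

/-- The relations `[H, E] = 2ħE`, `[H, F] = -2ħF`, `EF - FE = ħ (e^{rH} - e^{-rH}) / (2r)`. -/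
def relQ : Set FreeQ :=
  {FreeQ.gen .H * FreeQ.gen .E - FreeQ.gen .E * FreeQ.gen .H - (2 * hh) • FreeQ.gen .E,
   FreeQ.gen .H * FreeQ.gen .F - FreeQ.gen .F * FreeQ.gen .H + (2 * hh) • FreeQ.gen .F,
   FreeQ.gen .E * FreeQ.gen .F - FreeQ.gen .F * FreeQ.gen .E -
     hh • FreeQ.ofSeries (sinhDiv (FreeAlgebra.ι ℂ Gen.H))}

/-- The two-parameter quantum group `U_q^ħ(sl₂)`, `q = e^{-r}`, topologically generated over
`ℂ⟦r, ħ⟧` by `H, E, F`. -/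
def UQ : Type := FreeQ ⧸ closedIdeal Crh relQ

instance : Ring UQ := inferInstanceAs (Ring (FreeQ ⧸ closedIdeal Crh relQ))

instance : Algebra Crh UQ := inferInstanceAs (Algebra Crh (FreeQ ⧸ closedIdeal Crh relQ))

/-- The generators `H, E, F` of `U_q^ħ(sl₂)`. -/
def UQ.gen (g : Gen) : UQ := Ideal.Quotient.mk (closedIdeal Crh relQ) (FreeQ.gen g)

/-- The element `e^{t r H}` of `U_q^ħ(sl₂)`. -/
def UQ.exp (t : ℂ) : UQ :=
  Ideal.Quotient.mk (closedIdeal Crh relQ) (FreeQ.ofSeries (expS t (FreeAlgebra.ι ℂ Gen.H)))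

/-- The Lie algebra `sl₂` of traceless complex matrices. -/
abbrev sl2 : Type := LieAlgebra.SpecialLinear.sl (Fin 2) ℂ

/-- The basis `H, E, F` of `sl₂`. -/
def sl2Gen : Gen → sl2
  | .H => ⟨!![1, 0; 0, -1], by simp [LieAlgebra.SpecialLinear.sl, Matrix.trace_fin_two]⟩
  | .E => ⟨!![0, 1; 0, 0], by simp [LieAlgebra.SpecialLinear.sl, Matrix.trace_fin_two]⟩
  | .F => ⟨!![0, 0; 1, 0], by simp [LieAlgebra.SpecialLinear.sl, Matrix.trace_fin_two]⟩

/-- `T(sl₂)⟦ħ⟧`. -/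
def TensorH : Type := (TensorAlgebra ℂ sl2)⟦X⟧

instance : Ring TensorH := inferInstanceAs (Ring (TensorAlgebra ℂ sl2)⟦X⟧)

instance : Algebra Ch TensorH := seriesAlgebra ℂ (TensorAlgebra ℂ sl2)

/-- The inclusion of `sl₂` in `T(sl₂)⟦ħ⟧`. -/
def TensorH.ι (x : sl2) : TensorH :=
  PowerSeries.C (R := TensorAlgebra ℂ sl2) (TensorAlgebra.ι ℂ x)

/-- The relations `x ⊗ y - y ⊗ x = ħ [x, y]`. -/
def relH : Set TensorH :=
  {t | ∃ x y : sl2, t = TensorH.ι x * TensorH.ι y - TensorH.ι y * TensorH.ι x -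
    (PowerSeries.X : Ch) • TensorH.ι ⁅x, y⁆}

/-- The (`ħ`-adically completed) enveloping algebra `U^ħ(sl₂)` over `ℂ⟦ħ⟧`. -/
def UH : Type := TensorH ⧸ closedIdeal Ch relH

instance : Ring UH := inferInstanceAs (Ring (TensorH ⧸ closedIdeal Ch relH))

instance : Algebra Ch UH := inferInstanceAs (Algebra Ch (TensorH ⧸ closedIdeal Ch relH))

/-- The canonical map `sl₂ → U^ħ(sl₂)`. -/
def UH.ι (x : sl2) : UH := Ideal.Quotient.mk (closedIdeal Ch relH) (TensorH.ι x)

/-- `ℂ[su₂*] = ℂ[H, E, F]`: the complex polynomial functions in the coordinates `H, E, F`. -/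
abbrev Flat : Type := MvPolynomial Gen ℂ

/-- The linear function `f_x` on `su₂*` attached to `x ∈ sl₂ = su₂ ⊗ ℂ`; it sends the matrices
`H, E, F` to the coordinates `H, E, F`. -/
def Flat.linear (x : sl2) : Flat :=
  MvPolynomial.C (x.1 0 0) * MvPolynomial.X .H + MvPolynomial.C (x.1 0 1) * MvPolynomial.X .E +
    MvPolynomial.C (x.1 1 0) * MvPolynomial.X .F

/-- The (`r`-adically completed) coordinate algebra `ℂ[(SU₂*)_r] = ℂ[H, E, F]⟦r⟧`, in which the
coordinates `e^{± r H / 2}` are formal exponentials. -/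
abbrev Curved : Type := Flat⟦X⟧

/-- The coordinate functions `H, E, F` on `(SU₂*)_r`. -/
def Curved.gen (g : Gen) : Curved := PowerSeries.C (MvPolynomial.X g)

/-- The function `e^{t r H}` on `(SU₂*)_r`. -/
def Curved.exp (t : ℂ) : Curved := expS t (MvPolynomial.X Gen.H)

/-- The lower triangular component of the tautological point of `(SU₂*)_r ⊂ B × B⁺`. -/
def Curved.lower : Matrix (Fin 2) (Fin 2) Curved :=
  !![Curved.exp (1 / 2), 0; 2 * PowerSeries.X * Curved.gen .F, Curved.exp (-1 / 2)]

/-- The upper triangular component of the tautological point of `(SU₂*)_r ⊂ B × B⁺`. -/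
def Curved.upper : Matrix (Fin 2) (Fin 2) Curved :=
  !![Curved.exp (-1 / 2), 2 * PowerSeries.X * Curved.gen .E; 0, Curved.exp (1 / 2)]

/-! ### Structure constants -/

/-- The involution `†` on generators: `H† = H`, `E† = F`, `F† = E`. -/
def Gen.dag : Gen → Gen
  | .H => .H
  | .E => .F
  | .F => .E

/-- The values of the coproduct `Δ_r` on an algebra with elements `x H, x E, x F` and
`ex t = e^{t r H}`: `e^{± r H / 2}` is group-like, `H` is primitive (the same, divided by `r`), and
`Δ_r(Y) = Y ⊗ e^{r H / 2} + e^{- r H / 2} ⊗ Y` for `Y = E, F`. -/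
structure IsCurvedCoproduct {R A : Type*} [CommRing R] [IsLocalRing R] [Ring A] [Algebra R A]
    (hA : AdicHopf R A) (x : Gen → A) (ex : ℂ → A) : Prop where
  exp_pos : hA.comul (ex (1 / 2)) = ctmul R (ex (1 / 2)) (ex (1 / 2))
  exp_neg : hA.comul (ex (-1 / 2)) = ctmul R (ex (-1 / 2)) (ex (-1 / 2))
  H : hA.comul (x .H) = ctmul R (x .H) 1 + ctmul R 1 (x .H)
  E : hA.comul (x .E) = ctmul R (x .E) (ex (1 / 2)) + ctmul R (ex (-1 / 2)) (x .E)
  F : hA.comul (x .F) = ctmul R (x .F) (ex (1 / 2)) + ctmul R (ex (-1 / 2)) (x .F)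

/-- The values of the trivial coproduct `Δ₀` on an algebra with a map `ι` from `sl₂`: the elements
of `sl₂` are primitive. -/
def IsTrivialCoproduct {R A : Type*} [CommRing R] [IsLocalRing R] [Ring A] [Algebra R A]
    (hA : AdicHopf R A) (ι : sl2 → A) : Prop :=
  ∀ x, hA.comul (ι x) = ctmul R (ι x) 1 + ctmul R 1 (ι x)

end CurvedQuantum

end

open CurvedQuantum

open scoped TensorProduct PowerSeries

noncomputable section

/-! Everything is reduced to truncations modulo powers of the maximal ideal 𝔪. In an algebra killed
by 𝔪ⁿ the parameters act nilpotently, so e^{trH} and (e^{rH} − e^{−rH})/(2r) become finite sums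
(`texp`, `tsinh`), and identities between them are values of power series identities (`evSeries`). A
quotient by a closed ideal is Hausdorff, and a continuous map into a Hausdorff algebra descends to
it as soon as it kills the relations (`closedIdeal_le_ker`). Since H, E, F generate topologically
(`TopGen`), equalities may be tested on them modulo each 𝔪ⁿ.

Hopf structure. The coproduct is assembled from algebra maps A → A/𝔪ⁿ ⊗ A/𝔪ⁿ. The one real
computation is `IsUQRel.twistedTensor`: in the commutator of Δ(E) and Δ(F) the mixed terms cancel,
because both carry the same scalar e^{±rħ}, and the remaining two terms add up by the addition
formula `sinhDiv_add`. Coassociativity and the counit laws compare algebra maps on generators. The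
antipode laws are not statements about algebra maps, but the set where they hold is closed under
products because S reverses products. The trivial coproduct is the case κ = κ' = 1, so one argument
serves all four algebras.

Flatness. The deformation conditions require that the quantum algebras be as large as power series
over polynomials, a Poincaré–Birkhoff–Witt statement: ordered monomials F^a E^c H^b give an
isomorphism (`UQ.polyEquiv`, `UH.polyEquiv`). Surjectivity is a complete form of Nakayama, since
modulo 𝔪 the algebra is commutative and generated by H, E, F. Injectivity uses Verma-type modules
with basis F^a E^c v, where Hv = lv and E acts freely on v instead of killing it. There F^a E^c H^b
v = l^b F^a E^c v, so matrix coefficients read off the part of each weight evaluated at H = l, and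
infinitely many l ∈ ℂ separate polynomials. Completeness of the quantum algebras also comes from
this isomorphism, and in these coordinates the arrows of the square are constant-term maps, for the
left arrow after the exchange of r and ħ.

Quantization. Freeness allows division by ħ, so [a, b]/ħ is a biderivation; so is the Poisson
bracket, and it is enough to compare them on generators (`commutator_of_gens`). The Jacobi identity
holds for every bracket with {H, E} = 2E, {H, F} = −2F and {E, F} a function of H
(`isPoissonBracket_derivBracket`). Compatibility with the involutions and commutativity of the
square follow by density. -/

namespace CurvedQuantum

/-! ### Modules killed by a power of 𝔪, and topological generation. -/

section Generic

variable {R A : Type*} [CommRing R] [IsLocalRing R] [Ring A] [Algebra R A]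

/-- An `R`-module killed by the `n`-th power of the maximal ideal. -/
def KilledBy (R : Type*) (B : Type*) [CommRing R] [IsLocalRing R] [AddCommGroup B] [Module R B]
    (n : ℕ) : Prop :=
  ∀ c ∈ IsLocalRing.maximalIdeal R ^ n, ∀ b : B, c • b = 0

theorem killedBy_trunc (n : ℕ) : KilledBy R (Trunc R A n) n := fun r hr a => by
  obtain ⟨a, rfl⟩ := Trunc.mk_surjective n a
  rw [← map_smul, Trunc.mk_eq_zero, mem_adicIdeal]
  exact Submodule.smul_mem_smul hr Submodule.mem_top

theorem killedBy_tensor (n : ℕ) : KilledBy R (Trunc R A n ⊗[R] Trunc R A n) n :=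
  fun _ hr t => smul_trunc_tensor hr t

theorem KilledBy.map_eq_zero {B : Type*} [AddCommGroup B] [Module R B] {n : ℕ}
    (hB : KilledBy R B n) (f : A →ₗ[R] B) {a : A} (ha : a ∈ adicIdeal R A n) : f a = 0 := by
  rw [mem_adicIdeal] at ha
  refine Submodule.smul_induction_on (p := fun a => f a = 0) ha (fun r hr y _ => ?_)
    (fun y z hy hz => ?_)
  · rw [map_smul, hB r hr]
  · rw [map_add, hy, hz, add_zero]

theorem KilledBy.tensor {B C : Type*} [AddCommGroup B] [Module R B] [AddCommGroup C] [Module R C]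
    {n : ℕ} (hB : KilledBy R B n) : KilledBy R (B ⊗[R] C) n := fun r hr t => by
  induction t with
  | zero => simp
  | add x y hx hy => rw [smul_add, hx, hy, add_zero]
  | tmul x y => rw [TensorProduct.smul_tmul', hB r hr, TensorProduct.zero_tmul]

variable (R) in
/-- The family `x` generates `A` topologically. -/
def TopGen (x : Gen → A) : Prop :=
  ∀ n a, ∃ b ∈ Algebra.adjoin R (Set.range x), a - b ∈ adicIdeal R A n

/-- Approximation modulo 𝔪 bootstraps: an error in 𝔪ⁿA is a sum of terms c • z with c ∈ 𝔪ⁿ, and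
approximating each z modulo 𝔪 pushes the error into 𝔪ⁿ⁺¹A. -/
theorem TopGen.of_one {x : Gen → A}
    (h : ∀ a, ∃ b ∈ Algebra.adjoin R (Set.range x), a - b ∈ adicIdeal R A 1) : TopGen R x := by
  intro n
  induction n with
  | zero => exact fun a => ⟨0, zero_mem _, by simp [mem_adicIdeal]⟩
  | succ n ih =>
    intro a
    obtain ⟨b, hb, hab⟩ := ih a
    suffices H : ∀ y ∈ (IsLocalRing.maximalIdeal R ^ n • ⊤ : Submodule R A),
        ∃ b ∈ Algebra.adjoin R (Set.range x), y - b ∈ adicIdeal R A (n + 1) by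
      obtain ⟨b', hb', h'⟩ := H _ hab
      exact ⟨b + b', add_mem hb hb', by rwa [← sub_sub]⟩
    intro y hy
    refine Submodule.smul_induction_on hy (fun r hr z _ => ?_) ?_
    · obtain ⟨b, hb, hz⟩ := h z
      refine ⟨r • b, Subalgebra.smul_mem _ hb r, ?_⟩
      rw [mem_adicIdeal, pow_one] at hz
      rw [mem_adicIdeal, ← smul_sub, pow_succ, mul_smul]
      exact Submodule.smul_mem_smul hr hz
    · rintro y z ⟨b, hb, hy⟩ ⟨c, hc, hz⟩
      exact ⟨b + c, add_mem hb hc, by rw [add_sub_add_comm]; exact add_mem hy hz⟩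

/-- The level n is fixed and the property is asked outright on 𝔪ⁿA. This suits conditions that are
verified modulo each 𝔪ⁿ separately and then combined by the Hausdorff property. -/
theorem TopGen.induction {x : Gen → A} (hx : TopGen R x) (n : ℕ) {P : A → Prop}
    (add : ∀ a b, P a → P b → P (a + b)) (mul : ∀ a b, P a → P b → P (a * b))
    (alg : ∀ c, P (algebraMap R A c)) (gen : ∀ g, P (x g)) (ideal : ∀ a ∈ adicIdeal R A n, P a)
    (a : A) : P a := by
  obtain ⟨b, hb, hab⟩ := hx n a
  rw [← sub_add_cancel a b]
  refine add _ _ (ideal _ hab) ?_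
  clear hab
  induction hb using Algebra.adjoin_induction with
  | mem y hy => obtain ⟨g, rfl⟩ := hy; exact gen g
  | algebraMap c => exact alg c
  | add a b _ _ ha hb => exact add a b ha hb
  | mul a b _ _ ha hb => exact mul a b ha hb

/-- Continuity is automatic: linearity sends 𝔪ⁿA into 𝔪ⁿB = 0. -/
theorem TopGen.algHom_ext {x : Gen → A} (hx : TopGen R x) {B : Type*} [Ring B] [Algebra R B]
    {n : ℕ} (hB : KilledBy R B n) {f g : A →ₐ[R] B} (h : ∀ i, f (x i) = g (x i)) : f = g := by
  ext a
  induction a using hx.induction n with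
  | add a b ha hb => rw [map_add, map_add, ha, hb]
  | mul a b ha hb => rw [map_mul, map_mul, ha, hb]
  | alg c => rw [AlgHom.commutes, AlgHom.commutes]
  | gen i => exact h i
  | ideal a ha => exact (hB.map_eq_zero f.toLinearMap ha).trans (hB.map_eq_zero g.toLinearMap ha).symm

theorem TopGen.trunc_algHom_ext {x : Gen → A} (hx : TopGen R x) {B : Type*} [Ring B] [Algebra R B]
    {n : ℕ} (hB : KilledBy R B n) {f g : Trunc R A n →ₐ[R] B}
    (h : ∀ i, f (Trunc.mk R A n (x i)) = g (Trunc.mk R A n (x i))) : f = g := by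
  have h' : f.comp (Trunc.mk R A n) = g.comp (Trunc.mk R A n) := hx.algHom_ext hB h
  ext a
  obtain ⟨a, rfl⟩ := Trunc.mk_surjective n a
  exact DFunLike.congr_fun h' a

/-! ### Building the coproduct level by level -/

theorem transition_mk (n : ℕ) (a : A) :
    transition R A n (Trunc.mk R A (n + 1) a) = Trunc.mk R A n a := rfl

theorem CTensor.ext {x y : CTensor R A} (h : ∀ n, x.1 n = y.1 n) : x = y := Subtype.ext (funext h)

/-- A compatible family of algebra maps to the truncated tensor squares. -/
def comulOfFamily (f : ∀ n, A →ₐ[R] Trunc R A n ⊗[R] Trunc R A n)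
    (hf : ∀ n, (Algebra.TensorProduct.map (transition R A n) (transition R A n)).comp (f (n + 1)) =
      f n) : A →ₐ[R] CTensor R A :=
  (AlgHom.pi f).codRestrict (CTensor R A) fun a =>
    mem_CTensor.2 fun n => DFunLike.congr_fun (hf n) a

theorem comulOfFamily_val {f : ∀ n, A →ₐ[R] Trunc R A n ⊗[R] Trunc R A n} (hf) (a : A) (n : ℕ) :
    (comulOfFamily f hf a).1 n = f n a := rfl

theorem comulTrunc_mk (Δ : A →ₐ[R] CTensor R A) (n : ℕ) (a : A) :
    comulTrunc Δ n (Trunc.mk R A n a) = (Δ a).1 n := rfl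

theorem ctmul_val (a b : A) (n : ℕ) :
    (ctmul R a b).1 n = Trunc.mk R A n a ⊗ₜ Trunc.mk R A n b := rfl

theorem CTensor.add_val (x y : CTensor R A) (n : ℕ) : (x + y).1 n = x.1 n + y.1 n := rfl

theorem CTensor.smul_val (c : R) (x : CTensor R A) (n : ℕ) : (c • x).1 n = c • x.1 n := rfl

theorem smul_ctmul (c : R) (a b : A) : ctmul R (c • a) b = c • ctmul R a b :=
  CTensor.ext fun n => by
    rw [CTensor.smul_val, ctmul_val, ctmul_val, map_smul, TensorProduct.smul_tmul']

theorem ctmul_smul (c : R) (a b : A) : ctmul R a (c • b) = c • ctmul R a b :=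
  CTensor.ext fun n => by
    rw [CTensor.smul_val, ctmul_val, ctmul_val, map_smul, TensorProduct.tmul_smul]

theorem ctmul_add (a b c : A) : ctmul R a (b + c) = ctmul R a b + ctmul R a c :=
  CTensor.ext fun n => by
    rw [CTensor.add_val, ctmul_val, ctmul_val, ctmul_val, map_add, TensorProduct.tmul_add]

theorem add_ctmul (a b c : A) : ctmul R (a + b) c = ctmul R a c + ctmul R b c :=
  CTensor.ext fun n => by
    rw [CTensor.add_val, ctmul_val, ctmul_val, ctmul_val, map_add, TensorProduct.add_tmul]

theorem zero_ctmul (a : A) : ctmul R 0 a = 0 := CTensor.ext fun n => by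
  rw [ctmul_val, map_zero, TensorProduct.zero_tmul]; rfl

theorem ctmul_zero (a : A) : ctmul R a 0 = 0 := CTensor.ext fun n => by
  rw [ctmul_val, map_zero, TensorProduct.tmul_zero]; rfl

/-! ### Hopf algebras from values on generators -/

/-- The values of a coproduct on generators: `H` is primitive, `E` and `F` are twisted primitive
with respect to the group-like element `κ` with inverse `κ'`. -/
structure IsTwistedCoproduct (Δ : A →ₐ[R] CTensor R A) (x : Gen → A) (κ κ' : A) : Prop where
  inv : κ * κ' = 1
  inv' : κ' * κ = 1
  pos : Δ κ = ctmul R κ κ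
  neg : Δ κ' = ctmul R κ' κ'
  H : Δ (x .H) = ctmul R (x .H) 1 + ctmul R 1 (x .H)
  E : Δ (x .E) = ctmul R (x .E) κ + ctmul R κ' (x .E)
  F : Δ (x .F) = ctmul R (x .F) κ + ctmul R κ' (x .F)

namespace IsTwistedCoproduct

variable {Δ : A →ₐ[R] CTensor R A} {x : Gen → A} {κ κ' : A} (h : IsTwistedCoproduct Δ x κ κ')
include h

theorem trunc_pos (n : ℕ) : comulTrunc Δ n (Trunc.mk R A n κ) =
    Trunc.mk R A n κ ⊗ₜ Trunc.mk R A n κ := by rw [comulTrunc_mk, h.pos, ctmul_val]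

theorem trunc_neg (n : ℕ) : comulTrunc Δ n (Trunc.mk R A n κ') =
    Trunc.mk R A n κ' ⊗ₜ Trunc.mk R A n κ' := by rw [comulTrunc_mk, h.neg, ctmul_val]

theorem trunc_H (n : ℕ) : comulTrunc Δ n (Trunc.mk R A n (x .H)) =
    Trunc.mk R A n (x .H) ⊗ₜ 1 + 1 ⊗ₜ Trunc.mk R A n (x .H) := by
  rw [comulTrunc_mk, h.H, CTensor.add_val, ctmul_val, ctmul_val, map_one]

theorem trunc_E (n : ℕ) : comulTrunc Δ n (Trunc.mk R A n (x .E)) =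
    Trunc.mk R A n (x .E) ⊗ₜ Trunc.mk R A n κ + Trunc.mk R A n κ' ⊗ₜ Trunc.mk R A n (x .E) := by
  rw [comulTrunc_mk, h.E, CTensor.add_val, ctmul_val, ctmul_val]

theorem trunc_F (n : ℕ) : comulTrunc Δ n (Trunc.mk R A n (x .F)) =
    Trunc.mk R A n (x .F) ⊗ₜ Trunc.mk R A n κ + Trunc.mk R A n κ' ⊗ₜ Trunc.mk R A n (x .F) := by
  rw [comulTrunc_mk, h.F, CTensor.add_val, ctmul_val, ctmul_val]

/-- Both sides are algebra maps into an algebra killed by 𝔪ⁿ, so they need only be compared on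
generators. For E and F the comparison uses that κ and κ' are group-like. -/
theorem coassoc (hx : TopGen R x) (n : ℕ) : (TensorProduct.assoc R _ _ _).toLinearMap ∘ₗ
      (comulTrunc Δ n).toLinearMap.rTensor (Trunc R A n) ∘ₗ (comulTrunc Δ n).toLinearMap =
    (comulTrunc Δ n).toLinearMap.lTensor (Trunc R A n) ∘ₗ (comulTrunc Δ n).toLinearMap := by
  have key : ((Algebra.TensorProduct.assoc R R R (Trunc R A n) (Trunc R A n)
        (Trunc R A n)).toAlgHom.comp (Algebra.TensorProduct.map (comulTrunc Δ n)
          (AlgHom.id R (Trunc R A n)))).comp (comulTrunc Δ n) =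
      (Algebra.TensorProduct.map (AlgHom.id R (Trunc R A n)) (comulTrunc Δ n)).comp
        (comulTrunc Δ n) := by
    refine hx.trunc_algHom_ext (n := n) (killedBy_trunc n).tensor fun i => ?_
    cases i with
    | H => simp [h.trunc_H, TensorProduct.add_tmul, TensorProduct.tmul_add,
        Algebra.TensorProduct.one_def, add_assoc]
    | E => simp [h.trunc_E, h.trunc_pos, h.trunc_neg, TensorProduct.add_tmul,
        TensorProduct.tmul_add, add_assoc]
    | F => simp [h.trunc_F, h.trunc_pos, h.trunc_neg, TensorProduct.add_tmul,
        TensorProduct.tmul_add, add_assoc]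
  ext a
  exact DFunLike.congr_fun key a

end IsTwistedCoproduct

end Generic

/-! ### Counit and antipode laws, and compatibility of maps with coproducts, from values on
generators. -/

section Generic

variable {R A : Type*} [CommRing R] [IsLocalRing R] [Ring A] [Algebra R A]

theorem truncMap_counit (ε : A →ₐ[R] R) (n : ℕ) (a : A) :
    truncMap ((Algebra.ofId R A).comp ε).toLinearMap n (Trunc.mk R A n a) =
      algebraMap R (Trunc R A n) (ε a) := by
  rw [truncMap_mk]
  exact (Trunc.mk R A n).commutes (ε a)

/-- The values of a counit and of an antipode matching a twisted primitive coproduct. -/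
structure IsTwistedAntipode (ε : A →ₐ[R] R) (S : A →ₗ[R] A) (x : Gen → A) (κ κ' : A) :
    Prop where
  counit_gen : ∀ g, ε (x g) = 0
  counit_pos : ε κ = 1
  counit_neg : ε κ' = 1
  one : S 1 = 1
  antimul : ∀ a b, S (a * b) = S b * S a
  H : S (x .H) = -x .H
  E : S (x .E) = -(κ * x .E * κ')
  F : S (x .F) = -(κ * x .F * κ')
  pos : S κ = κ'
  neg : S κ' = κ

section

variable {Δ : A →ₐ[R] CTensor R A} {ε : A →ₐ[R] R} {S : A →ₗ[R] A} {x : Gen → A} {κ κ' : A}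
  (h : IsTwistedCoproduct Δ x κ κ') (h' : IsTwistedAntipode ε S x κ κ') (hx : TopGen R x)
include h h' hx

/-- Scalars are central, so applying ε to one factor and the identity to the other, then
multiplying, is an algebra map; it is compared with the identity on generators. -/
theorem twisted_counit_left (n : ℕ) : LinearMap.mul' R (Trunc R A n) ∘ₗ
      (truncMap ((Algebra.ofId R A).comp ε).toLinearMap n).rTensor (Trunc R A n) ∘ₗ
      (comulTrunc Δ n).toLinearMap = LinearMap.id := by
  let f : Trunc R A n →ₐ[R] Trunc R A n :=
    AlgHom.ofLinearMap (truncMap ((Algebra.ofId R A).comp ε).toLinearMap n)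
      (by rw [← map_one (Trunc.mk R A n), truncMap_counit]; simp)
      (fun a b => by
        obtain ⟨a, rfl⟩ := Trunc.mk_surjective n a
        obtain ⟨b, rfl⟩ := Trunc.mk_surjective n b
        rw [← map_mul, truncMap_counit, truncMap_counit, truncMap_counit, map_mul, map_mul])
  have hf : ∀ a, f (Trunc.mk R A n a) = algebraMap R (Trunc R A n) (ε a) := truncMap_counit ε n
  have key : (Algebra.TensorProduct.lift f (AlgHom.id R (Trunc R A n)) (fun a b => by
        obtain ⟨a, rfl⟩ := Trunc.mk_surjective n a
        rw [hf]
        exact Algebra.commutes _ _)).comp (comulTrunc Δ n) = AlgHom.id R _ := by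
    refine hx.trunc_algHom_ext (n := n) (killedBy_trunc n) fun i => ?_
    cases i with
    | H => simp [h.trunc_H, hf, h'.counit_gen]
    | E => simp [h.trunc_E, hf, h'.counit_gen, h'.counit_neg]
    | F => simp [h.trunc_F, hf, h'.counit_gen, h'.counit_neg]
  refine LinearMap.ext fun a => (Eq.trans ?_ (DFunLike.congr_fun key a))
  simp only [LinearMap.comp_apply, AlgHom.comp_apply, AlgHom.toLinearMap_apply]
  generalize comulTrunc Δ n a = t
  induction t with
  | zero => simp
  | add u v hu hv => rw [map_add, map_add, map_add, hu, hv]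
  | tmul u v => simp [f]

theorem twisted_counit_right (n : ℕ) : LinearMap.mul' R (Trunc R A n) ∘ₗ
      (truncMap ((Algebra.ofId R A).comp ε).toLinearMap n).lTensor (Trunc R A n) ∘ₗ
      (comulTrunc Δ n).toLinearMap = LinearMap.id := by
  let f : Trunc R A n →ₐ[R] Trunc R A n :=
    AlgHom.ofLinearMap (truncMap ((Algebra.ofId R A).comp ε).toLinearMap n)
      (by rw [← map_one (Trunc.mk R A n), truncMap_counit]; simp)
      (fun a b => by
        obtain ⟨a, rfl⟩ := Trunc.mk_surjective n a
        obtain ⟨b, rfl⟩ := Trunc.mk_surjective n b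
        rw [← map_mul, truncMap_counit, truncMap_counit, truncMap_counit, map_mul, map_mul])
  have hf : ∀ a, f (Trunc.mk R A n a) = algebraMap R (Trunc R A n) (ε a) := truncMap_counit ε n
  have key : (Algebra.TensorProduct.lift (AlgHom.id R (Trunc R A n)) f (fun a b => by
        obtain ⟨b, rfl⟩ := Trunc.mk_surjective n b
        rw [hf]
        exact (Algebra.commutes _ _).symm)).comp (comulTrunc Δ n) = AlgHom.id R _ := by
    refine hx.trunc_algHom_ext (n := n) (killedBy_trunc n) fun i => ?_
    cases i with
    | H => simp [h.trunc_H, hf, h'.counit_gen]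
    | E => simp [h.trunc_E, hf, h'.counit_gen, h'.counit_pos]
    | F => simp [h.trunc_F, hf, h'.counit_gen, h'.counit_pos]
  refine LinearMap.ext fun a => (Eq.trans ?_ (DFunLike.congr_fun key a))
  simp only [LinearMap.comp_apply, AlgHom.comp_apply, AlgHom.toLinearMap_apply]
  generalize comulTrunc Δ n a = t
  induction t with
  | zero => simp
  | add u v hu hv => rw [map_add, map_add, map_add, hu, hv]
  | tmul u v => simp [f]

/-- Multiplication after S ⊗ id is not an algebra map. Writing L for it, antimultiplicativity gives
L(u(p ⊗ q)) = S(p) L(u) q, so if L(u) is a scalar it can be pulled out. Hence the law passes from a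
and b to ab, and generators suffice. -/
theorem twisted_antipode_left (n : ℕ) : LinearMap.mul' R (Trunc R A n) ∘ₗ
      (truncMap S n).rTensor (Trunc R A n) ∘ₗ (comulTrunc Δ n).toLinearMap =
    truncMap ((Algebra.ofId R A).comp ε).toLinearMap n := by
  set L : Trunc R A n ⊗[R] Trunc R A n →ₗ[R] Trunc R A n :=
    LinearMap.mul' R (Trunc R A n) ∘ₗ (truncMap S n).rTensor (Trunc R A n) with hL
  have hLt : ∀ a b : A, L (Trunc.mk R A n a ⊗ₜ Trunc.mk R A n b) = Trunc.mk R A n (S a * b) := by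
    intro a b
    simp [hL, truncMap_mk]
  have hmul : ∀ (u v : Trunc R A n ⊗[R] Trunc R A n) (c : R), L u = algebraMap R _ c →
      L (u * v) = c • L v := by
    intro u v c hu
    induction v with
    | zero => simp
    | add v w hv hw => rw [mul_add, map_add, map_add, hv, hw, smul_add]
    | tmul p q =>
      obtain ⟨p, rfl⟩ := Trunc.mk_surjective n p
      obtain ⟨q, rfl⟩ := Trunc.mk_surjective n q
      have : L (u * (Trunc.mk R A n p ⊗ₜ Trunc.mk R A n q)) =
          Trunc.mk R A n (S p) * L u * Trunc.mk R A n q := by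
        clear hu
        induction u with
        | zero => simp
        | add v w hv hw => rw [add_mul, map_add, map_add, hv, hw, mul_add, add_mul]
        | tmul a b =>
          obtain ⟨a, rfl⟩ := Trunc.mk_surjective n a
          obtain ⟨b, rfl⟩ := Trunc.mk_surjective n b
          simp only [Algebra.TensorProduct.tmul_mul_tmul, ← map_mul (Trunc.mk R A n), hLt,
            h'.antimul, mul_assoc]
      rw [this, hu, hLt, ← Algebra.commutes, mul_assoc, ← map_mul, Algebra.smul_def]
  refine LinearMap.ext fun a => ?_
  obtain ⟨a, rfl⟩ := Trunc.mk_surjective n a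
  change L (comulTrunc Δ n (Trunc.mk R A n a)) = _
  rw [truncMap_counit]
  induction a using hx.induction n with
  | add a b ha hb => simp only [map_add, ha, hb]
  | mul a b ha hb => rw [map_mul, map_mul, hmul _ _ _ ha, hb, map_mul, map_mul, Algebra.smul_def]
  | alg c =>
    rw [AlgHom.commutes, AlgHom.commutes, AlgHom.commutes, Algebra.algebraMap_eq_smul_one,
      map_smul, Algebra.TensorProduct.one_def, ← map_one (Trunc.mk R A n), hLt, h'.one, one_mul,
      map_one, ← Algebra.algebraMap_eq_smul_one]
    rfl
  | gen i =>
    rw [h'.counit_gen, map_zero]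
    cases i with
    | H =>
      rw [h.trunc_H, ← map_one (Trunc.mk R A n), map_add, hLt, hLt, h'.one, h'.H, ← map_add]
      simp
    | E =>
      rw [h.trunc_E, map_add, hLt, hLt, h'.neg, h'.E, ← map_add, neg_mul, mul_assoc, h.inv']
      simp
    | F =>
      rw [h.trunc_F, map_add, hLt, hLt, h'.neg, h'.F, ← map_add, neg_mul, mul_assoc, h.inv']
      simp
  | ideal a ha =>
    rw [Trunc.mk_eq_zero.2 ha, map_zero, map_zero, ← truncMap_counit, Trunc.mk_eq_zero.2 ha,
      map_zero]

/-- The mirror image: now L((p ⊗ q)v) = p L(v) S(q), so in a product it is the right factor whose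
value is pulled out as a scalar. -/
theorem twisted_antipode_right (n : ℕ) : LinearMap.mul' R (Trunc R A n) ∘ₗ
      (truncMap S n).lTensor (Trunc R A n) ∘ₗ (comulTrunc Δ n).toLinearMap =
    truncMap ((Algebra.ofId R A).comp ε).toLinearMap n := by
  set L : Trunc R A n ⊗[R] Trunc R A n →ₗ[R] Trunc R A n :=
    LinearMap.mul' R (Trunc R A n) ∘ₗ (truncMap S n).lTensor (Trunc R A n) with hL
  have hLt : ∀ a b : A, L (Trunc.mk R A n a ⊗ₜ Trunc.mk R A n b) = Trunc.mk R A n (a * S b) := by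
    intro a b
    simp [hL, truncMap_mk]
  have hmul : ∀ (u v : Trunc R A n ⊗[R] Trunc R A n) (c : R), L v = algebraMap R _ c →
      L (u * v) = c • L u := by
    intro u v c hv
    induction u with
    | zero => simp
    | add u w hu hw => rw [add_mul, map_add, map_add, hu, hw, smul_add]
    | tmul p q =>
      obtain ⟨p, rfl⟩ := Trunc.mk_surjective n p
      obtain ⟨q, rfl⟩ := Trunc.mk_surjective n q
      have : L ((Trunc.mk R A n p ⊗ₜ Trunc.mk R A n q) * v) =
          Trunc.mk R A n p * L v * Trunc.mk R A n (S q) := by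
        clear hv
        induction v with
        | zero => simp
        | add v w hv hw => rw [mul_add, map_add, map_add, hv, hw, mul_add, add_mul]
        | tmul a b =>
          obtain ⟨a, rfl⟩ := Trunc.mk_surjective n a
          obtain ⟨b, rfl⟩ := Trunc.mk_surjective n b
          simp only [Algebra.TensorProduct.tmul_mul_tmul, ← map_mul (Trunc.mk R A n), hLt,
            h'.antimul, mul_assoc]
      rw [this, hv, hLt, ← Algebra.commutes, mul_assoc, ← map_mul, Algebra.smul_def]
  refine LinearMap.ext fun a => ?_
  obtain ⟨a, rfl⟩ := Trunc.mk_surjective n a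
  change L (comulTrunc Δ n (Trunc.mk R A n a)) = _
  rw [truncMap_counit]
  induction a using hx.induction n with
  | add a b ha hb => simp only [map_add, ha, hb]
  | mul a b ha hb =>
    rw [map_mul, map_mul, hmul _ _ _ hb, ha, map_mul, map_mul, Algebra.smul_def,
      ← map_mul (algebraMap R _), ← map_mul (algebraMap R _), mul_comm]
  | alg c =>
    rw [AlgHom.commutes, AlgHom.commutes, AlgHom.commutes, Algebra.algebraMap_eq_smul_one,
      map_smul, Algebra.TensorProduct.one_def, ← map_one (Trunc.mk R A n), hLt, h'.one, one_mul,
      map_one, ← Algebra.algebraMap_eq_smul_one]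
    rfl
  | gen i =>
    rw [h'.counit_gen, map_zero]
    cases i with
    | H =>
      rw [h.trunc_H, ← map_one (Trunc.mk R A n), map_add, hLt, hLt, h'.one, h'.H, ← map_add]
      simp
    | E =>
      rw [h.trunc_E, map_add, hLt, hLt, h'.pos, h'.E, ← map_add, mul_neg, ← mul_assoc,
        ← mul_assoc, h.inv']
      simp
    | F =>
      rw [h.trunc_F, map_add, hLt, hLt, h'.pos, h'.F, ← map_add, mul_neg, ← mul_assoc,
        ← mul_assoc, h.inv']
      simp
  | ideal a ha =>
    rw [Trunc.mk_eq_zero.2 ha, map_zero, map_zero, ← truncMap_counit, Trunc.mk_eq_zero.2 ha,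
      map_zero]

end

/-- The Hopf algebra defined by a twisted primitive coproduct on topological generators. -/
def twistedHopf (hA : IsAdicComplete (IsLocalRing.maximalIdeal R) A) {x : Gen → A}
    (hx : TopGen R x) {Δ : A →ₐ[R] CTensor R A} {ε : A →ₐ[R] R} {S : A →ₗ[R] A} {κ κ' : A}
    (h : IsTwistedCoproduct Δ x κ κ') (h' : IsTwistedAntipode ε S x κ κ') : AdicHopf R A where
  complete := hA
  comul := Δ
  counit := ε
  antipode := S
  coassoc := h.coassoc hx
  counit_left := twisted_counit_left h h' hx
  counit_right := twisted_counit_right h h' hx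
  antipode_left := twisted_antipode_left h h' hx
  antipode_right := twisted_antipode_right h h' hx

theorem ctMap_val {S B : Type*} [CommRing S] [IsLocalRing S] [Ring B] [Algebra S B]
    {σ : R →+* S} [IsLocalHom σ] (f : A →ₛₗ[σ] B) (x : CTensor R A) (n : ℕ) :
    (ctMap f x).1 n = TensorProduct.map (truncMap f n) (truncMap f n) (x.1 n) := rfl

/-- Semilinear multiplicative maps preserving generators and group-likes are compatible with the
coproducts. -/
theorem twisted_map_comul {S B : Type*} [CommRing S] [IsLocalRing S] [Ring B] [Algebra S B]
    {σ : R →+* S} [IsLocalHom σ] (f : A →ₛₗ[σ] B) (f_one : f 1 = 1)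
    (f_mul : ∀ a b, f (a * b) = f a * f b) {x : Gen → A} (hx : TopGen R x) {y : Gen → B}
    {Δ : A →ₐ[R] CTensor R A} {Δ' : B →ₐ[S] CTensor S B} {κ κ' : A} {μ μ' : B}
    (h : IsTwistedCoproduct Δ x κ κ') (h' : IsTwistedCoproduct Δ' y μ μ')
    (hg : ∀ g, f (x g) = y g) (hκ : f κ = μ) (hκ' : f κ' = μ') (a : A) :
    ctMap f (Δ a) = Δ' (f a) := by
  refine CTensor.ext fun n => ?_
  rw [ctMap_val, ← comulTrunc_mk, ← comulTrunc_mk]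
  -- The map is only semilinear, so multiplicativity of its tensor square is checked on pure tensors
  -- instead of being inherited from a tensor product of algebra maps.
  have hmul : ∀ u v : Trunc R A n ⊗[R] Trunc R A n,
      TensorProduct.map (truncMap f n) (truncMap f n) (u * v) =
        TensorProduct.map (truncMap f n) (truncMap f n) u *
          TensorProduct.map (truncMap f n) (truncMap f n) v := by
    intro u v
    induction u with
    | zero => simp
    | add u w hu hw => rw [add_mul, map_add, map_add, hu, hw, add_mul]
    | tmul p q =>
      induction v with
      | zero => simp
      | add v w hv hw => rw [mul_add, map_add, map_add, hv, hw, mul_add]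
      | tmul s t =>
        obtain ⟨p, rfl⟩ := Trunc.mk_surjective n p
        obtain ⟨q, rfl⟩ := Trunc.mk_surjective n q
        obtain ⟨s, rfl⟩ := Trunc.mk_surjective n s
        obtain ⟨t, rfl⟩ := Trunc.mk_surjective n t
        simp only [Algebra.TensorProduct.tmul_mul_tmul, ← map_mul, TensorProduct.map_tmul,
          truncMap_mk, f_mul]
  induction a using hx.induction n with
  | add a b ha hb => simp only [map_add, ha, hb]
  | mul a b ha hb => rw [f_mul, map_mul, map_mul, hmul, ha, hb, map_mul, map_mul]
  | alg c =>
    rw [Algebra.algebraMap_eq_smul_one, map_smulₛₗ f, f_one, map_smul, map_smul, map_one, map_one,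
      map_smulₛₗ (TensorProduct.map _ _), map_smul, map_smul, map_one (Trunc.mk S B n), map_one (comulTrunc Δ' n), Algebra.TensorProduct.one_def,
      TensorProduct.map_tmul, ← map_one (Trunc.mk R A n), truncMap_mk, f_one,
      map_one (Trunc.mk S B n)]
    rfl
  | gen i =>
    rw [hg]
    cases i with
    | H =>
      rw [h.trunc_H, h'.trunc_H, ← map_one (Trunc.mk R A n), map_add, TensorProduct.map_tmul,
        TensorProduct.map_tmul, truncMap_mk, truncMap_mk, f_one, hg, map_one]
    | E =>
      rw [h.trunc_E, h'.trunc_E, map_add, TensorProduct.map_tmul,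
        TensorProduct.map_tmul, truncMap_mk, truncMap_mk, truncMap_mk, hg, hκ, hκ']
    | F =>
      rw [h.trunc_F, h'.trunc_F, map_add, TensorProduct.map_tmul,
        TensorProduct.map_tmul, truncMap_mk, truncMap_mk, truncMap_mk, hg, hκ, hκ']
  | ideal a ha =>
    rw [Trunc.mk_eq_zero.2 ha, Trunc.mk_eq_zero.2 (map_mem_adicIdeal f n ha)]
    simp only [map_zero]

/-- Antilinear antimultiplicative maps exchanging `E` and `F` and fixing the group-likes are
compatible with the coproduct. -/
theorem twisted_isHopfStar {conj : R →+* R} [IsLocalHom conj] (hA : AdicHopf R A)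
    {x : Gen → A} (hx : TopGen R x) {κ κ' : A} (h : IsTwistedCoproduct hA.comul x κ κ')
    (hε : ∀ g, hA.counit (x g) = 0) (hconj : ∀ c, conj (conj c) = c)
    (haus : IsHausdorff (IsLocalRing.maximalIdeal R) R)
    (f : A →ₛₗ[conj] A) (f_one : f 1 = 1) (f_mul : ∀ a b, f (a * b) = f b * f a)
    (hg : ∀ g, f (x g) = x g.dag) (hκ : f κ = κ) (hκ' : f κ' = κ') : IsHopfStar hA f where
  involutive a := by
    have := hA.complete.toIsHausdorff
    refine (IsHausdorff.eq_iff_smodEq (I := IsLocalRing.maximalIdeal R)).2 fun n => ?_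
    rw [SModEq.sub_mem, ← mem_adicIdeal]
    induction a using hx.induction n with
    | add a b ha hb => rw [map_add, map_add, add_sub_add_comm]; exact add_mem ha hb
    | mul a b ha hb =>
      rw [f_mul, f_mul]
      have : f (f a) * f (f b) - a * b = (f (f a) - a) * f (f b) + a * (f (f b) - b) := by
        noncomm_ring
      rw [this]
      exact add_mem (Ideal.mul_mem_right _ _ ha) (Ideal.mul_mem_left _ _ hb)
    | alg c =>
      rw [Algebra.algebraMap_eq_smul_one, map_smulₛₗ, f_one, map_smulₛₗ, f_one, hconj, sub_self]
      exact zero_mem _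
    | gen i =>
      rw [hg, hg]
      have : i.dag.dag = i := by cases i <;> rfl
      rw [this, sub_self]
      exact zero_mem _
    | ideal a ha =>
      exact sub_mem (map_mem_adicIdeal f n (map_mem_adicIdeal f n ha)) ha
  antimul := f_mul
  comul a := by
    refine CTensor.ext fun n => ?_
    rw [ctMap_val, ← comulTrunc_mk, ← comulTrunc_mk]
    have hmul : ∀ u v : Trunc R A n ⊗[R] Trunc R A n,
        TensorProduct.map (truncMap f n) (truncMap f n) (u * v) =
          TensorProduct.map (truncMap f n) (truncMap f n) v *
            TensorProduct.map (truncMap f n) (truncMap f n) u := by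
      intro u v
      induction u with
      | zero => simp
      | add u w hu hw => rw [add_mul, map_add, map_add, hu, hw, mul_add]
      | tmul p q =>
        induction v with
        | zero => simp
        | add v w hv hw => rw [mul_add, map_add, map_add, hv, hw, add_mul]
        | tmul s t =>
          obtain ⟨p, rfl⟩ := Trunc.mk_surjective n p
          obtain ⟨q, rfl⟩ := Trunc.mk_surjective n q
          obtain ⟨s, rfl⟩ := Trunc.mk_surjective n s
          obtain ⟨t, rfl⟩ := Trunc.mk_surjective n t
          simp only [Algebra.TensorProduct.tmul_mul_tmul, ← map_mul, TensorProduct.map_tmul,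
            truncMap_mk, f_mul]
    induction a using hx.induction n with
    | add a b ha hb => simp only [map_add, ha, hb]
    | mul a b ha hb => rw [f_mul, map_mul, map_mul, ha, hb, map_mul, map_mul, hmul]
    | alg c =>
      rw [Algebra.algebraMap_eq_smul_one, map_smulₛₗ, f_one, map_smul, map_smul, map_one, map_one,
        map_smul, map_smul, map_smulₛₗ, map_one, map_one, Algebra.TensorProduct.one_def,
        TensorProduct.map_tmul, ← map_one (Trunc.mk R A n), truncMap_mk, f_one]
    | gen i =>
      rw [hg]
      cases i with
      | H =>
        simp only [Gen.dag]
        rw [h.trunc_H, ← map_one (Trunc.mk R A n), map_add, TensorProduct.map_tmul,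
          TensorProduct.map_tmul, truncMap_mk, truncMap_mk, f_one, hg]
        rfl
      | E =>
        simp only [Gen.dag]
        rw [h.trunc_E, h.trunc_F, map_add, TensorProduct.map_tmul,
          TensorProduct.map_tmul, truncMap_mk, truncMap_mk, truncMap_mk, hg, hκ, hκ']
        rfl
      | F =>
        simp only [Gen.dag]
        rw [h.trunc_F, h.trunc_E, map_add, TensorProduct.map_tmul,
          TensorProduct.map_tmul, truncMap_mk, truncMap_mk, truncMap_mk, hg, hκ, hκ']
        rfl
    | ideal a ha =>
      rw [Trunc.mk_eq_zero.2 ha, Trunc.mk_eq_zero.2 (map_mem_adicIdeal f n ha)]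
      simp only [map_zero]
  counit a := by
    refine (IsHausdorff.eq_iff_smodEq (I := IsLocalRing.maximalIdeal R)).2 fun n => ?_
    rw [SModEq.sub_mem, ← mem_adicIdeal]
    induction a using hx.induction n with
    | add a b ha hb => simp only [map_add, add_sub_add_comm]; exact add_mem ha hb
    | mul a b ha hb =>
      rw [f_mul, map_mul, map_mul, map_mul]
      have : hA.counit (f b) * hA.counit (f a) - conj (hA.counit a) * conj (hA.counit b) =
          (hA.counit (f a) - conj (hA.counit a)) * hA.counit (f b) +
            conj (hA.counit a) * (hA.counit (f b) - conj (hA.counit b)) := by ring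
      rw [this]
      exact add_mem (Ideal.mul_mem_right _ _ ha) (Ideal.mul_mem_left _ _ hb)
    | alg c =>
      rw [Algebra.algebraMap_eq_smul_one, map_smulₛₗ, f_one, map_smul, map_smul, map_one,
        smul_eq_mul, smul_eq_mul, mul_one, mul_one, sub_self]
      exact zero_mem _
    | gen i => rw [hg, hε, hε, map_zero, sub_zero]; exact zero_mem _
    | ideal a ha =>
      refine sub_mem (map_mem_adicIdeal hA.counit.toLinearMap n (map_mem_adicIdeal f n ha)) ?_
      have h1 : hA.counit a ∈ adicIdeal R R n := map_mem_adicIdeal hA.counit.toLinearMap n ha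
      rw [mem_adicIdeal, smul_eq_mul, Ideal.mul_top] at h1 ⊢
      have h2 := Ideal.mem_map_of_mem conj h1
      rw [Ideal.map_pow] at h2
      exact Ideal.pow_right_mono (Ideal.map_le_iff_le_comap.2 (map_nonunit conj)) n h2

end Generic

/-! ### The commutator condition -/

theorem IsPoissonBracket.antisymm {k A : Type*} [CommRing k] [CommRing A] [Algebra k A]
    {br : A →ₗ[k] A →ₗ[k] A} (h : IsPoissonBracket br) (a b : A) : br a b = -br b a := by
  have := h.self (a + b)
  simp only [map_add, LinearMap.add_apply, h.self, zero_add, add_zero] at this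
  exact eq_neg_of_add_eq_zero_left (by rwa [add_comm] at this)

theorem IsPoissonBracket.one_left {k A : Type*} [CommRing k] [CommRing A] [Algebra k A]
    {br : A →ₗ[k] A →ₗ[k] A} (h : IsPoissonBracket br) (a : A) : br 1 a = 0 := by
  have := h.leibniz a 1 1
  simp only [mul_one, one_mul, left_eq_add] at this
  rw [h.antisymm, this, neg_zero]

section Commutator

variable {k R A B : Type*} [CommRing k] [CommRing R] [IsLocalRing k]
    [IsLocalRing R] [Ring A] [Algebra R A] [CommRing B] [Algebra k B] (e : R ≃+* k⟦X⟧)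

/-- Freeness makes z cancellable, so C(a, b) = [a, b]/z is well defined; it is antisymmetric, and
linear and a derivation in its first argument. The Poisson bracket has the same properties. Two such
operations that agree through π on generators agree modulo every power of the maximal ideal of k,
hence agree because B is Hausdorff. -/
theorem commutator_of_gens (hB : IsHausdorff (IsLocalRing.maximalIdeal k) B)
    {br : B →ₗ[k] B →ₗ[k] B} (hbr : IsPoissonBracket br) (π : A →ₛₗ[redHom e] B)
    (map_one : π 1 = 1) (map_mul : ∀ a b, π (a * b) = π a * π b)
    (free : ∃ φ : A ≃+ B⟦X⟧,
      (∀ s a, φ (s • a) = PowerSeries.map (algebraMap k B) (e s) * φ a) ∧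
        ∀ a, PowerSeries.constantCoeff (φ a) = π a)
    {x : Gen → A} (hx : TopGen R x)
    (hg : ∀ i j, ∃ c, x i * x j - x j * x i = e.symm PowerSeries.X • c ∧
      π c = br (π (x i)) (π (x j))) (a b : A) :
    ∃ c, a * b - b * a = e.symm PowerSeries.X • c ∧ π c = br (π a) (π b) := by
  obtain ⟨φ, hφ, hφ0⟩ := free
  have hφX : ∀ a, φ (e.symm PowerSeries.X • a) = PowerSeries.X * φ a := fun a => by
    rw [hφ]; simp
  have tf : ∀ {a b : A}, e.symm (PowerSeries.X : k⟦X⟧) • a = e.symm PowerSeries.X • b → a = b := by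
    intro a b hab
    have := congrArg φ hab
    rw [hφX, hφX] at this
    apply φ.injective
    ext n
    simpa [PowerSeries.coeff_succ_X_mul] using congrArg (PowerSeries.coeff (n + 1)) this
  -- In the coordinates given by φ, the map π is the constant term, so its kernel consists of
  -- multiples of z. As B is commutative, all commutators lie there.
  have hker : ∀ a, π a = 0 → ∃ c, a = e.symm (PowerSeries.X : k⟦X⟧) • c := by
    intro a ha
    rw [← hφ0, ← PowerSeries.X_dvd_iff] at ha
    obtain ⟨g, hg⟩ := ha
    exact ⟨φ.symm g, φ.injective (by rw [hφX, hg, φ.apply_symm_apply])⟩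
  have hex : ∀ a b : A, ∃ c, a * b - b * a = e.symm (PowerSeries.X : k⟦X⟧) • c := fun a b =>
    hker _ (by rw [map_sub, map_mul, map_mul, mul_comm, sub_self])
  choose C hC using hex
  have C_add : ∀ a a' b, C (a + a') b = C a b + C a' b := fun a a' b => tf (by
    rw [smul_add, ← hC, ← hC, ← hC]; noncomm_ring)
  have C_smul : ∀ (r : R) a b, C (r • a) b = r • C a b := fun r a b => tf (by
    rw [smul_comm, ← hC, ← hC, smul_sub, smul_mul_assoc, mul_smul_comm])
  have C_mul : ∀ a a' b, C (a * a') b = a * C a' b + C a b * a' := fun a a' b => tf (by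
    rw [smul_add, ← mul_smul_comm, ← smul_mul_assoc, ← hC, ← hC, ← hC]; noncomm_ring)
  have C_symm : ∀ a b, C a b = -C b a := fun a b => tf (by
    rw [smul_neg, ← hC, ← hC]; noncomm_ring)
  let CL : A → A →ₗ[R] A := fun b =>
    { toFun := fun a => C a b
      map_add' := fun a a' => C_add a a' b
      map_smul' := fun r a => C_smul r a b }
  have br_mul : ∀ f f' g, br (f * f') g = f * br f' g + br f g * f' := fun f f' g => by
    rw [hbr.antisymm, hbr.leibniz, hbr.antisymm f', hbr.antisymm f]; ring
  refine ⟨C a b, hC a b, ?_⟩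
  refine (IsHausdorff.eq_iff_smodEq (I := IsLocalRing.maximalIdeal k)).2 fun n => ?_
  rw [SModEq.sub_mem, ← mem_adicIdeal]
  -- With the second argument fixed, agreement spreads from generators to all first arguments.
  -- Antisymmetry then exchanges the arguments, so the step can be used twice.
  have step : ∀ b, (∀ i, π (C (x i) b) - br (π (x i)) (π b) ∈ adicIdeal k B n) →
      ∀ a, π (C a b) - br (π a) (π b) ∈ adicIdeal k B n := by
    intro b hb a
    induction a using hx.induction n with
    | add a a' ha ha' =>
      rw [C_add, map_add, map_add, map_add, LinearMap.add_apply, add_sub_add_comm]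
      exact add_mem ha ha'
    | mul a a' ha ha' =>
      have : π (C (a * a') b) - br (π (a * a')) (π b) =
          π a * (π (C a' b) - br (π a') (π b)) + (π (C a b) - br (π a) (π b)) * π a' := by
        rw [C_mul, map_add, map_mul, map_mul, map_mul, br_mul]; ring
      rw [this]
      exact add_mem (Ideal.mul_mem_left _ _ ha') (Ideal.mul_mem_right _ _ ha)
    | alg c =>
      have h1 : C (1 : A) b = 0 := tf (by rw [← hC]; simp)
      rw [Algebra.algebraMap_eq_smul_one, C_smul, h1, smul_zero, map_zero, map_smulₛₗ, map_one,
        map_smul, LinearMap.smul_apply, hbr.one_left, smul_zero, sub_zero]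
      exact zero_mem _
    | gen i => exact hb i
    | ideal a ha =>
      exact sub_mem (map_mem_adicIdeal π n (map_mem_adicIdeal (CL b) n ha))
        (map_mem_adicIdeal (br.flip (π b)) n (map_mem_adicIdeal π n ha))
  have h1 : ∀ j a, π (C a (x j)) - br (π a) (π (x j)) ∈ adicIdeal k B n := fun j =>
    step _ fun i => by
      obtain ⟨c, hc, hc'⟩ := hg i j
      rw [hC] at hc
      rw [tf hc, hc', sub_self]
      exact zero_mem _
  refine step b (fun i => ?_) a
  have := h1 i b
  rw [C_symm, hbr.antisymm (π b), map_neg, sub_neg_eq_add, neg_add_eq_sub] at this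
  exact (Submodule.neg_mem_iff _).1 (by rwa [neg_sub])

end Commutator

/-! ### Poisson brackets from commuting derivations -/

section Derivations

variable {k A : Type*} [CommRing k] [CommRing A] [Algebra k A]

/-- The bracket with `{H, E} = 2E`, `{H, F} = -2F`, `{E, F} = s`. -/
def derivBracket (dH dE dF : Derivation k A A) (E F s : A) : A →ₗ[k] A →ₗ[k] A :=
  LinearMap.mk₂ k (fun f g => 2 * E * (dH f * dE g - dE f * dH g) -
      2 * F * (dH f * dF g - dF f * dH g) + s * (dE f * dF g - dF f * dE g))
    (fun a b c => by simp only [map_add]; ring)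
    (fun r a b => by
      simp only [Derivation.map_smul]; simp only [Algebra.smul_def]; ring)
    (fun a b c => by simp only [map_add]; ring)
    (fun r a b => by
      simp only [Derivation.map_smul]; simp only [Algebra.smul_def]; ring)

theorem derivBracket_apply (dH dE dF : Derivation k A A) (E F s f g : A) :
    derivBracket dH dE dF E F s f g = 2 * E * (dH f * dE g - dE f * dH g) -
      2 * F * (dH f * dF g - dF f * dH g) + s * (dE f * dF g - dF f * dE g) := rfl

/-- The three derivations play the role of the partial derivatives in H, E, F, and s depends on H
alone. On coordinates the Jacobi sum is {H, s} + {E, 2F} + {F, 2E} = 0 + 2s − 2s. Leaving s general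
covers both s = H and s = (e^{rH} − e^{−rH})/(2r). -/
theorem isPoissonBracket_derivBracket {dH dE dF : Derivation k A A} {E F s : A}
    (hHE : ∀ a, dE (dH a) = dH (dE a)) (hHF : ∀ a, dF (dH a) = dH (dF a))
    (hEF : ∀ a, dF (dE a) = dE (dF a)) (h1 : dH E = 0) (h2 : dE E = 1) (h3 : dF E = 0)
    (h4 : dH F = 0) (h5 : dE F = 0) (h6 : dF F = 1) (h7 : dE s = 0) (h8 : dF s = 0) :
    IsPoissonBracket (derivBracket dH dE dF E F s) where
  self a := by rw [derivBracket_apply]; ring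
  leibniz a b c := by
    simp only [derivBracket_apply, Derivation.leibniz, smul_eq_mul]; ring
  jacobi a b c := by
    have two : ∀ d : Derivation k A A, d 2 = 0 := fun d => by
      exact_mod_cast d.map_natCast 2
    simp only [derivBracket_apply, map_add, map_sub, Derivation.leibniz, smul_eq_mul, two, hHE,
      hHF, hEF, h1, h2, h3, h4, h5, h6, h7, h8]
    ring

end Derivations

/-! ### Completeness of power series modules -/

section Complete

variable {k N : Type*} [CommRing k] [CommRing N] [Algebra k N]

theorem coeff_smul_powerSeries (c : k⟦X⟧) (g : N⟦X⟧) (n : ℕ) : PowerSeries.coeff n (c • g) =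
    ∑ p ∈ Finset.HasAntidiagonal.antidiagonal n, PowerSeries.coeff p.1 c • PowerSeries.coeff p.2 g := by
  rw [Algebra.smul_def, PowerSeries.coeff_mul]
  refine Finset.sum_congr rfl fun p _ => ?_
  rw [Algebra.smul_def]
  rfl

theorem C_smul_C (c : k) (y : N) : (PowerSeries.C c : k⟦X⟧) • (PowerSeries.C y : N⟦X⟧) =
    PowerSeries.C (c • y) := by
  rw [Algebra.smul_def, Algebra.smul_def, map_mul]
  congr 1
  exact PowerSeries.map_C _ _

theorem X_pow_smul (i : ℕ) (g : N⟦X⟧) : (PowerSeries.X ^ i : k⟦X⟧) • g = PowerSeries.X ^ i * g := by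
  rw [Algebra.smul_def]
  congr 1
  exact (map_pow (PowerSeries.map (algebraMap k N)) _ _).trans (by rw [PowerSeries.map_X])

theorem exists_eq_sum_add_X_pow_mul {S : Type*} [Ring S] (g : S⟦X⟧) (n : ℕ) :
    ∃ g' : S⟦X⟧, g = ∑ i ∈ Finset.range n,
      PowerSeries.X ^ i * PowerSeries.C (PowerSeries.coeff i g) + PowerSeries.X ^ n * g' := by
  have : PowerSeries.X ^ n ∣ g - ∑ i ∈ Finset.range n,
      PowerSeries.X ^ i * PowerSeries.C (PowerSeries.coeff i g) := by
    rw [PowerSeries.X_pow_dvd_iff]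
    intro m hm
    simp only [map_sub, map_sum, PowerSeries.coeff_X_pow_mul', PowerSeries.coeff_C]
    rw [Finset.sum_eq_single m]
    · simp
    · intro b _ hb
      by_cases h : b ≤ m
      · rw [if_pos h, if_neg (by omega)]
      · rw [if_neg h]
    · intro h; exact absurd (Finset.mem_range.2 hm) h
  obtain ⟨g', hg'⟩ := this
  exact ⟨g', by rw [← hg']; abel⟩

variable [IsLocalRing k]

theorem constantCoeff_mem_maximalIdeal {c : k⟦X⟧} :
    c ∈ IsLocalRing.maximalIdeal k⟦X⟧ ↔
      PowerSeries.constantCoeff c ∈ IsLocalRing.maximalIdeal k := by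
  rw [IsLocalRing.mem_maximalIdeal, IsLocalRing.mem_maximalIdeal, mem_nonunits_iff,
    mem_nonunits_iff, PowerSeries.isUnit_iff_constantCoeff]

/-- In a product, each factor from the maximal ideal either contributes its constant term, which
lies in the maximal ideal of k, or uses up at least one power of X. The truncated subtraction makes
the claim empty once i ≥ n. -/
theorem coeff_mem_of_mem_pow {n : ℕ} {c : k⟦X⟧} (hc : c ∈ IsLocalRing.maximalIdeal k⟦X⟧ ^ n)
    (i : ℕ) : PowerSeries.coeff i c ∈ IsLocalRing.maximalIdeal k ^ (n - i) := by
  induction n generalizing c i with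
  | zero => simp
  | succ n ih =>
    rw [pow_succ] at hc
    refine Submodule.mul_induction_on hc (fun a ha b hb => ?_) (fun a b ha hb => ?_)
    · rw [PowerSeries.coeff_mul]
      refine sum_mem fun p hp => ?_
      rw [Finset.HasAntidiagonal.mem_antidiagonal] at hp
      rcases Nat.eq_zero_or_pos p.2 with h0 | h0
      · rw [h0]
        have h1 := ih ha p.1
        have h2 : PowerSeries.coeff 0 b ∈ IsLocalRing.maximalIdeal k := by
          rw [PowerSeries.coeff_zero_eq_constantCoeff_apply]
          exact constantCoeff_mem_maximalIdeal.1 hb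
        refine Ideal.pow_le_pow_right (n := n - p.1 + 1) (by omega) ?_
        rw [pow_succ]
        exact Ideal.mul_mem_mul h1 h2
      · exact Ideal.pow_le_pow_right (by omega) (Ideal.mul_mem_right _ _ (ih ha p.1))
    · rw [map_add]
      exact add_mem ha hb

theorem X_mem_maximalIdeal : (PowerSeries.X : k⟦X⟧) ∈ IsLocalRing.maximalIdeal k⟦X⟧ :=
  constantCoeff_mem_maximalIdeal.2 (by simp)

theorem C_mem_maximalIdeal_pow {n : ℕ} {c : k} (hc : c ∈ IsLocalRing.maximalIdeal k ^ n) :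
    (PowerSeries.C c : k⟦X⟧) ∈ IsLocalRing.maximalIdeal k⟦X⟧ ^ n := by
  have h := Ideal.mem_map_of_mem (PowerSeries.C (R := k)) hc
  rw [Ideal.map_pow] at h
  exact Ideal.pow_right_mono (Ideal.map_le_iff_le_comap.2 fun a ha =>
    constantCoeff_mem_maximalIdeal.2 (by simpa using ha)) n h

/-- For the converse only the coefficients below n matter: the term of degree i < n uses 𝔪ⁿ = 𝔪ⁱ
𝔪ⁿ⁻ⁱ with Xⁱ ∈ 𝔪ⁱ, and the tail is a multiple of Xⁿ. The criterion makes the adic topology of N⟦X⟧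
coefficientwise. -/
theorem mem_pow_smul_top_powerSeries {n : ℕ} {g : N⟦X⟧} :
    g ∈ (IsLocalRing.maximalIdeal k⟦X⟧ ^ n • ⊤ : Submodule k⟦X⟧ N⟦X⟧) ↔
      ∀ i, PowerSeries.coeff i g ∈ (IsLocalRing.maximalIdeal k ^ (n - i) • ⊤ : Submodule k N) := by
  constructor
  · intro hg
    refine Submodule.smul_induction_on hg (fun c hc y _ i => ?_) (fun y z hy hz i => ?_)
    · rw [coeff_smul_powerSeries]
      refine sum_mem fun p hp => Submodule.smul_mem_smul ?_ Submodule.mem_top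
      rw [Finset.HasAntidiagonal.mem_antidiagonal] at hp
      exact Ideal.pow_le_pow_right (by omega) (coeff_mem_of_mem_pow hc p.1)
    · rw [map_add]
      exact add_mem (hy i) (hz i)
  · intro hg
    obtain ⟨g', hg'⟩ := exists_eq_sum_add_X_pow_mul g n
    rw [hg']
    refine add_mem (sum_mem fun i hi => ?_) ?_
    · rw [Finset.mem_range] at hi
      rw [← X_pow_smul (k := k)]
      have : IsLocalRing.maximalIdeal k⟦X⟧ ^ n =
          IsLocalRing.maximalIdeal k⟦X⟧ ^ i * IsLocalRing.maximalIdeal k⟦X⟧ ^ (n - i) := by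
        rw [← pow_add]; congr 1; omega
      rw [this, mul_smul]
      refine Submodule.smul_mem_smul (Ideal.pow_mem_pow X_mem_maximalIdeal i) ?_
      refine Submodule.smul_induction_on (p := fun y => (PowerSeries.C y : N⟦X⟧) ∈ _) (hg i)
        (fun c hc y _ => ?_) (fun y z hy hz => ?_)
      · rw [← C_smul_C]
        exact Submodule.smul_mem_smul (C_mem_maximalIdeal_pow hc) Submodule.mem_top
      · rw [map_add]
        exact add_mem hy hz
    · rw [← X_pow_smul (k := k)]
      exact Submodule.smul_mem_smul (Ideal.pow_mem_pow X_mem_maximalIdeal n) Submodule.mem_top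

instance isAdicComplete_powerSeries [IsAdicComplete (IsLocalRing.maximalIdeal k) N] :
    IsAdicComplete (IsLocalRing.maximalIdeal k⟦X⟧) N⟦X⟧ where
  haus' g hg := by
    ext i
    rw [map_zero]
    refine IsHausdorff.haus (I := IsLocalRing.maximalIdeal k) inferInstance _ fun n => ?_
    have := hg (n + i)
    rw [SModEq.zero, mem_pow_smul_top_powerSeries] at this
    rw [SModEq.zero]
    simpa using this i
  prec' f hf := by
    -- A congruence modulo the power n + i controls the i-th coefficient only modulo the power n, so
    -- the i-th coefficients are taken along the sequence shifted by i.
    have hco : ∀ i, ∃ L : N, ∀ n, PowerSeries.coeff i (f (n + i)) ≡ L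
        [SMOD (IsLocalRing.maximalIdeal k ^ n • ⊤ : Submodule k N)] := fun i => by
      refine IsPrecomplete.prec (I := IsLocalRing.maximalIdeal k) inferInstance fun {m n} hmn => ?_
      have := hf (Nat.add_le_add_right hmn i)
      rw [SModEq.sub_mem, mem_pow_smul_top_powerSeries] at this
      rw [SModEq.sub_mem, ← map_sub]
      simpa using this i
    choose L hL using hco
    refine ⟨PowerSeries.mk L, fun n => ?_⟩
    rw [SModEq.sub_mem, mem_pow_smul_top_powerSeries]
    intro i
    rw [map_sub, PowerSeries.coeff_mk, ← SModEq.sub_mem]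
    by_cases h : i ≤ n
    · have := hL i (n - i)
      rwa [Nat.sub_add_cancel h] at this
    · rw [Nat.sub_eq_zero_of_le (by omega), SModEq.sub_mem, pow_zero, Ideal.one_eq_top,
        Submodule.top_smul]
      exact Submodule.mem_top

/-- The maximal ideal of ℂ is zero, so every complex vector space is complete. Adjoining power
series variables to Flat = ℂ[H, E, F] one at a time then gives completeness over ℂ⟦r⟧ and ℂ⟦r, ħ⟧.
-/
instance isAdicComplete_field {V : Type*} [AddCommGroup V] [Module ℂ V] :
    IsAdicComplete (IsLocalRing.maximalIdeal ℂ) V := by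
  rw [IsLocalRing.maximalIdeal_eq_bot]
  infer_instance

end Complete

/-! ### Evaluation of power series at nilpotent central elements -/

section Evaluation

variable {B : Type*} [Ring B]

/-- Evaluation of a power series over `B` at a central element `z` with `zⁿ = 0`. -/
def evNil (z : B) (n : ℕ) (hz : ∀ b, Commute z b) (hn : z ^ n = 0) : B⟦X⟧ →+* B where
  toFun f := ∑ i ∈ Finset.range n, PowerSeries.coeff i f * z ^ i
  map_zero' := by simp
  map_add' f g := by simp [add_mul, Finset.sum_add_distrib]
  map_one' := by
    cases n with
    -- For n = 0 the hypothesis reads 1 = 0, so the empty sum is the unit.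
    | zero => simpa using hn.symm
    | succ n => rw [Finset.sum_range_succ']; simp [PowerSeries.coeff_one]
  map_mul' f g := by
    simp only [PowerSeries.coeff_mul, Finset.Nat.sum_antidiagonal_eq_sum_range_succ_mk,
      Finset.sum_mul]
    rw [Finset.sum_congr rfl (g := fun m => ∑ k ∈ Finset.range (m + 1),
      (fun i j => PowerSeries.coeff i f * PowerSeries.coeff j g * z ^ (i + j)) k (m - k))]
    · refine (Finset.sum_range_diag_flip n
        (fun i j => PowerSeries.coeff i f * PowerSeries.coeff j g * z ^ (i + j))).trans ?_
      refine Finset.sum_congr rfl fun i hi => ?_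
      rw [Finset.mul_sum, ← Finset.sum_subset (Finset.range_mono (Nat.sub_le n i))]
      · refine Finset.sum_congr rfl fun j _ => ?_
        rw [pow_add, mul_assoc, mul_assoc, ← mul_assoc (z ^ i),
          ((hz (PowerSeries.coeff j g)).pow_left i).eq, mul_assoc]
      -- Pairs with i + j ≥ n do not occur in the truncated product; they contribute a power of z
      -- that vanishes.
      · intro j _ hj
        rw [Finset.mem_range, not_lt] at hj
        rw [mul_assoc, ← mul_assoc (z ^ i), ((hz (PowerSeries.coeff j g)).pow_left i).eq, mul_assoc,
          ← pow_add, pow_eq_zero_of_le (by omega) hn, mul_zero, mul_zero]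
    · intro m _
      refine Finset.sum_congr rfl fun k hk => ?_
      rw [Finset.mem_range] at hk
      simp only
      congr 2
      omega

theorem evNil_apply (z : B) (n : ℕ) (hz : ∀ b, Commute z b) (hn : z ^ n = 0) (f : B⟦X⟧) :
    evNil z n hz hn f = ∑ i ∈ Finset.range n, PowerSeries.coeff i f * z ^ i := rfl

theorem evNil_C (z : B) (n : ℕ) (hz : ∀ b, Commute z b) (hn : z ^ n = 0) (b : B) :
    evNil z n hz hn (PowerSeries.C b) = b := by
  rw [evNil_apply]
  cases n with
  | zero =>
    have h1 : (1 : B) = 0 := by simpa using hn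
    rw [Finset.range_zero, Finset.sum_empty, ← mul_one b, h1, mul_zero]
  | succ n => rw [Finset.sum_range_succ']; simp [PowerSeries.coeff_C]

/-- Evaluation of a power series over a `k`-algebra `A` at a nilpotent scalar `z`. -/
def evSeries {R A : Type*} [CommRing R] [Ring A] [Algebra R B] (z : R) (n : ℕ)
    (hn : ∀ b : B, z ^ n • b = 0) (f : A →+* B) : A⟦X⟧ →+* B :=
  (evNil (algebraMap R B z) n (Algebra.commute_algebraMap_left z)
    (by rw [← map_pow, Algebra.algebraMap_eq_smul_one, hn])).comp (PowerSeries.map f)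

section

variable {R A : Type*} [CommRing R] [Ring A] [Algebra R B] {z : R} {n : ℕ}
  (hn : ∀ b : B, z ^ n • b = 0)

theorem evSeries_apply (f : A →+* B) (g : A⟦X⟧) : evSeries z n hn f g =
    ∑ i ∈ Finset.range n, z ^ i • f (PowerSeries.coeff i g) := by
  rw [evSeries, RingHom.comp_apply, evNil_apply]
  refine Finset.sum_congr rfl fun i _ => ?_
  rw [PowerSeries.coeff_map, ← map_pow, ← Algebra.commutes, ← Algebra.smul_def]

theorem evSeries_C (f : A →+* B) (a : A) : evSeries z n hn f (PowerSeries.C a) = f a := by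
  rw [evSeries, RingHom.comp_apply, PowerSeries.map_C, evNil_C]

theorem evSeries_map {A' : Type*} [Ring A'] (f : A →+* B) (g : A' →+* A) (c : A'⟦X⟧) :
    evSeries z n hn f (PowerSeries.map g c) = evSeries z n hn (f.comp g) c := by
  simp [evSeries_apply]

/-- A ring map sending X to z is automatically continuous here: f is a polynomial of degree below n
plus Xⁿg, and the last term goes to zⁿ times something, which is zero. So the map is determined by
its restriction to constants. -/
theorem evSeries_ringHom {k : Type*} [CommRing k] (α : k⟦X⟧ →+* B)
    (hα : α PowerSeries.X = algebraMap R B z) (f : k⟦X⟧) :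
    evSeries z n hn (α.comp PowerSeries.C) f = α f := by
  obtain ⟨g, hg⟩ := exists_eq_sum_add_X_pow_mul f n
  conv_rhs => rw [hg]
  rw [evSeries_apply, map_add, map_sum, map_mul, map_pow, hα, ← map_pow, ← Algebra.smul_def, hn,
    add_zero]
  refine Finset.sum_congr rfl fun i _ => ?_
  rw [map_mul, map_pow, hα, ← map_pow, ← Algebra.smul_def]
  rfl

end

end Evaluation

/-! ### Formal exponentials -/

section Exponentials

variable {B : Type*} [Ring B]

theorem X_mul_cancel {a b : B⟦X⟧} (h : (PowerSeries.X : B⟦X⟧) * a = PowerSeries.X * b) : a = b := by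
  ext k
  simpa [PowerSeries.coeff_succ_X_mul] using congrArg (PowerSeries.coeff (k + 1)) h

theorem pow_mul_of_bracket {h e c : B} (hhe : h * e = e * (h + c)) (k : ℕ) :
    h ^ k * e = e * (h + c) ^ k := by
  induction k with
  | zero => simp
  | succ k ih => rw [pow_succ, mul_assoc, hhe, ← mul_assoc, ih, mul_assoc, pow_succ]

variable [Algebra ℂ B]

theorem coeff_expS (t : ℂ) (h : B) (k : ℕ) :
    PowerSeries.coeff k (expS t h) = (t ^ k / (k.factorial : ℂ)) • h ^ k :=
  PowerSeries.coeff_mk _ _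

theorem coeff_sinhDiv (h : B) (k : ℕ) : PowerSeries.coeff k (sinhDiv h) =
    ((1 - (-1) ^ (k + 1)) / 2 / ((k + 1).factorial : ℂ)) • h ^ (k + 1) := by
  rw [sinhDiv, PowerSeries.coeff_mk, map_sub, coeff_expS, coeff_expS, ← sub_smul, smul_smul]
  congr 1
  ring

theorem map_expS {B' : Type*} [Ring B'] [Algebra ℂ B'] (f : B →ₐ[ℂ] B') (t : ℂ) (h : B) :
    PowerSeries.map (f : B →+* B') (expS t h) = expS t (f h) := by
  ext k
  simp [coeff_expS]

theorem expS_zero (h : B) : expS 0 h = 1 := by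
  ext k
  rw [coeff_expS, PowerSeries.coeff_one]
  cases k <;> simp

theorem expS_zero_right (t : ℂ) : expS t (0 : B) = 1 := by
  ext k
  rw [coeff_expS, PowerSeries.coeff_one]
  cases k <;> simp

theorem expS_smul (s t : ℂ) (h : B) : expS t (s • h) = expS (t * s) h := by
  ext k
  rw [coeff_expS, coeff_expS, smul_pow, smul_smul]
  congr 1
  ring

theorem expS_add_of_commute (t : ℂ) {h h' : B} (hc : Commute h h') :
    expS t (h + h') = expS t h * expS t h' := by
  ext k
  rw [PowerSeries.coeff_mul, coeff_expS, hc.add_pow', Finset.smul_sum]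
  refine Finset.sum_congr rfl fun p hp => ?_
  rw [Finset.HasAntidiagonal.mem_antidiagonal] at hp
  rw [coeff_expS, coeff_expS, smul_mul_smul_comm, ← Nat.cast_smul_eq_nsmul ℂ, smul_smul]
  congr 1
  rw [← hp, Nat.cast_add_choose, pow_add]
  have h1 : ((p.1 + p.2).factorial : ℂ) ≠ 0 := by exact_mod_cast Nat.factorial_ne_zero _
  field_simp

theorem expS_mul_expS (s t : ℂ) (h : B) : expS s h * expS t h = expS (s + t) h := by
  have := expS_add_of_commute 1 (((Commute.refl h).smul_left s).smul_right t)
  rw [← add_smul, expS_smul, expS_smul, expS_smul, one_mul, one_mul, one_mul] at this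
  exact this.symm

theorem expS_commute {h b : B} (hb : Commute h b) (t : ℂ) : Commute (expS t h) (PowerSeries.C b) := by
  ext k
  rw [PowerSeries.coeff_mul_C, PowerSeries.coeff_C_mul, coeff_expS, smul_mul_assoc, mul_smul_comm,
    (hb.pow_left k).eq]

theorem two_mul_cancel {a b : B⟦X⟧} (h : (2 : B⟦X⟧) * a = 2 * b) : a = b := by
  ext k
  have := congrArg (PowerSeries.coeff k) h
  rw [two_mul, two_mul, map_add, map_add, ← two_smul ℂ, ← two_smul ℂ (PowerSeries.coeff k b)] at this
  exact smul_right_injective B (two_ne_zero : (2 : ℂ) ≠ 0) this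

/-- Both 2 and X cancel in B⟦X⟧, so the quotient by 2X is characterized by a division-free identity,
and its properties are proved after multiplying by 2X. -/
theorem sinhDiv_ext {h : B} {f : B⟦X⟧}
    (hf : PowerSeries.X * (2 * f) = expS 1 h - expS (-1) h) : f = sinhDiv h :=
  two_mul_cancel (X_mul_cancel (hf.trans (X_mul_two_mul_sinhDiv h).symm))

/-- This is ab − a⁻¹b⁻¹ = (a − a⁻¹)b + a⁻¹(b − b⁻¹) with a = e^{Xh}, b = e^{Xh'}, divided by 2X. The
asymmetric form is the one that the coproduct of [E, F] produces. -/
theorem sinhDiv_add {h h' : B} (hc : Commute h h') : sinhDiv (h + h') =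
    sinhDiv h * expS 1 h' + expS (-1) h * sinhDiv h' := by
  refine (sinhDiv_ext ?_).symm
  have h1 : PowerSeries.X * (2 * (sinhDiv h * expS 1 h' + expS (-1) h * sinhDiv h')) =
      PowerSeries.X * (2 * sinhDiv h) * expS 1 h' +
        expS (-1) h * (PowerSeries.X * (2 * sinhDiv h')) := by
    rw [← mul_assoc (expS (-1) h), (PowerSeries.commute_X (expS (-1) h)).eq]
    noncomm_ring
  rw [h1, X_mul_two_mul_sinhDiv, X_mul_two_mul_sinhDiv, expS_add_of_commute _ hc,
    expS_add_of_commute _ hc]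
  noncomm_ring

theorem sinhDiv_neg (h : B) : sinhDiv (-h) = -sinhDiv h := by
  have h1 : ∀ t : ℂ, expS t (-h) = expS (-t) h := fun t => by
    rw [← neg_one_smul ℂ h, expS_smul, mul_neg, mul_one]
  refine (sinhDiv_ext ?_).symm
  rw [h1, h1, mul_neg, mul_neg, X_mul_two_mul_sinhDiv]
  simp

/-- Moving e to the left past h replaces h by h + c, in every power of h and hence in the
exponential. -/
theorem expS_mul_C {h e c : B} (hhe : h * e = e * (h + c)) (hc : Commute h c) (t : ℂ) :
    expS t h * PowerSeries.C e = PowerSeries.C e * (expS t h * expS t c) := by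
  rw [← expS_add_of_commute t hc]
  ext k
  rw [PowerSeries.coeff_mul_C, PowerSeries.coeff_C_mul, coeff_expS, coeff_expS, smul_mul_assoc,
    pow_mul_of_bracket hhe, mul_smul_comm]

end Exponentials

/-! ### Truncated exponentials -/

section TruncatedExp

variable {R B : Type*} [CommRing R] [Algebra ℂ R] [Ring B] [Algebra R B]

/-- `e^{t z h}`, truncated at `zⁿ`. -/
def texp (z : R) (n : ℕ) (t : ℂ) (h : B) : B :=
  ∑ k ∈ Finset.range n, (algebraMap ℂ R (t ^ k / (k.factorial : ℂ)) * z ^ k) • h ^ k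

/-- `(e^{z h} - e^{-z h}) / (2 z)`, truncated at `zⁿ`. -/
def tsinh (z : R) (n : ℕ) (h : B) : B :=
  ∑ k ∈ Finset.range n,
    (algebraMap ℂ R ((1 - (-1) ^ (k + 1)) / 2 / ((k + 1).factorial : ℂ)) * z ^ k) • h ^ (k + 1)

variable {z : R} {n : ℕ}

theorem map_texp {B' : Type*} [Ring B'] [Algebra R B'] (f : B →ₐ[R] B') (t : ℂ) (h : B) :
    f (texp z n t h) = texp z n t (f h) := by
  simp [texp]

theorem map_tsinh {B' : Type*} [Ring B'] [Algebra R B'] (f : B →ₐ[R] B') (h : B) :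
    f (tsinh z n h) = tsinh z n (f h) := by
  simp [tsinh]

variable (hn : ∀ b : B, z ^ n • b = 0)
include hn

section

variable [Algebra ℂ B] [IsScalarTower ℂ R B]

theorem evSeries_expS (t : ℂ) (h : B) :
    evSeries z n hn (RingHom.id B) (expS t h) = texp z n t h := by
  rw [evSeries_apply, texp]
  refine Finset.sum_congr rfl fun k _ => ?_
  rw [coeff_expS, RingHom.id_apply, mul_comm, mul_smul, algebraMap_smul]

theorem evSeries_sinhDiv (h : B) :
    evSeries z n hn (RingHom.id B) (sinhDiv h) = tsinh z n h := by
  rw [evSeries_apply, tsinh]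
  refine Finset.sum_congr rfl fun k _ => ?_
  rw [coeff_sinhDiv, RingHom.id_apply, mul_comm, mul_smul, algebraMap_smul]

end

theorem evSeries_map_expS {A : Type*} [Ring A] [Algebra ℂ A] (f : A →+* B)
    (hf : ∀ c, f (algebraMap ℂ A c) = algebraMap R B (algebraMap ℂ R c)) (t : ℂ) (h : A) :
    evSeries z n hn f (expS t h) = texp z n t (f h) := by
  rw [evSeries_apply, texp]
  refine Finset.sum_congr rfl fun k _ => ?_
  rw [coeff_expS, Algebra.smul_def (R := ℂ), map_mul, hf, map_pow, ← Algebra.smul_def, mul_comm, mul_smul]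

theorem evSeries_map_sinhDiv {A : Type*} [Ring A] [Algebra ℂ A] (f : A →+* B)
    (hf : ∀ c, f (algebraMap ℂ A c) = algebraMap R B (algebraMap ℂ R c)) (h : A) :
    evSeries z n hn f (sinhDiv h) = tsinh z n (f h) := by
  rw [evSeries_apply, tsinh]
  refine Finset.sum_congr rfl fun k _ => ?_
  rw [coeff_sinhDiv, Algebra.smul_def (R := ℂ), map_mul, hf, map_pow, ← Algebra.smul_def, mul_comm, mul_smul]

/-- The complex structure on B is taken through R; the identity is then the value at z of the one
for `expS`. The next three lemmas follow the same pattern. -/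
theorem texp_mul_texp (s t : ℂ) (h : B) :
    texp z n s h * texp z n t h = texp z n (s + t) h := by
  let _ := Algebra.compHom B (algebraMap ℂ R)
  have : IsScalarTower ℂ R B := IsScalarTower.of_algebraMap_eq' rfl
  simp only [← evSeries_expS hn, ← map_mul, expS_mul_expS]

theorem texp_add_of_commute (t : ℂ) {h h' : B} (hc : Commute h h') :
    texp z n t (h + h') = texp z n t h * texp z n t h' := by
  let _ := Algebra.compHom B (algebraMap ℂ R)
  have : IsScalarTower ℂ R B := IsScalarTower.of_algebraMap_eq' rfl
  simp only [← evSeries_expS hn, ← map_mul, expS_add_of_commute t hc]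

/-- Obtained by evaluation at z, because z acts nilpotently on B and a division by z could not be
carried out there. -/
theorem tsinh_add {h h' : B} (hc : Commute h h') :
    tsinh z n (h + h') = tsinh z n h * texp z n 1 h' + texp z n (-1) h * tsinh z n h' := by
  let _ := Algebra.compHom B (algebraMap ℂ R)
  have : IsScalarTower ℂ R B := IsScalarTower.of_algebraMap_eq' rfl
  simp only [← evSeries_expS hn, ← evSeries_sinhDiv hn, ← map_mul, ← map_add, sinhDiv_add hc]

theorem texp_mul {h e c : B} (hhe : h * e = e * (h + c)) (hc : Commute h c) (t : ℂ) :
    texp z n t h * e = e * (texp z n t h * texp z n t c) := by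
  let _ := Algebra.compHom B (algebraMap ℂ R)
  have : IsScalarTower ℂ R B := IsScalarTower.of_algebraMap_eq' rfl
  have := congrArg (evSeries z n hn (RingHom.id B)) (expS_mul_C hhe hc t)
  simpa only [map_mul, evSeries_expS, evSeries_C, RingHom.id_apply] using this

end TruncatedExp

/-! ### Quotients by closed ideals -/

section ClosedQuotient

variable {R A : Type*} [CommRing R] [IsLocalRing R] [Ring A] [Algebra R A] {s : Set A}

theorem subset_closedIdeal : s ⊆ closedIdeal R s := fun x hx => by
  rw [SetLike.mem_coe, closedIdeal, Ideal.mem_iInf]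
  exact fun n => Ideal.mem_sup_left (TwoSidedIdeal.mem_asIdeal.2 (TwoSidedIdeal.subset_span hx))

/-- An element lying in every 𝔪ⁿ(A/I) lifts to one that is, for each n, in the generated ideal plus
𝔪ⁿA, which is exactly membership in the closure I. -/
instance isHausdorff_closedQuotient :
    IsHausdorff (IsLocalRing.maximalIdeal R) (A ⧸ closedIdeal R s) where
  haus' x hx := by
    obtain ⟨a, rfl⟩ := Ideal.Quotient.mk_surjective x
    rw [Ideal.Quotient.eq_zero_iff_mem, closedIdeal, Ideal.mem_iInf]
    intro n
    have h1 := hx n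
    rw [SModEq.zero] at h1
    have h2 : ∃ b ∈ adicIdeal R A n, Ideal.Quotient.mk (closedIdeal R s) a =
        Ideal.Quotient.mk (closedIdeal R s) b := by
      refine Submodule.smul_induction_on
        (p := fun x => ∃ b ∈ adicIdeal R A n, x = Ideal.Quotient.mk (closedIdeal R s) b) h1
        (fun r hr y _ => ?_) (fun y z hy hz => ?_)
      · obtain ⟨y, rfl⟩ := Ideal.Quotient.mk_surjective y
        exact ⟨r • y, mem_adicIdeal.2 (Submodule.smul_mem_smul hr Submodule.mem_top),
          (map_smul (Ideal.Quotient.mkₐ R (closedIdeal R s)) r y).symm⟩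
      · obtain ⟨b, hb, hy⟩ := hy
        obtain ⟨c, hc, hz⟩ := hz
        exact ⟨b + c, add_mem hb hc, by rw [hy, hz, map_add]⟩
    obtain ⟨b, hb, hab⟩ := h2
    rw [Ideal.Quotient.eq, closedIdeal, Ideal.mem_iInf] at hab
    rw [← sub_add_cancel a b]
    exact add_mem (hab n) (Ideal.mem_sup_right hb)

variable {S B : Type*} [CommRing S] [IsLocalRing S] [Ring B] [Algebra S B] {σ : R →+* S}
  [IsLocalHom σ]

/-- For each n an element of the closure is y + z with y in the generated ideal and z ∈ 𝔪ⁿA; φ kills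
y and sends z into 𝔪ⁿB. As n is arbitrary and B is Hausdorff, the value is zero. -/
theorem closedIdeal_le_ker (φ : A →+* B) (hφ : ∀ (c : R) a, φ (c • a) = σ c • φ a)
    [IsHausdorff (IsLocalRing.maximalIdeal S) B] (h : ∀ x ∈ s, φ x = 0) (a : A)
    (ha : a ∈ closedIdeal R s) : φ a = 0 := by
  let φL : A →ₛₗ[σ] B := { φ with map_smul' := hφ }
  refine IsHausdorff.haus (I := IsLocalRing.maximalIdeal S) inferInstance _ fun n => ?_
  rw [SModEq.zero]
  rw [closedIdeal, Ideal.mem_iInf] at ha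
  obtain ⟨y, hy, z, hz, rfl⟩ := Submodule.mem_sup.1 (ha n)
  have h1 : φ y = 0 := by
    have : TwoSidedIdeal.span s ≤ TwoSidedIdeal.ker φ :=
      TwoSidedIdeal.span_le.2 fun x hx => (TwoSidedIdeal.mem_ker φ).2 (h x hx)
    exact (TwoSidedIdeal.mem_ker φ).1 (this (TwoSidedIdeal.mem_asIdeal.1 hy))
  rw [map_add, h1, zero_add]
  exact map_mem_adicIdeal φL n hz

/-- The semilinear map induced on the quotient by a closed ideal. -/
def quotDesc (φ : A →+* B) (hφ : ∀ (c : R) a, φ (c • a) = σ c • φ a)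
    [IsHausdorff (IsLocalRing.maximalIdeal S) B] (h : ∀ x ∈ s, φ x = 0) :
    (A ⧸ closedIdeal R s) →ₛₗ[σ] B :=
  { Ideal.Quotient.lift (closedIdeal R s) φ (closedIdeal_le_ker φ hφ h) with
    map_smul' := by
      rintro c ⟨a⟩
      exact hφ c a }

theorem quotDesc_one (φ : A →+* B) (hφ : ∀ (c : R) a, φ (c • a) = σ c • φ a)
    [IsHausdorff (IsLocalRing.maximalIdeal S) B] (h : ∀ x ∈ s, φ x = 0) :
    quotDesc φ hφ h 1 = 1 := map_one φ

theorem quotDesc_mul (φ : A →+* B) (hφ : ∀ (c : R) a, φ (c • a) = σ c • φ a)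
    [IsHausdorff (IsLocalRing.maximalIdeal S) B] (h : ∀ x ∈ s, φ x = 0)
    (a b : A ⧸ closedIdeal R s) : quotDesc φ hφ h (a * b) = quotDesc φ hφ h a * quotDesc φ hφ h b :=
  map_mul (Ideal.Quotient.lift (closedIdeal R s) φ (closedIdeal_le_ker φ hφ h)) a b

theorem isHausdorff_of_killedBy {M : Type*} [AddCommGroup M] [Module R M] {n : ℕ}
    (h : KilledBy R M n) : IsHausdorff (IsLocalRing.maximalIdeal R) M where
  haus' x hx := by
    have := hx n
    rw [SModEq.zero] at this
    refine Submodule.smul_induction_on this (fun r hr y _ => h r hr y) (fun y z hy hz => ?_)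
    rw [hy, hz, add_zero]

/-- Antimultiplicative maps are constructed as ring maps into the opposite algebra, which must
therefore be an admissible target for the universal property. -/
instance isHausdorff_mulOpposite {M : Type*} [AddCommGroup M] [Module R M]
    [IsHausdorff (IsLocalRing.maximalIdeal R) M] : IsHausdorff (IsLocalRing.maximalIdeal R) Mᵐᵒᵖ where
  haus' x hx := by
    refine MulOpposite.unop_injective (IsHausdorff.haus (I := IsLocalRing.maximalIdeal R)
      inferInstance _ fun n => ?_)
    have h1 := hx n
    rw [SModEq.zero] at h1 ⊢
    refine Submodule.smul_induction_on (p := fun y : Mᵐᵒᵖ => y.unop ∈ _) h1 (fun r hr y _ => ?_)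
      (fun y z hy hz => ?_)
    · exact Submodule.smul_mem_smul hr Submodule.mem_top
    · exact add_mem hy hz

end ClosedQuotient

/-! ### Maps out of the free algebra -/

section Free

variable {B : Type*} [Ring B]

/-- The ring map from the free algebra with given values on scalars and generators. -/
def freeHom (α : ℂ →+* B) (hα : ∀ c b, α c * b = b * α c) (x : Gen → B) :
    FreeAlgebra ℂ Gen →+* B :=
  letI := α.toAlgebra' hα
  (FreeAlgebra.lift ℂ x : FreeAlgebra ℂ Gen →ₐ[ℂ] B)

theorem freeHom_algebraMap (α : ℂ →+* B) (hα : ∀ c b, α c * b = b * α c) (x : Gen → B) (c : ℂ) :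
    freeHom α hα x (algebraMap ℂ _ c) = α c :=
  letI := α.toAlgebra' hα
  (FreeAlgebra.lift ℂ x : FreeAlgebra ℂ Gen →ₐ[ℂ] B).commutes c

theorem freeHom_ι (α : ℂ →+* B) (hα : ∀ c b, α c * b = b * α c) (x : Gen → B) (g : Gen) :
    freeHom α hα x (FreeAlgebra.ι ℂ g) = x g :=
  letI := α.toAlgebra' hα
  FreeAlgebra.lift_ι_apply x g

/-- The antimultiplicative map on power series induced by an antimultiplicative map. -/
def opSeries {A B : Type*} [Ring A] [Ring B] (φ : A →+* Bᵐᵒᵖ) : A⟦X⟧ →+* B⟦X⟧ᵐᵒᵖ where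
  toFun f := MulOpposite.op (PowerSeries.mk fun k => (φ (PowerSeries.coeff k f)).unop)
  map_zero' := by
    apply MulOpposite.unop_injective
    ext k; simp
  map_one' := by
    apply MulOpposite.unop_injective
    ext k
    simp only [MulOpposite.unop_op, PowerSeries.coeff_mk, MulOpposite.unop_one,
      PowerSeries.coeff_one]
    split <;> simp
  map_add' f g := by
    apply MulOpposite.unop_injective
    ext k; simp
  map_mul' f g := by
    apply MulOpposite.unop_injective
    ext k
    simp only [MulOpposite.unop_op, PowerSeries.coeff_mk, MulOpposite.unop_mul,
      PowerSeries.coeff_mul, map_sum, map_mul, Finset.unop_sum]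
    rw [← Finset.Nat.sum_antidiagonal_swap]
    rfl

theorem coeff_opSeries {A B : Type*} [Ring A] [Ring B] (φ : A →+* Bᵐᵒᵖ) (f : A⟦X⟧) (k : ℕ) :
    PowerSeries.coeff k (opSeries φ f).unop = (φ (PowerSeries.coeff k f)).unop := by
  simp [opSeries]

end Free

/-! ### The two-parameter quantum group: basic properties -/

theorem rr_mem : rr ∈ IsLocalRing.maximalIdeal Crh := by
  have := C_mem_maximalIdeal_pow (n := 1) (c := (PowerSeries.X : Cr))
    (by rw [pow_one]; exact X_mem_maximalIdeal)
  rwa [pow_one] at this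

theorem hh_mem : hh ∈ IsLocalRing.maximalIdeal Crh := X_mem_maximalIdeal

theorem KilledBy.pow_smul {R B : Type*} [CommRing R] [IsLocalRing R] [AddCommGroup B] [Module R B]
    {n : ℕ} (h : KilledBy R B n) {z : R} (hz : z ∈ IsLocalRing.maximalIdeal R) (b : B) :
    z ^ n • b = 0 := h _ (Ideal.pow_mem_pow hz n) b

theorem algebraMap_Crh (c : ℂ) : algebraMap ℂ Crh c = PowerSeries.C (PowerSeries.C c) := by
  rw [PowerSeries.algebraMap_apply, PowerSeries.algebraMap_apply]
  rfl

namespace FreeQ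

/-- The underlying iterated power series. -/
def toSeries : FreeQ ≃+* (FreeAlgebra ℂ Gen)⟦X⟧⟦X⟧ := RingEquiv.refl _

theorem toSeries_ofSeries (f : (FreeAlgebra ℂ Gen)⟦X⟧) :
    toSeries (ofSeries f) = PowerSeries.C f := rfl

theorem toSeries_algebraMap (c : Crh) : toSeries (algebraMap Crh FreeQ c) =
    PowerSeries.map (PowerSeries.map (algebraMap ℂ (FreeAlgebra ℂ Gen))) c := rfl

theorem toSeries_smul (c : Crh) (f : FreeQ) : toSeries (c • f) =
    PowerSeries.map (PowerSeries.map (algebraMap ℂ (FreeAlgebra ℂ Gen))) c * toSeries f := by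
  rw [Algebra.smul_def, map_mul, toSeries_algebraMap]

theorem rr_smul_ofSeries (f : (FreeAlgebra ℂ Gen)⟦X⟧) :
    rr • ofSeries f = ofSeries (PowerSeries.X * f) := by
  apply toSeries.injective
  rw [toSeries_smul, toSeries_ofSeries, toSeries_ofSeries, rr, PowerSeries.map_C,
    PowerSeries.map_X, map_mul]

theorem rr_pow_smul_ofSeries (i : ℕ) (f : (FreeAlgebra ℂ Gen)⟦X⟧) :
    rr ^ i • ofSeries f = ofSeries (PowerSeries.X ^ i * f) := by
  induction i generalizing f with
  | zero => simp
  | succ i ih => rw [pow_succ, mul_smul, rr_smul_ofSeries, ih, ← mul_assoc, pow_succ]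

theorem hh_smul (f : FreeQ) : toSeries (hh • f) = PowerSeries.X * toSeries f := by
  rw [toSeries_smul, hh, PowerSeries.map_X]

theorem exists_eq_constant_add (f : FreeQ) : ∃ g₁ g₂ : FreeQ,
    f = ofSeries (PowerSeries.C (PowerSeries.constantCoeff
      (PowerSeries.constantCoeff (toSeries f)))) + (rr • g₁ + hh • g₂) := by
  set f₀ := PowerSeries.constantCoeff (toSeries f) with hf₀
  refine ⟨ofSeries (PowerSeries.mk fun p => PowerSeries.coeff (p + 1) f₀),
    toSeries.symm (PowerSeries.mk fun p => PowerSeries.coeff (p + 1) (toSeries f)), ?_⟩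
  apply toSeries.injective
  rw [rr_smul_ofSeries, map_add, map_add, hh_smul, RingEquiv.apply_symm_apply, toSeries_ofSeries,
    toSeries_ofSeries, ← add_assoc, ← map_add,
    add_comm (PowerSeries.C (PowerSeries.constantCoeff f₀)),
    ← PowerSeries.eq_X_mul_shift_add_const f₀, add_comm (PowerSeries.C f₀), hf₀,
    ← PowerSeries.eq_X_mul_shift_add_const]

theorem ofSeries_eq_sum (f : (FreeAlgebra ℂ Gen)⟦X⟧) (n : ℕ) : ∃ y : FreeQ,
    ofSeries f = ∑ i ∈ Finset.range n,
      rr ^ i • ofSeries (PowerSeries.C (PowerSeries.coeff i f)) + rr ^ n • y := by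
  obtain ⟨g, hg⟩ := exists_eq_sum_add_X_pow_mul f n
  refine ⟨ofSeries g, ?_⟩
  conv_lhs => rw [hg]
  simp only [rr_pow_smul_ofSeries, map_add, map_sum]

section Eval

variable {B : Type*} [Ring B] [Algebra Crh B] {n : ℕ} (hB : KilledBy Crh B n)

/-- Evaluation of a series over the free algebra in an algebra killed by `𝔪ⁿ`. -/
def eval (x : Gen → B) : FreeQ →+* B :=
  (evSeries hh n (hB.pow_smul hh_mem) (evSeries rr n (hB.pow_smul rr_mem)
    (freeHom ((algebraMap Crh B).comp (algebraMap ℂ Crh)) (fun _ b => Algebra.commutes _ b) x))).comp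
    (toSeries : FreeQ →+* (FreeAlgebra ℂ Gen)⟦X⟧⟦X⟧)

theorem eval_ofSeries (x : Gen → B) (f : (FreeAlgebra ℂ Gen)⟦X⟧) :
    eval hB x (ofSeries f) = evSeries rr n (hB.pow_smul rr_mem)
    (freeHom ((algebraMap Crh B).comp (algebraMap ℂ Crh)) (fun _ b => Algebra.commutes _ b) x) f :=
  evSeries_C (hB.pow_smul hh_mem) _ _

theorem eval_gen (x : Gen → B) (g : Gen) : eval hB x (gen g) = x g := by
  rw [gen, eval_ofSeries, evSeries_C, freeHom_ι]

theorem eval_expS (x : Gen → B) (t : ℂ) (g : Gen) :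
    eval hB x (ofSeries (expS t (FreeAlgebra.ι ℂ g))) = texp rr n t (x g) := by
  rw [eval_ofSeries, evSeries_map_expS, freeHom_ι]
  exact fun c => freeHom_algebraMap _ _ _ c

theorem eval_sinhDiv (x : Gen → B) (g : Gen) :
    eval hB x (ofSeries (sinhDiv (FreeAlgebra.ι ℂ g))) = tsinh rr n (x g) := by
  rw [eval_ofSeries, evSeries_map_sinhDiv, freeHom_ι]
  exact fun c => freeHom_algebraMap _ _ _ c

/-- By construction the evaluation is known only on complex constants. For series in the parameters
it is forced by `evSeries_ringHom`, used once for ħ and once for r. -/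
theorem eval_algebraMap (x : Gen → B) (c : Crh) :
    eval hB x (algebraMap Crh FreeQ c) = algebraMap Crh B c := by
  change evSeries hh n (hB.pow_smul hh_mem) _ (toSeries (algebraMap Crh FreeQ c)) = _
  rw [toSeries_algebraMap, evSeries_map, ← evSeries_ringHom (hB.pow_smul hh_mem)
    (algebraMap Crh B) rfl]
  refine congrArg (fun F : Cr →+* B => evSeries hh n (hB.pow_smul hh_mem) F c) (RingHom.ext fun d => ?_)
  rw [RingHom.comp_apply, evSeries_map, RingHom.comp_apply,
    ← RingHom.comp_apply (algebraMap Crh B) PowerSeries.C, ← evSeries_ringHom (z := rr)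
      (hB.pow_smul rr_mem) ((algebraMap Crh B).comp PowerSeries.C) rfl]
  refine congrArg (fun F : ℂ →+* B => evSeries rr n (hB.pow_smul rr_mem) F d) (RingHom.ext fun d => ?_)
  refine (freeHom_algebraMap ((algebraMap Crh B).comp (algebraMap ℂ Crh)) _ x d).trans ?_
  rw [RingHom.comp_apply, algebraMap_Crh]
  rfl

theorem eval_smul (x : Gen → B) (c : Crh) (a : FreeQ) :
    eval hB x (c • a) = c • eval hB x a := by
  rw [Algebra.smul_def, map_mul, eval_algebraMap, ← Algebra.smul_def]

end Eval

end FreeQ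

/-- The defining relations of `U_q^ħ(sl₂)` in an algebra killed by `𝔪ⁿ`. -/
structure IsUQRel {B : Type*} [Ring B] [Algebra Crh B] (n : ℕ) (x : Gen → B) : Prop where
  HE : x .H * x .E - x .E * x .H = (2 * hh) • x .E
  HF : x .H * x .F - x .F * x .H = -((2 * hh) • x .F)
  EF : x .E * x .F - x .F * x .E = hh • tsinh rr n (x .H)

namespace UQ

instance : IsHausdorff (IsLocalRing.maximalIdeal Crh) UQ :=
  inferInstanceAs (IsHausdorff (IsLocalRing.maximalIdeal Crh) (FreeQ ⧸ closedIdeal Crh relQ))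

/-- The quotient map. -/
def mk : FreeQ →ₐ[Crh] UQ := Ideal.Quotient.mkₐ Crh (closedIdeal Crh relQ)

theorem mk_surjective : Function.Surjective mk := Ideal.Quotient.mk_surjective

theorem mk_gen (g : Gen) : mk (FreeQ.gen g) = UQ.gen g := rfl

theorem mk_ofSeries_expS (t : ℂ) :
    mk (FreeQ.ofSeries (expS t (FreeAlgebra.ι ℂ Gen.H))) = UQ.exp t := rfl

/-- The element `(e^{rH} - e^{-rH}) / (2r)`. -/
def sinh : UQ := mk (FreeQ.ofSeries (sinhDiv (FreeAlgebra.ι ℂ Gen.H)))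

theorem mk_eq_zero {a : FreeQ} (ha : a ∈ relQ) : mk a = 0 :=
  Ideal.Quotient.eq_zero_iff_mem.2 (subset_closedIdeal ha)

theorem rel_HE : UQ.gen .H * UQ.gen .E - UQ.gen .E * UQ.gen .H = (2 * hh) • UQ.gen .E := by
  rw [← sub_eq_zero, ← mk_gen, ← mk_gen, ← map_mul, ← map_mul, ← map_smul, ← map_sub, ← map_sub]
  exact mk_eq_zero (Or.inl rfl)

theorem rel_HF : UQ.gen .H * UQ.gen .F - UQ.gen .F * UQ.gen .H = -((2 * hh) • UQ.gen .F) := by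
  rw [← sub_eq_zero, sub_neg_eq_add, ← mk_gen, ← mk_gen, ← map_mul, ← map_mul, ← map_smul,
    ← map_sub, ← map_add]
  exact mk_eq_zero (Or.inr (Or.inl rfl))

theorem rel_EF : UQ.gen .E * UQ.gen .F - UQ.gen .F * UQ.gen .E = hh • sinh := by
  rw [← sub_eq_zero, sinh, ← mk_gen, ← mk_gen, ← map_mul, ← map_mul, ← map_smul,
    ← map_sub, ← map_sub]
  exact mk_eq_zero (Or.inr (Or.inr rfl))

/-- Semilinear maps out of `U_q^ħ(sl₂)`. -/
def desc {S B : Type*} [CommRing S] [IsLocalRing S] [Ring B] [Algebra S B] {σ : Crh →+* S}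
    [IsLocalHom σ] (φ : FreeQ →+* B) (hφ : ∀ (c : Crh) a, φ (c • a) = σ c • φ a)
    [IsHausdorff (IsLocalRing.maximalIdeal S) B] (h : ∀ x ∈ relQ, φ x = 0) : UQ →ₛₗ[σ] B :=
  quotDesc φ hφ h

section

variable {S B : Type*} [CommRing S] [IsLocalRing S] [Ring B] [Algebra S B] {σ : Crh →+* S}
    [IsLocalHom σ] (φ : FreeQ →+* B) (hφ : ∀ (c : Crh) a, φ (c • a) = σ c • φ a)
    [IsHausdorff (IsLocalRing.maximalIdeal S) B] (h : ∀ x ∈ relQ, φ x = 0)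

theorem desc_one : desc φ hφ h 1 = 1 := quotDesc_one φ hφ h

theorem desc_mul (a b : UQ) : desc φ hφ h (a * b) = desc φ hφ h a * desc φ hφ h b :=
  quotDesc_mul φ hφ h a b

end

section Lift

variable {B : Type*} [Ring B] [Algebra Crh B] {n : ℕ} (hB : KilledBy Crh B n)

/-- The universal property of `U_q^ħ(sl₂)` for algebras killed by `𝔪ⁿ`. -/
def lift (x : Gen → B) (hx : IsUQRel n x) : UQ →ₐ[Crh] B :=
  haveI := isHausdorff_of_killedBy hB
  have h : ∀ a ∈ relQ, FreeQ.eval hB x a = 0 := by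
    rintro a (rfl | rfl | rfl)
    · simp only [map_sub, map_mul, FreeQ.eval_smul, FreeQ.eval_gen, hx.HE, sub_self]
    · simp only [map_sub, map_add, map_mul, FreeQ.eval_smul, FreeQ.eval_gen, hx.HF,
        neg_add_cancel]
    · simp only [map_sub, map_mul, FreeQ.eval_smul, FreeQ.eval_gen, hx.EF, FreeQ.eval_sinhDiv,
        sub_self]
  AlgHom.ofLinearMap (desc (σ := RingHom.id Crh) (FreeQ.eval hB x) (FreeQ.eval_smul hB x) h)
    (desc_one _ _ _) (desc_mul _ _ _)

theorem lift_gen (x : Gen → B) (hx : IsUQRel n x) (g : Gen) : lift hB x hx (gen g) = x g :=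
  FreeQ.eval_gen hB x g

theorem lift_exp (x : Gen → B) (hx : IsUQRel n x) (t : ℂ) :
    lift hB x hx (UQ.exp t) = texp rr n t (x .H) :=
  FreeQ.eval_expS hB x t .H

end Lift

theorem mk_C_mem_adjoin (a : FreeAlgebra ℂ Gen) :
    mk (FreeQ.ofSeries (PowerSeries.C a)) ∈ Algebra.adjoin Crh (Set.range UQ.gen) := by
  induction a using FreeAlgebra.induction with
  | grade0 c =>
    have : FreeQ.ofSeries (PowerSeries.C (algebraMap ℂ (FreeAlgebra ℂ Gen) c)) =
        algebraMap Crh FreeQ (PowerSeries.C (PowerSeries.C c)) := by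
      apply FreeQ.toSeries.injective
      rw [FreeQ.toSeries_algebraMap, PowerSeries.map_C, PowerSeries.map_C, FreeQ.toSeries_ofSeries]
    rw [this, AlgHom.commutes]
    exact Subalgebra.algebraMap_mem _ _
  | grade1 g => exact Algebra.subset_adjoin ⟨g, rfl⟩
  | mul a b ha hb => rw [map_mul, map_mul, map_mul]; exact mul_mem ha hb
  | add a b ha hb => rw [map_add, map_add, map_add]; exact add_mem ha hb

theorem rr_smul_mem {A : Type*} [Ring A] [Algebra Crh A] (a : A) : rr • a ∈ adicIdeal Crh A 1 := by
  rw [mem_adicIdeal, pow_one]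
  exact Submodule.smul_mem_smul rr_mem Submodule.mem_top

theorem hh_smul_mem {A : Type*} [Ring A] [Algebra Crh A] (a : A) : hh • a ∈ adicIdeal Crh A 1 := by
  rw [mem_adicIdeal, pow_one]
  exact Submodule.smul_mem_smul hh_mem Submodule.mem_top

/-- Modulo r and ħ a double series reduces to its constant term, which is a noncommutative
polynomial in the generators. -/
theorem topGen : TopGen Crh UQ.gen := TopGen.of_one fun a => by
  obtain ⟨f, rfl⟩ := mk_surjective a
  obtain ⟨g₁, g₂, hf⟩ := FreeQ.exists_eq_constant_add f
  refine ⟨_, mk_C_mem_adjoin (PowerSeries.constantCoeff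
    (PowerSeries.constantCoeff (FreeQ.toSeries f))), ?_⟩
  rw [← map_sub, sub_eq_iff_eq_add'.2 hf, map_add, map_smul, map_smul]
  exact add_mem (rr_smul_mem _) (hh_smul_mem _)

/-- Modulo 𝔪ⁿ only the first n coefficients in r survive. This is how elements of the completed
algebra such as e^{trH} become the truncated expressions to which the universal property applies. -/
theorem trunc_mk_ofSeries (n : ℕ) (f : (FreeAlgebra ℂ Gen)⟦X⟧) :
    Trunc.mk Crh UQ n (mk (FreeQ.ofSeries f)) = ∑ i ∈ Finset.range n,
      rr ^ i • Trunc.mk Crh UQ n (mk (FreeQ.ofSeries (PowerSeries.C (PowerSeries.coeff i f)))) := by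
  obtain ⟨y, hy⟩ := FreeQ.ofSeries_eq_sum f n
  rw [hy, map_add, map_add, map_smul mk (rr ^ n), map_smul (Trunc.mk Crh UQ n) (rr ^ n),
    (killedBy_trunc n).pow_smul rr_mem, add_zero]
  simp only [map_sum, map_smul]

theorem ofSeries_C_smul (c : ℂ) (a : FreeAlgebra ℂ Gen) :
    FreeQ.ofSeries (PowerSeries.C (c • a)) =
      algebraMap ℂ Crh c • FreeQ.ofSeries (PowerSeries.C a) := by
  apply FreeQ.toSeries.injective
  rw [FreeQ.toSeries_smul, algebraMap_Crh, PowerSeries.map_C, PowerSeries.map_C,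
    FreeQ.toSeries_ofSeries, FreeQ.toSeries_ofSeries, ← map_mul, ← map_mul, Algebra.smul_def]

theorem trunc_mk_exp (n : ℕ) (t : ℂ) :
    Trunc.mk Crh UQ n (UQ.exp t) = texp rr n t (Trunc.mk Crh UQ n (UQ.gen .H)) := by
  rw [← mk_ofSeries_expS, trunc_mk_ofSeries, texp]
  refine Finset.sum_congr rfl fun i _ => ?_
  rw [coeff_expS, ofSeries_C_smul, map_smul, map_smul, smul_smul, mul_comm, map_pow, map_pow,
    map_pow, map_pow]
  rfl

theorem trunc_mk_sinh (n : ℕ) :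
    Trunc.mk Crh UQ n UQ.sinh = tsinh rr n (Trunc.mk Crh UQ n (UQ.gen .H)) := by
  rw [sinh, trunc_mk_ofSeries, tsinh]
  refine Finset.sum_congr rfl fun i _ => ?_
  rw [coeff_sinhDiv, ofSeries_C_smul, map_smul, map_smul, smul_smul, mul_comm, map_pow, map_pow,
    map_pow, map_pow]
  rfl

/-- Equality in `U_q^ħ(sl₂)` can be checked on truncations. -/
theorem ext_trunc {a b : UQ} (h : ∀ n, Trunc.mk Crh UQ n a = Trunc.mk Crh UQ n b) : a = b := by
  refine (IsHausdorff.eq_iff_smodEq (I := IsLocalRing.maximalIdeal Crh)).2 fun n => ?_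
  rw [SModEq.sub_mem, ← mem_adicIdeal, ← Trunc.mk_eq_zero, map_sub, h n, sub_self]

theorem isUQRel_trunc (n : ℕ) : IsUQRel n fun g => Trunc.mk Crh UQ n (UQ.gen g) where
  HE := by rw [← map_mul, ← map_mul, ← map_sub, rel_HE, map_smul]
  HF := by rw [← map_mul, ← map_mul, ← map_sub, rel_HF, map_neg, map_smul]
  EF := by rw [← map_mul, ← map_mul, ← map_sub, rel_EF, map_smul, trunc_mk_sinh]

end UQ

/-! ### Coproduct, counit, involution and antipode of the two-parameter quantum group -/

section QuantumTensor

variable {B : Type*} [Ring B] [Algebra Crh B] {n : ℕ} (hB : KilledBy Crh B n)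
include hB

/-- In e^{tr·sħ} each power of r comes with the same power of ħ. Truncation at rⁿ is therefore
truncation at ħⁿ, and the tail of the full series is killed by ħⁿ. -/
theorem texp_scalar (s t : ℂ) :
    texp rr n t (algebraMap Crh B (algebraMap ℂ Crh s * hh)) =
      algebraMap Crh B (expS (s * t) (PowerSeries.X : Cr)) := by
  obtain ⟨g, hg⟩ := exists_eq_sum_add_X_pow_mul (expS (s * t) (PowerSeries.X : Cr)) n
  have h0 := hB.pow_smul hh_mem (algebraMap Crh B g)
  rw [Algebra.smul_def, ← map_mul] at h0
  have h1 : ∀ (c : ℂ) (k : ℕ), PowerSeries.C (c • (PowerSeries.X : Cr) ^ k) =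
      algebraMap ℂ Crh c * rr ^ k := fun c k => by
    rw [Algebra.smul_def, map_mul, map_pow, algebraMap_Crh, PowerSeries.algebraMap_apply]
    rfl
  rw [hg, map_add]
  refine Eq.trans ?_ ((add_zero _).symm.trans (congrArg _ h0.symm))
  rw [map_sum, texp]
  refine Finset.sum_congr rfl fun k _ => ?_
  rw [← map_pow, Algebra.smul_def, ← map_mul]
  congr 1
  rw [coeff_expS, h1, mul_pow s t, mul_div_assoc, map_mul (algebraMap ℂ Crh), mul_pow, map_pow, hh]
  ring

/-- An eigenvector of ad h with eigenvalue sħ shifts h by the central element sħ when moved past it;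
exponentiating gives the scalar e^{strħ}. -/
theorem texp_mul_of_weight {h e : B} {s : ℂ}
    (he : h * e - e * h = (algebraMap ℂ Crh s * hh) • e) (t : ℂ) :
    texp rr n t h * e = expS (s * t) (PowerSeries.X : Cr) • (e * texp rr n t h) := by
  have h1 : h * e = e * (h + algebraMap Crh B (algebraMap ℂ Crh s * hh)) := by
    rw [mul_add, ← Algebra.commutes, ← Algebra.smul_def, ← he]; abel
  rw [texp_mul (hB.pow_smul rr_mem) h1 (Algebra.commute_algebraMap_right _ _), texp_scalar hB,
    ← mul_assoc, ← Algebra.commutes, ← Algebra.smul_def]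

theorem IsUQRel.texp_mul_E {x : Gen → B} (hx : IsUQRel n x) (t : ℂ) : texp rr n t (x .H) * x .E =
    expS (2 * t) (PowerSeries.X : Cr) • (x .E * texp rr n t (x .H)) :=
  texp_mul_of_weight hB (by rw [hx.HE, map_ofNat]) t

theorem IsUQRel.texp_mul_F {x : Gen → B} (hx : IsUQRel n x) (t : ℂ) : texp rr n t (x .H) * x .F =
    expS (-2 * t) (PowerSeries.X : Cr) • (x .F * texp rr n t (x .H)) :=
  texp_mul_of_weight hB (by rw [hx.HF, map_neg, map_ofNat, neg_mul, neg_smul]) t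

end QuantumTensor

theorem commute_texp {R B : Type*} [CommRing R] [Algebra ℂ R] [Ring B] [Algebra R B] (z : R) (n : ℕ)
    (t : ℂ) (h : B) : Commute h (texp z n t h) :=
  Commute.sum_right _ _ _ fun k _ => ((Commute.refl h).pow_right k).smul_right _

/-- The values of the coproduct on generators. -/
def twistedTensor {R T : Type*} [CommRing R] [Ring T] [Algebra R T] (x : Gen → T) (k k' : T) :
    Gen → T ⊗[R] T
  | .H => x .H ⊗ₜ 1 + 1 ⊗ₜ x .H
  | .E => x .E ⊗ₜ k + k' ⊗ₜ x .E
  | .F => x .F ⊗ₜ k + k' ⊗ₜ x .F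

theorem commute_tmul_one {R T : Type*} [CommRing R] [Ring T] [Algebra R T] (h h' : T) :
    Commute (h ⊗ₜ[R] (1 : T)) ((1 : T) ⊗ₜ[R] h') := by
  simp [commute_iff_eq]

section

variable {R T : Type*} [CommRing R] [Algebra ℂ R] [Ring T] [Algebra R T]

theorem texp_tmul_one (z : R) (n : ℕ) (t : ℂ) (h : T) :
    texp z n t (h ⊗ₜ[R] (1 : T)) = texp z n t h ⊗ₜ 1 :=
  (map_texp (Algebra.TensorProduct.includeLeft : T →ₐ[R] T ⊗[R] T) t h).symm

theorem texp_one_tmul (z : R) (n : ℕ) (t : ℂ) (h : T) :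
    texp z n t ((1 : T) ⊗ₜ[R] h) = 1 ⊗ₜ texp z n t h :=
  (map_texp (Algebra.TensorProduct.includeRight : T →ₐ[R] T ⊗[R] T) t h).symm

theorem tsinh_tmul_one (z : R) (n : ℕ) (h : T) :
    tsinh z n (h ⊗ₜ[R] (1 : T)) = tsinh z n h ⊗ₜ 1 :=
  (map_tsinh (Algebra.TensorProduct.includeLeft : T →ₐ[R] T ⊗[R] T) h).symm

theorem tsinh_one_tmul (z : R) (n : ℕ) (h : T) :
    tsinh z n ((1 : T) ⊗ₜ[R] h) = 1 ⊗ₜ tsinh z n h :=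
  (map_tsinh (Algebra.TensorProduct.includeRight : T →ₐ[R] T ⊗[R] T) h).symm

theorem texp_primitive {z : R} {n : ℕ} (hn : ∀ b : T ⊗[R] T, z ^ n • b = 0) (t : ℂ) (h : T) :
    texp z n t (h ⊗ₜ[R] (1 : T) + 1 ⊗ₜ h) = texp z n t h ⊗ₜ texp z n t h := by
  rw [texp_add_of_commute hn t (commute_tmul_one h h), texp_tmul_one, texp_one_tmul,
    Algebra.TensorProduct.tmul_mul_tmul, mul_one, one_mul]

end

/-- The two relations with H hold because k = e^{rH/2} and k' = e^{−rH/2} commute with H. In the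
relation for E and F, the terms from equal slots are [e, f] ⊗ k² and k'² ⊗ [e, f], whose sum is the
addition formula for (e^{rh} − e^{−rh})/(2r) at h ⊗ 1 + 1 ⊗ h; the mixed terms cancel. -/
theorem IsUQRel.twistedTensor {T : Type*} [Ring T] [Algebra Crh T] {n : ℕ}
    (hT : KilledBy Crh T n) {x : Gen → T} (hx : IsUQRel n x) :
    IsUQRel n (twistedTensor (R := Crh) x (texp rr n (1 / 2) (x .H))
      (texp rr n (-1 / 2) (x .H))) := by
  set h := x .H with hh'
  set e := x .E with he
  set f := x .F with hf
  set k := texp rr n (1 / 2) h with hk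
  set k' := texp rr n (-1 / 2) h with hk'
  have c1 : h * k = k * h := commute_texp _ _ _ _
  have c2 : h * k' = k' * h := commute_texp _ _ _ _
  refine ⟨?_, ?_, ?_⟩
  · change (h ⊗ₜ 1 + 1 ⊗ₜ h) * (e ⊗ₜ k + k' ⊗ₜ e) - (e ⊗ₜ k + k' ⊗ₜ e) * (h ⊗ₜ 1 + 1 ⊗ₜ h) =
      (2 * hh) • (e ⊗ₜ k + k' ⊗ₜ e)
    have h1 : h * e = (2 * hh) • e + e * h := sub_eq_iff_eq_add.1 hx.HE
    simp only [add_mul, mul_add, Algebra.TensorProduct.tmul_mul_tmul, one_mul, mul_one, h1, c1, c2,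
      TensorProduct.add_tmul, TensorProduct.tmul_add, smul_add, TensorProduct.smul_tmul',
      TensorProduct.tmul_smul]
    abel
  · change (h ⊗ₜ 1 + 1 ⊗ₜ h) * (f ⊗ₜ k + k' ⊗ₜ f) - (f ⊗ₜ k + k' ⊗ₜ f) * (h ⊗ₜ 1 + 1 ⊗ₜ h) =
      -((2 * hh) • (f ⊗ₜ k + k' ⊗ₜ f))
    have h1 : h * f = -((2 * hh) • f) + f * h := sub_eq_iff_eq_add.1 hx.HF
    simp only [add_mul, mul_add, Algebra.TensorProduct.tmul_mul_tmul, one_mul, mul_one, h1, c1, c2,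
      TensorProduct.add_tmul, TensorProduct.tmul_add, smul_add, TensorProduct.smul_tmul',
      TensorProduct.tmul_smul, TensorProduct.neg_tmul, TensorProduct.tmul_neg]
    abel
  · change (e ⊗ₜ k + k' ⊗ₜ e) * (f ⊗ₜ k + k' ⊗ₜ f) - (f ⊗ₜ k + k' ⊗ₜ f) * (e ⊗ₜ k + k' ⊗ₜ e) =
      hh • tsinh rr n (h ⊗ₜ[Crh] (1 : T) + 1 ⊗ₜ h)
    rw [tsinh_add (hT.tensor.pow_smul rr_mem) (commute_tmul_one h h), tsinh_tmul_one,
      tsinh_one_tmul, texp_tmul_one, texp_one_tmul]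
    have h1 : e * f = hh • tsinh rr n h + f * e := sub_eq_iff_eq_add.1 hx.EF
    have h2 : k * k = texp rr n 1 h := by
      rw [hk, texp_mul_texp (hT.pow_smul rr_mem)]; norm_num
    have h3 : k' * k' = texp rr n (-1) h := by
      rw [hk', texp_mul_texp (hT.pow_smul rr_mem)]; norm_num
    -- The scalars pair up: `h5` and `h6` both give e^{−rħ}, so e k' ⊗ k f equals k' e ⊗ f k; `h4`
    -- and `h7` both give e^{rħ}, so k' f ⊗ e k equals f k' ⊗ k e.
    have h4 : k * e = expS 1 (PowerSeries.X : Cr) • (e * k) := 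
      (hx.texp_mul_E hT (1 / 2)).trans (by rw [show (2 : ℂ) * (1 / 2) = 1 by norm_num])
    have h5 : k' * e = expS (-1) (PowerSeries.X : Cr) • (e * k') := 
      (hx.texp_mul_E hT (-1 / 2)).trans (by rw [show (2 : ℂ) * (-1 / 2) = -1 by norm_num])
    have h6 : k * f = expS (-1) (PowerSeries.X : Cr) • (f * k) := 
      (hx.texp_mul_F hT (1 / 2)).trans (by rw [show (-2 : ℂ) * (1 / 2) = -1 by norm_num])
    have h7 : k' * f = expS 1 (PowerSeries.X : Cr) • (f * k') := 
      (hx.texp_mul_F hT (-1 / 2)).trans (by rw [show (-2 : ℂ) * (-1 / 2) = 1 by norm_num])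
    simp only [add_mul, mul_add, Algebra.TensorProduct.tmul_mul_tmul, one_mul, mul_one, h1, h2, h3,
      h4, h5, h6, h7, TensorProduct.add_tmul, TensorProduct.tmul_add, smul_add,
      TensorProduct.smul_tmul', TensorProduct.tmul_smul]
    abel

namespace UQ

theorem exp_mul_exp (s t : ℂ) : UQ.exp s * UQ.exp t = UQ.exp (s + t) := by
  rw [← mk_ofSeries_expS, ← mk_ofSeries_expS, ← map_mul, ← map_mul, expS_mul_expS, mk_ofSeries_expS]

theorem exp_zero : UQ.exp 0 = 1 := by
  rw [← mk_ofSeries_expS, expS_zero, map_one, map_one]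

theorem pos_mul_neg : UQ.exp (1 / 2) * UQ.exp (-1 / 2) = 1 := by
  rw [exp_mul_exp, ← exp_zero]; norm_num

theorem neg_mul_pos : UQ.exp (-1 / 2) * UQ.exp (1 / 2) = 1 := by
  rw [exp_mul_exp, ← exp_zero]; norm_num

theorem exp_mul_E (t : ℂ) : UQ.exp t * UQ.gen .E =
    expS (2 * t) (PowerSeries.X : Cr) • (UQ.gen .E * UQ.exp t) :=
  ext_trunc fun n => by
    rw [map_mul, map_smul, map_mul, trunc_mk_exp]
    exact (isUQRel_trunc n).texp_mul_E (killedBy_trunc n) t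

theorem exp_mul_F (t : ℂ) : UQ.exp t * UQ.gen .F =
    expS (-2 * t) (PowerSeries.X : Cr) • (UQ.gen .F * UQ.exp t) :=
  ext_trunc fun n => by
    rw [map_mul, map_smul, map_mul, trunc_mk_exp]
    exact (isUQRel_trunc n).texp_mul_F (killedBy_trunc n) t

theorem conj_E : UQ.exp (-1 / 2) * UQ.gen .E * UQ.exp (1 / 2) =
    expS (-1) (PowerSeries.X : Cr) • UQ.gen .E := by
  rw [exp_mul_E, smul_mul_assoc, mul_assoc, neg_mul_pos, mul_one]; norm_num

theorem conj_F : UQ.exp (-1 / 2) * UQ.gen .F * UQ.exp (1 / 2) =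
    expS 1 (PowerSeries.X : Cr) • UQ.gen .F := by
  rw [exp_mul_F, smul_mul_assoc, mul_assoc, neg_mul_pos, mul_one]; norm_num

theorem exp_commute_H (t : ℂ) : UQ.exp t * UQ.gen .H = UQ.gen .H * UQ.exp t := by
  rw [← mk_ofSeries_expS, ← mk_gen, ← map_mul, ← map_mul, FreeQ.gen, ← map_mul, ← map_mul,
    (expS_commute (Commute.refl _) t).eq]

theorem two_rr_smul_sinh : (2 * rr) • sinh = UQ.exp 1 - UQ.exp (-1) := by
  rw [sinh, ← map_smul, mul_comm, mul_smul, two_smul, ← map_add, FreeQ.rr_smul_ofSeries, ← two_mul,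
    X_mul_two_mul_sinhDiv, map_sub, map_sub, mk_ofSeries_expS, mk_ofSeries_expS]

theorem two_rr_smul_commutator :
    (2 * rr) • (UQ.gen .E * UQ.gen .F - UQ.gen .F * UQ.gen .E) =
      hh • (UQ.exp (1 / 2) ^ 2 - UQ.exp (-1 / 2) ^ 2) := by
  rw [rel_EF, smul_comm, two_rr_smul_sinh, pow_two, pow_two, exp_mul_exp, exp_mul_exp]
  norm_num

/-- The coproduct on truncations. -/
def comulLevel (n : ℕ) : UQ →ₐ[Crh] Trunc Crh UQ n ⊗[Crh] Trunc Crh UQ n :=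
  lift (killedBy_tensor n) (twistedTensor (fun g => Trunc.mk Crh UQ n (UQ.gen g))
    (Trunc.mk Crh UQ n (UQ.exp (1 / 2))) (Trunc.mk Crh UQ n (UQ.exp (-1 / 2)))) (by
      rw [trunc_mk_exp, trunc_mk_exp]
      exact (isUQRel_trunc n).twistedTensor (killedBy_trunc n))

/-- The coproduct `Δ_r` of `U_q^ħ(sl₂)`. -/
def comul : UQ →ₐ[Crh] CTensor Crh UQ :=
  comulOfFamily comulLevel fun n => topGen.algHom_ext (killedBy_tensor n) fun g => by
    rw [AlgHom.comp_apply, comulLevel, comulLevel, lift_gen, lift_gen]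
    cases g <;> simp [twistedTensor, transition_mk]

theorem comul_gen_val (g : Gen) (n : ℕ) : (comul (UQ.gen g)).1 n =
    twistedTensor (fun g => Trunc.mk Crh UQ n (UQ.gen g))
    (Trunc.mk Crh UQ n (UQ.exp (1 / 2))) (Trunc.mk Crh UQ n (UQ.exp (-1 / 2))) g := by
  rw [comul, comulOfFamily_val, comulLevel, lift_gen]

/-- H is primitive and H ⊗ 1 commutes with 1 ⊗ H, so the exponential of Δ(H) factors into a pure
tensor. -/
theorem comul_exp (t : ℂ) : comul (UQ.exp t) = ctmul Crh (UQ.exp t) (UQ.exp t) :=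
  CTensor.ext fun n => by
    rw [comul, comulOfFamily_val, comulLevel, lift_exp, ctmul_val, trunc_mk_exp n t]
    exact texp_primitive ((killedBy_tensor (R := Crh) (A := UQ) n).pow_smul rr_mem) t _

theorem isTwistedCoproduct :
    IsTwistedCoproduct comul UQ.gen (UQ.exp (1 / 2)) (UQ.exp (-1 / 2)) where
  inv := pos_mul_neg
  inv' := neg_mul_pos
  pos := comul_exp _
  neg := comul_exp _
  H := CTensor.ext fun n => by
    rw [comul_gen_val, CTensor.add_val, ctmul_val, ctmul_val, map_one]; rfl
  E := CTensor.ext fun n => comul_gen_val _ n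
  F := CTensor.ext fun n => comul_gen_val _ n

end UQ

/-- The i-th coefficient lies in the n-th power of the maximal ideal of k, as seen from membership
of the series in the power n + i. -/
instance isHausdorff_self_powerSeries {k : Type*} [CommRing k] [IsLocalRing k]
    [IsHausdorff (IsLocalRing.maximalIdeal k) k] :
    IsHausdorff (IsLocalRing.maximalIdeal k⟦X⟧) k⟦X⟧ where
  haus' g hg := by
    ext i
    rw [map_zero]
    refine IsHausdorff.haus (I := IsLocalRing.maximalIdeal k) inferInstance _ fun n => ?_
    have := hg (n + i)
    rw [SModEq.zero, smul_eq_mul, Ideal.mul_top] at this ⊢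
    simpa using coeff_mem_of_mem_pow this i

/-! ### Antimultiplicative maps of the two-parameter quantum group, its antipode and its counit. -/

namespace FreeQ

/-- The antimultiplicative map of the free algebra with given values on generators, semilinear over
a ring endomorphism of the coefficients. -/
def antiFree (α : ℂ →+* ℂ) (x : Gen → FreeAlgebra ℂ Gen) :
    FreeAlgebra ℂ Gen →+* (FreeAlgebra ℂ Gen)ᵐᵒᵖ :=
  freeHom ((algebraMap ℂ (FreeAlgebra ℂ Gen)ᵐᵒᵖ).comp α) (fun c b => Algebra.commutes (α c) b)
    fun g => MulOpposite.op (x g)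

theorem antiFree_algebraMap (α : ℂ →+* ℂ) (x : Gen → FreeAlgebra ℂ Gen) (c : ℂ) :
    antiFree α x (algebraMap ℂ _ c) = MulOpposite.op (algebraMap ℂ _ (α c)) :=
  freeHom_algebraMap _ _ _ c

theorem antiFree_ι (α : ℂ →+* ℂ) (x : Gen → FreeAlgebra ℂ Gen) (g : Gen) :
    antiFree α x (FreeAlgebra.ι ℂ g) = MulOpposite.op (x g) :=
  freeHom_ι _ _ _ g

/-- The antimultiplicative map with given values on generators, semilinear over a ring
endomorphism of the coefficients. -/
def anti (α : ℂ →+* ℂ) (x : Gen → FreeAlgebra ℂ Gen) : FreeQ →+* FreeQᵐᵒᵖ :=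
  opSeries (A := (FreeAlgebra ℂ Gen)⟦X⟧) (B := (FreeAlgebra ℂ Gen)⟦X⟧) (opSeries (antiFree α x))

theorem coeff_anti (α : ℂ →+* ℂ) (x : Gen → FreeAlgebra ℂ Gen) (a : FreeQ) (i j : ℕ) :
    PowerSeries.coeff j (PowerSeries.coeff i (toSeries (anti α x a).unop)) =
      (antiFree α x (PowerSeries.coeff j (PowerSeries.coeff i (toSeries a)))).unop := by
  rw [← coeff_opSeries]
  congr 1
  exact coeff_opSeries (A := (FreeAlgebra ℂ Gen)⟦X⟧) (B := (FreeAlgebra ℂ Gen)⟦X⟧) _ _ _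

variable (α : ℂ →+* ℂ) (x : Gen → FreeAlgebra ℂ Gen)

theorem anti_algebraMap (c : Crh) : anti α x (algebraMap Crh FreeQ c) =
    MulOpposite.op (algebraMap Crh FreeQ (PowerSeries.map (PowerSeries.map α) c)) := by
  apply MulOpposite.unop_injective
  apply toSeries.injective
  rw [MulOpposite.unop_op, toSeries_algebraMap]
  ext i j : 2
  rw [coeff_anti, toSeries_algebraMap]
  simp only [PowerSeries.coeff_map, antiFree_algebraMap, MulOpposite.unop_op]

theorem anti_smul (c : Crh) (a : FreeQ) : (anti α x (c • a)).unop =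
    PowerSeries.map (PowerSeries.map α) c • (anti α x a).unop := by
  rw [Algebra.smul_def, map_mul, anti_algebraMap, MulOpposite.unop_mul, MulOpposite.unop_op,
    ← Algebra.commutes, ← Algebra.smul_def]

theorem anti_ofSeries (f : (FreeAlgebra ℂ Gen)⟦X⟧) (g : (FreeAlgebra ℂ Gen)⟦X⟧)
    (h : ∀ k, antiFree α x (PowerSeries.coeff k f) = MulOpposite.op (PowerSeries.coeff k g)) :
    anti α x (ofSeries f) = MulOpposite.op (ofSeries g) := by
  apply MulOpposite.unop_injective
  apply toSeries.injective
  ext i j : 2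
  rw [coeff_anti, MulOpposite.unop_op, toSeries_ofSeries, toSeries_ofSeries, PowerSeries.coeff_C,
    PowerSeries.coeff_C]
  split
  · rw [h, MulOpposite.unop_op]
  · simp

theorem anti_gen (g : Gen) :
    anti α x (gen g) = MulOpposite.op (ofSeries (PowerSeries.C (x g))) := by
  refine anti_ofSeries α x _ _ fun k => ?_
  rw [PowerSeries.coeff_C, PowerSeries.coeff_C]
  split
  · rw [antiFree_ι]
  · rw [map_zero, MulOpposite.op_zero]

theorem anti_expS (t : ℂ) (g : Gen) : anti α x (ofSeries (expS t (FreeAlgebra.ι ℂ g))) =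
    MulOpposite.op (ofSeries (expS (α t) (x g))) := by
  refine anti_ofSeries α x _ _ fun k => ?_
  rw [coeff_expS, coeff_expS, Algebra.smul_def, map_mul, antiFree_algebraMap, map_pow, antiFree_ι,
    map_div₀, map_pow, map_natCast, Algebra.smul_def, MulOpposite.op_mul, MulOpposite.op_pow,
    ← MulOpposite.algebraMap_apply, Algebra.commutes]

theorem anti_sinhDiv (g : Gen) : anti α x (ofSeries (sinhDiv (FreeAlgebra.ι ℂ g))) =
    MulOpposite.op (ofSeries (sinhDiv (x g))) := by
  refine anti_ofSeries α x _ _ fun k => ?_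
  rw [coeff_sinhDiv, coeff_sinhDiv, Algebra.smul_def, map_mul, antiFree_algebraMap, map_pow,
    antiFree_ι, map_div₀ α, map_div₀ α, map_sub, map_pow, map_natCast, map_one,
    map_neg, map_one, map_ofNat, Algebra.smul_def, MulOpposite.op_mul, MulOpposite.op_pow,
    ← MulOpposite.algebraMap_apply, Algebra.commutes]

end FreeQ

namespace UQ

/-- The antimultiplicative maps of `U_q^ħ(sl₂)`, with values in the opposite algebra. -/
def antiOp (α : ℂ →+* ℂ) (x : Gen → FreeAlgebra ℂ Gen)
    (h : ∀ a ∈ relQ, mk (FreeQ.anti α x a).unop = 0) :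
    UQ →ₛₗ[PowerSeries.map (PowerSeries.map α)] UQᵐᵒᵖ :=
  desc ((mk : FreeQ →+* UQ).op.comp (FreeQ.anti α x))
    (fun c a => MulOpposite.unop_injective (by
      change mk (FreeQ.anti α x (c • a)).unop = _
      rw [FreeQ.anti_smul, map_smul]; rfl))
    (fun a ha => MulOpposite.unop_injective (h a ha))

/-- The antimultiplicative maps of `U_q^ħ(sl₂)`. -/
def anti (α : ℂ →+* ℂ) (x : Gen → FreeAlgebra ℂ Gen)
    (h : ∀ a ∈ relQ, mk (FreeQ.anti α x a).unop = 0) :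
    UQ →ₛₗ[PowerSeries.map (PowerSeries.map α)] UQ where
  toFun a := (antiOp α x h a).unop
  map_add' a b := by rw [map_add, MulOpposite.unop_add]
  map_smul' c a := by rw [map_smulₛₗ, MulOpposite.unop_smul]

section

variable {α : ℂ →+* ℂ} {x : Gen → FreeAlgebra ℂ Gen}
    (h : ∀ a ∈ relQ, mk (FreeQ.anti α x a).unop = 0)

theorem anti_mk (a : FreeQ) : anti α x h (mk a) = mk (FreeQ.anti α x a).unop := rfl

theorem anti_one : anti α x h 1 = 1 := by
  change (antiOp α x h 1).unop = 1
  rw [antiOp, desc_one, MulOpposite.unop_one]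

theorem anti_mul (a b : UQ) : anti α x h (a * b) = anti α x h b * anti α x h a := by
  change (antiOp α x h (a * b)).unop = (antiOp α x h b).unop * (antiOp α x h a).unop
  rw [antiOp, desc_mul, MulOpposite.unop_mul]

end

/-- An antimultiplicative map reverses products, so the images of the generators must satisfy the
relations written in reverse order; ħ is fixed because α acts on complex coefficients only.
Conjugation as α serves the involution, the identity serves the antipode. -/
theorem anti_mk_relQ (α : ℂ →+* ℂ) (x : Gen → FreeAlgebra ℂ Gen) {y : Gen → UQ}
    (hy : ∀ g, mk (FreeQ.ofSeries (PowerSeries.C (x g))) = y g) {s : UQ}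
    (hs : mk (FreeQ.ofSeries (sinhDiv (x .H))) = s)
    (hHE : y .E * y .H - y .H * y .E = (2 * hh) • y .E)
    (hHF : y .F * y .H - y .H * y .F = -((2 * hh) • y .F))
    (hEF : y .F * y .E - y .E * y .F = hh • s) :
    ∀ a ∈ relQ, mk (FreeQ.anti α x a).unop = 0 := by
  have h1 : PowerSeries.map (PowerSeries.map α) hh = hh := PowerSeries.map_X _
  rintro a (rfl | rfl | rfl)
  · simp only [map_sub, map_mul, MulOpposite.unop_sub, MulOpposite.unop_mul, FreeQ.anti_smul,
      FreeQ.anti_gen, MulOpposite.unop_op, map_smul, hy, h1, map_ofNat, hHE, sub_self]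
  · simp only [map_sub, map_add, map_mul, MulOpposite.unop_sub, MulOpposite.unop_add,
      MulOpposite.unop_mul, FreeQ.anti_smul,
      FreeQ.anti_gen, MulOpposite.unop_op, map_smul, hy, h1, map_ofNat, hHF, neg_add_cancel]
  · simp only [map_sub, map_mul, MulOpposite.unop_sub, MulOpposite.unop_mul, FreeQ.anti_smul,
      FreeQ.anti_gen, FreeQ.anti_sinhDiv, MulOpposite.unop_op, map_smul, hy, hs, h1, hEF, sub_self]

/-- The involution `†` of `U_q^ħ(sl₂)`. -/
def dag : UQ →ₛₗ[conj₂] UQ := anti (starRingEnd ℂ) (fun g => FreeAlgebra.ι ℂ g.dag)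
  (anti_mk_relQ _ _ (fun _ => rfl) rfl
    (by simp only [Gen.dag]; exact (neg_sub _ _).symm.trans ((congrArg _ rel_HF).trans (neg_neg _)))
    (by simp only [Gen.dag]; exact (neg_sub _ _).symm.trans (congrArg _ rel_HE))
    rel_EF)

theorem dag_gen (g : Gen) : dag (UQ.gen g) = UQ.gen g.dag := by
  rw [← mk_gen, dag, anti_mk, FreeQ.anti_gen]; rfl

theorem dag_exp (t : ℂ) : dag (UQ.exp t) = UQ.exp (starRingEnd ℂ t) := by
  rw [← mk_ofSeries_expS, dag, anti_mk, FreeQ.anti_expS]; rfl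

/-- The antimultiplicative map `H, E, F ↦ -H, -E, -F`. -/
def negAnti : UQ →ₛₗ[PowerSeries.map (PowerSeries.map (RingHom.id ℂ))] UQ :=
  anti (RingHom.id ℂ) (fun g => -FreeAlgebra.ι ℂ g)
  (anti_mk_relQ _ _ (y := fun g => -UQ.gen g) (fun _ => by rw [map_neg, map_neg, map_neg]; rfl)
    (s := -sinh) (by rw [sinhDiv_neg, map_neg, map_neg]; rfl)
    (by rw [neg_mul_neg, neg_mul_neg, smul_neg, ← rel_HE, neg_sub])
    (by rw [neg_mul_neg, neg_mul_neg, smul_neg, ← rel_HF, neg_sub])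
    (by rw [neg_mul_neg, neg_mul_neg, smul_neg, ← rel_EF, neg_sub]))

theorem negAnti_gen (g : Gen) : negAnti (UQ.gen g) = -UQ.gen g := by
  rw [← mk_gen, negAnti, anti_mk, FreeQ.anti_gen, MulOpposite.unop_op, map_neg, map_neg, map_neg]
  rfl

theorem negAnti_exp (t : ℂ) : negAnti (UQ.exp t) = UQ.exp (-t) := by
  rw [← mk_ofSeries_expS, negAnti, anti_mk, FreeQ.anti_expS, MulOpposite.unop_op, RingHom.id_apply,
    ← neg_one_smul ℂ, expS_smul, mul_neg, mul_one, mk_ofSeries_expS]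

/-- The antipode of `U_q^ħ(sl₂)`. -/
def antipode : UQ →ₗ[Crh] UQ where
  toFun a := UQ.exp (1 / 2) * negAnti a * UQ.exp (-1 / 2)
  map_add' a b := by rw [map_add, mul_add, add_mul]
  map_smul' c a := by
    have h : PowerSeries.map (PowerSeries.map (RingHom.id ℂ)) c = c := by
      ext i j
      simp
    rw [map_smulₛₗ, h, mul_smul_comm, smul_mul_assoc, RingHom.id_apply]

theorem antipode_apply (a : UQ) :
    antipode a = UQ.exp (1 / 2) * negAnti a * UQ.exp (-1 / 2) := rfl

/-- The counit of `U_q^ħ(sl₂)`. -/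
def counit : UQ →ₐ[Crh] Crh :=
  AlgHom.ofLinearMap (desc (σ := RingHom.id Crh)
    ((PowerSeries.map (PowerSeries.map
      (FreeAlgebra.lift ℂ (fun _ : Gen => (0 : ℂ)) : FreeAlgebra ℂ Gen →+* ℂ))).comp
        (FreeQ.toSeries : FreeQ →+* _))
    (fun c a => by
      rw [RingHom.comp_apply, RingHom.comp_apply]
      change PowerSeries.map _ (FreeQ.toSeries (c • a)) = _
      rw [FreeQ.toSeries_smul, map_mul, RingHom.id_apply, smul_eq_mul]
      congr 1
      ext i j
      simp)
    (by
      have h1 : ∀ g, FreeQ.toSeries (FreeQ.gen g) =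
          PowerSeries.C (PowerSeries.C (FreeAlgebra.ι ℂ g)) := fun _ => rfl
      have h2 : PowerSeries.map
          (FreeAlgebra.lift ℂ (fun _ : Gen => (0 : ℂ)) : FreeAlgebra ℂ Gen →+* ℂ)
          (sinhDiv (FreeAlgebra.ι ℂ Gen.H)) = 0 := by
        ext k
        simp [coeff_sinhDiv]
      rintro a (rfl | rfl | rfl)
      · simp [FreeQ.toSeries_smul, h1]
      · simp [FreeQ.toSeries_smul, h1]
      · simp [FreeQ.toSeries_smul, h1, FreeQ.toSeries_ofSeries, h2]))
    (desc_one _ _ _) (desc_mul _ _ _)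

theorem counit_mk (a : FreeQ) : counit (mk a) = PowerSeries.map (PowerSeries.map
      (FreeAlgebra.lift ℂ (fun _ : Gen => (0 : ℂ)) : FreeAlgebra ℂ Gen →+* ℂ))
        (FreeQ.toSeries a) := rfl

theorem counit_gen (g : Gen) : counit (UQ.gen g) = 0 := by
  rw [← mk_gen, counit_mk]
  change PowerSeries.map _ (PowerSeries.C (PowerSeries.C (FreeAlgebra.ι ℂ g))) = 0
  simp

theorem counit_exp (t : ℂ) : counit (UQ.exp t) = 1 := by
  rw [← mk_ofSeries_expS, counit_mk, FreeQ.toSeries_ofSeries, PowerSeries.map_C,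
    map_expS (FreeAlgebra.lift ℂ (fun _ : Gen => (0 : ℂ))), FreeAlgebra.lift_ι_apply,
    expS_zero_right, map_one]

/-- Negating the generators extends antimultiplicatively since the hyperbolic quotient is odd.
Conjugation by κ = e^{rH/2} then creates the twist on E and F, and has no effect on H, which
commutes with κ. -/
theorem isTwistedAntipode :
    IsTwistedAntipode counit antipode UQ.gen (UQ.exp (1 / 2)) (UQ.exp (-1 / 2)) where
  counit_gen := counit_gen
  counit_pos := counit_exp _
  counit_neg := counit_exp _
  one := by rw [antipode_apply, negAnti, anti_one, mul_one, pos_mul_neg]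
  antimul a b := by
    rw [antipode_apply, antipode_apply, antipode_apply, negAnti, anti_mul]
    simp only [mul_assoc]
    rw [← mul_assoc (UQ.exp (-1 / 2)) (UQ.exp (1 / 2)), neg_mul_pos, one_mul]
  H := by
    rw [antipode_apply, negAnti_gen, mul_neg, neg_mul, exp_commute_H, mul_assoc, pos_mul_neg,
      mul_one]
  E := by rw [antipode_apply, negAnti_gen, mul_neg, neg_mul]
  F := by rw [antipode_apply, negAnti_gen, mul_neg, neg_mul]
  pos := by
    rw [antipode_apply, negAnti_exp, exp_mul_exp, exp_mul_exp]; norm_num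
  neg := by
    rw [antipode_apply, negAnti_exp, exp_mul_exp, exp_mul_exp]; norm_num

end UQ

/-! ### The completed enveloping algebra -/

section Sl2

theorem sl2_trace (x : sl2) : x.1 1 1 = -x.1 0 0 := by
  have h : Matrix.trace x.1 = 0 := x.2
  rw [Matrix.trace_fin_two] at h
  exact (neg_eq_of_add_eq_zero_right h).symm

theorem sl2_eq (x : sl2) :
    x = x.1 0 0 • sl2Gen .H + x.1 0 1 • sl2Gen .E + x.1 1 0 • sl2Gen .F := by
  apply Subtype.ext
  ext i j
  fin_cases i <;> fin_cases j <;> simp [sl2Gen, sl2_trace x]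

/-- The conjugate transpose on `sl₂`. -/
def sl2Dag : sl2 →+ sl2 where
  toFun x := ⟨x.1.conjTranspose, by
    change Matrix.trace x.1.conjTranspose = 0
    have h : Matrix.trace x.1 = 0 := x.2
    rw [Matrix.trace_conjTranspose, h, star_zero]⟩
  map_zero' := Subtype.ext (by simp)
  map_add' x y := Subtype.ext (by simp)

theorem sl2Dag_smul (c : ℂ) (x : sl2) : sl2Dag (c • x) = starRingEnd ℂ c • sl2Dag x :=
  Subtype.ext (by simp [sl2Dag])

theorem sl2Dag_lie (x y : sl2) : sl2Dag ⁅x, y⁆ = ⁅sl2Dag y, sl2Dag x⁆ :=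
  Subtype.ext (by simp [sl2Dag, Ring.lie_def])

theorem sl2Dag_gen (g : Gen) : sl2Dag (sl2Gen g) = sl2Gen g.dag := by
  apply Subtype.ext
  cases g <;> ext i j <;> fin_cases i <;> fin_cases j <;> simp [sl2Gen, sl2Dag, Gen.dag]

variable {B : Type*} [Ring B]

/-- The ring map from the tensor algebra with given values on scalars and on `sl₂`. -/
def tensorHom (α : ℂ →+* B) (hα : ∀ c b, α c * b = b * α c) (l : sl2 →+ B)
    (hl : ∀ c x, l (c • x) = α c * l x) : TensorAlgebra ℂ sl2 →+* B :=
  letI := α.toAlgebra' hα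
  (TensorAlgebra.lift ℂ ({ l with map_smul' := hl } : sl2 →ₗ[ℂ] B) : TensorAlgebra ℂ sl2 →ₐ[ℂ] B)

theorem tensorHom_algebraMap (α : ℂ →+* B) (hα : ∀ c b, α c * b = b * α c) (l : sl2 →+ B)
    (hl : ∀ c x, l (c • x) = α c * l x) (c : ℂ) : tensorHom α hα l hl (algebraMap ℂ _ c) = α c :=
  letI := α.toAlgebra' hα
  (TensorAlgebra.lift ℂ ({ l with map_smul' := hl } : sl2 →ₗ[ℂ] B) :
    TensorAlgebra ℂ sl2 →ₐ[ℂ] B).commutes c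

theorem tensorHom_ι (α : ℂ →+* B) (hα : ∀ c b, α c * b = b * α c) (l : sl2 →+ B)
    (hl : ∀ c x, l (c • x) = α c * l x) (x : sl2) :
    tensorHom α hα l hl (TensorAlgebra.ι ℂ x) = l x :=
  letI := α.toAlgebra' hα
  TensorAlgebra.lift_ι_apply ({ l with map_smul' := hl } : sl2 →ₗ[ℂ] B) x

end Sl2

namespace TensorH

/-- The underlying power series. -/
def toSeries : TensorH ≃+* (TensorAlgebra ℂ sl2)⟦X⟧ := RingEquiv.refl _

/-- The inclusion of the tensor algebra. -/
def C : TensorAlgebra ℂ sl2 →+* TensorH := PowerSeries.C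

theorem toSeries_C (a : TensorAlgebra ℂ sl2) : toSeries (C a) = PowerSeries.C a := rfl

theorem toSeries_ι (x : sl2) :
    toSeries (ι x) = PowerSeries.C (R := TensorAlgebra ℂ sl2) (TensorAlgebra.ι ℂ x) := rfl

theorem C_ι (x : sl2) : C (TensorAlgebra.ι ℂ x) = ι x := rfl

theorem toSeries_algebraMap (c : Ch) : toSeries (algebraMap Ch TensorH c) =
    PowerSeries.map (algebraMap ℂ (TensorAlgebra ℂ sl2)) c := rfl

theorem toSeries_smul (c : Ch) (f : TensorH) : toSeries (c • f) =
    PowerSeries.map (algebraMap ℂ (TensorAlgebra ℂ sl2)) c * toSeries f := by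
  rw [Algebra.smul_def, map_mul, toSeries_algebraMap]

theorem X_smul (f : TensorH) :
    toSeries ((PowerSeries.X : Ch) • f) = PowerSeries.X * toSeries f := by
  rw [toSeries_smul, PowerSeries.map_X]

theorem exists_eq_constant_add (f : TensorH) : ∃ g : TensorH,
    f = C (PowerSeries.constantCoeff (toSeries f)) + (PowerSeries.X : Ch) • g := by
  refine ⟨toSeries.symm (PowerSeries.mk fun p => PowerSeries.coeff (p + 1) (toSeries f)), ?_⟩
  apply toSeries.injective
  rw [map_add, X_smul, RingEquiv.apply_symm_apply, toSeries_C, add_comm (PowerSeries.C _),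
    ← PowerSeries.eq_X_mul_shift_add_const]

theorem ι_add (x y : sl2) : ι (x + y) = ι x + ι y := by
  rw [← C_ι, ← C_ι, ← C_ι, map_add, map_add]

theorem ι_smul (c : ℂ) (x : sl2) : ι (c • x) = algebraMap ℂ Ch c • ι x := by
  apply toSeries.injective
  rw [toSeries_smul, PowerSeries.algebraMap_apply, PowerSeries.map_C, toSeries_ι, toSeries_ι,
    ← map_mul, map_smul, Algebra.smul_def]
  rfl

section Eval

variable {B : Type*} [Ring B] [Algebra Ch B] {n : ℕ} (hB : KilledBy Ch B n)

/-- Evaluation of a series over the tensor algebra in an algebra killed by `𝔪ⁿ`. -/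
def eval (l : sl2 →+ B) (hl : ∀ (c : ℂ) x, l (c • x) = algebraMap ℂ Ch c • l x) : TensorH →+* B :=
  (evSeries (PowerSeries.X : Ch) n (hB.pow_smul X_mem_maximalIdeal)
    (tensorHom ((algebraMap Ch B).comp (algebraMap ℂ Ch)) (fun _ b => Algebra.commutes _ b) l
      (fun c x => (hl c x).trans (Algebra.smul_def _ _)))).comp
    (toSeries : TensorH →+* (TensorAlgebra ℂ sl2)⟦X⟧)

variable (l : sl2 →+ B) (hl : ∀ (c : ℂ) x, l (c • x) = algebraMap ℂ Ch c • l x)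

theorem eval_ι (x : sl2) : eval hB l hl (ι x) = l x :=
  (evSeries_C (hB.pow_smul X_mem_maximalIdeal) _ _).trans (tensorHom_ι _ _ _ _ _)

theorem eval_algebraMap (c : Ch) :
    eval hB l hl (algebraMap Ch TensorH c) = algebraMap Ch B c := by
  change evSeries (PowerSeries.X : Ch) n (hB.pow_smul X_mem_maximalIdeal) _
    (toSeries (algebraMap Ch TensorH c)) = _
  rw [toSeries_algebraMap, evSeries_map, ← evSeries_ringHom (hB.pow_smul X_mem_maximalIdeal)
    (algebraMap Ch B) rfl]
  refine congrArg (fun F : ℂ →+* B =>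
    evSeries (PowerSeries.X : Ch) n (hB.pow_smul X_mem_maximalIdeal) F c) (RingHom.ext fun d => ?_)
  refine (tensorHom_algebraMap ((algebraMap Ch B).comp (algebraMap ℂ Ch)) _ l _ d).trans ?_
  rw [RingHom.comp_apply, PowerSeries.algebraMap_apply]
  rfl

theorem eval_smul (c : Ch) (a : TensorH) :
    eval hB l hl (c • a) = c • eval hB l hl a := by
  rw [Algebra.smul_def, map_mul, eval_algebraMap, ← Algebra.smul_def]

end Eval

/-- The antimultiplicative map of the tensor algebra with given values on `sl₂`, semilinear over
a ring endomorphism of the coefficients. -/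
def antiTensor (α : ℂ →+* ℂ) (l : sl2 →+ sl2) (hl : ∀ c x, l (c • x) = α c • l x) :
    TensorAlgebra ℂ sl2 →+* (TensorAlgebra ℂ sl2)ᵐᵒᵖ :=
  tensorHom ((algebraMap ℂ (TensorAlgebra ℂ sl2)ᵐᵒᵖ).comp α)
    (fun c b => Algebra.commutes (α c) b)
    ((MulOpposite.opAddEquiv : _ ≃+ (TensorAlgebra ℂ sl2)ᵐᵒᵖ).toAddMonoidHom.comp
      ((TensorAlgebra.ι ℂ : sl2 →ₗ[ℂ] _).toAddMonoidHom.comp l))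
    (fun c x => by
      change MulOpposite.op (TensorAlgebra.ι ℂ (l (c • x))) = _
      rw [hl, map_smul, MulOpposite.op_smul, Algebra.smul_def]
      rfl)

/-- The antimultiplicative map with given values on `sl₂`. -/
def anti (α : ℂ →+* ℂ) (l : sl2 →+ sl2) (hl : ∀ c x, l (c • x) = α c • l x) :
    TensorH →+* TensorHᵐᵒᵖ :=
  opSeries (A := TensorAlgebra ℂ sl2) (B := TensorAlgebra ℂ sl2) (antiTensor α l hl)

section

variable (α : ℂ →+* ℂ) (l : sl2 →+ sl2) (hl : ∀ c x, l (c • x) = α c • l x)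

theorem antiTensor_algebraMap (c : ℂ) :
    antiTensor α l hl (algebraMap ℂ _ c) = MulOpposite.op (algebraMap ℂ _ (α c)) :=
  tensorHom_algebraMap _ _ _ _ c

theorem antiTensor_ι (x : sl2) :
    antiTensor α l hl (TensorAlgebra.ι ℂ x) = MulOpposite.op (TensorAlgebra.ι ℂ (l x)) :=
  tensorHom_ι _ _ _ _ x

theorem coeff_anti (a : TensorH) (i : ℕ) :
    PowerSeries.coeff i (toSeries (anti α l hl a).unop) =
      (antiTensor α l hl (PowerSeries.coeff i (toSeries a))).unop :=
  coeff_opSeries (A := TensorAlgebra ℂ sl2) (B := TensorAlgebra ℂ sl2) _ _ _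

theorem anti_algebraMap (c : Ch) : anti α l hl (algebraMap Ch TensorH c) =
    MulOpposite.op (algebraMap Ch TensorH (PowerSeries.map α c)) := by
  apply MulOpposite.unop_injective
  apply toSeries.injective
  rw [MulOpposite.unop_op, toSeries_algebraMap]
  ext i : 1
  rw [coeff_anti, toSeries_algebraMap]
  simp only [PowerSeries.coeff_map, antiTensor_algebraMap, MulOpposite.unop_op]

theorem anti_smul (c : Ch) (a : TensorH) : (anti α l hl (c • a)).unop =
    PowerSeries.map α c • (anti α l hl a).unop := by
  rw [Algebra.smul_def, map_mul, anti_algebraMap, MulOpposite.unop_mul, MulOpposite.unop_op,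
    ← Algebra.commutes, ← Algebra.smul_def]

theorem anti_ι (x : sl2) : anti α l hl (ι x) = MulOpposite.op (ι (l x)) := by
  apply MulOpposite.unop_injective
  apply toSeries.injective
  ext i : 1
  rw [coeff_anti, MulOpposite.unop_op, toSeries_ι, toSeries_ι, PowerSeries.coeff_C,
    PowerSeries.coeff_C]
  split
  · rw [antiTensor_ι, MulOpposite.unop_op]
  · simp

end

end TensorH

namespace UH

instance : IsHausdorff (IsLocalRing.maximalIdeal Ch) UH :=
  inferInstanceAs (IsHausdorff (IsLocalRing.maximalIdeal Ch) (TensorH ⧸ closedIdeal Ch relH))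

/-- The quotient map. -/
def mk : TensorH →ₐ[Ch] UH := Ideal.Quotient.mkₐ Ch (closedIdeal Ch relH)

theorem mk_surjective : Function.Surjective mk := Ideal.Quotient.mk_surjective

theorem mk_ι (x : sl2) : mk (TensorH.ι x) = UH.ι x := rfl

/-- The generators `H, E, F`. -/
def gen (g : Gen) : UH := UH.ι (sl2Gen g)

theorem ι_add (x y : sl2) : UH.ι (x + y) = UH.ι x + UH.ι y := by
  rw [← mk_ι, ← mk_ι, ← mk_ι, TensorH.ι_add, map_add]

theorem ι_smul (c : ℂ) (x : sl2) : UH.ι (c • x) = algebraMap ℂ Ch c • UH.ι x := by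
  rw [← mk_ι, ← mk_ι, TensorH.ι_smul, map_smul]

theorem ι_neg (x : sl2) : UH.ι (-x) = -UH.ι x := by
  rw [← neg_one_smul ℂ, ι_smul, map_neg, map_one, neg_one_smul]

theorem rel (x y : sl2) :
    UH.ι x * UH.ι y - UH.ι y * UH.ι x = (PowerSeries.X : Ch) • UH.ι ⁅x, y⁆ := by
  rw [← sub_eq_zero, ← mk_ι, ← mk_ι, ← mk_ι, ← map_mul, ← map_mul, ← map_smul, ← map_sub, ← map_sub]
  exact Ideal.Quotient.eq_zero_iff_mem.2 (subset_closedIdeal ⟨x, y, rfl⟩)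

/-- Semilinear maps out of `U^ħ(sl₂)`. -/
def desc {S B : Type*} [CommRing S] [IsLocalRing S] [Ring B] [Algebra S B] {σ : Ch →+* S}
    [IsLocalHom σ] (φ : TensorH →+* B) (hφ : ∀ (c : Ch) a, φ (c • a) = σ c • φ a)
    [IsHausdorff (IsLocalRing.maximalIdeal S) B] (h : ∀ x ∈ relH, φ x = 0) : UH →ₛₗ[σ] B :=
  quotDesc φ hφ h

section

variable {S B : Type*} [CommRing S] [IsLocalRing S] [Ring B] [Algebra S B] {σ : Ch →+* S}
    [IsLocalHom σ] (φ : TensorH →+* B) (hφ : ∀ (c : Ch) a, φ (c • a) = σ c • φ a)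
    [IsHausdorff (IsLocalRing.maximalIdeal S) B] (h : ∀ x ∈ relH, φ x = 0)

theorem desc_one : desc φ hφ h 1 = 1 := quotDesc_one φ hφ h

theorem desc_mul (a b : UH) : desc φ hφ h (a * b) = desc φ hφ h a * desc φ hφ h b :=
  quotDesc_mul φ hφ h a b

end

section Lift

variable {B : Type*} [Ring B] [Algebra Ch B] {n : ℕ} (hB : KilledBy Ch B n)

/-- The universal property of `U^ħ(sl₂)` for algebras killed by `𝔪ⁿ`. -/
def lift (l : sl2 →+ B) (hl : ∀ (c : ℂ) x, l (c • x) = algebraMap ℂ Ch c • l x)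
    (hx : ∀ x y, l x * l y - l y * l x = (PowerSeries.X : Ch) • l ⁅x, y⁆) : UH →ₐ[Ch] B :=
  haveI := isHausdorff_of_killedBy hB
  have h : ∀ a ∈ relH, TensorH.eval hB l hl a = 0 := by
    rintro a ⟨x, y, rfl⟩
    simp only [map_sub, map_mul, TensorH.eval_smul, TensorH.eval_ι, hx, sub_self]
  AlgHom.ofLinearMap (desc (σ := RingHom.id Ch) (TensorH.eval hB l hl) (TensorH.eval_smul hB l hl) h)
    (desc_one _ _ _) (desc_mul _ _ _)

variable (l : sl2 →+ B) (hl : ∀ (c : ℂ) x, l (c • x) = algebraMap ℂ Ch c • l x)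
    (hx : ∀ x y, l x * l y - l y * l x = (PowerSeries.X : Ch) • l ⁅x, y⁆)

theorem lift_ι (x : sl2) : lift hB l hl hx (ι x) = l x := TensorH.eval_ι hB l hl x

end Lift

theorem ι_mem_adjoin (x : sl2) : UH.ι x ∈ Algebra.adjoin Ch (Set.range UH.gen) := by
  rw [sl2_eq x, ι_add, ι_add, ι_smul, ι_smul, ι_smul]
  have h : ∀ g, UH.gen g ∈ Algebra.adjoin Ch (Set.range UH.gen) := fun g =>
    Algebra.subset_adjoin ⟨g, rfl⟩
  exact add_mem (add_mem (Subalgebra.smul_mem _ (h .H) _) (Subalgebra.smul_mem _ (h .E) _))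
    (Subalgebra.smul_mem _ (h .F) _)

theorem mk_C_mem_adjoin (a : TensorAlgebra ℂ sl2) :
    mk (TensorH.C a) ∈ Algebra.adjoin Ch (Set.range UH.gen) := by
  induction a using TensorAlgebra.induction with
  | algebraMap c =>
    have : TensorH.C (algebraMap ℂ (TensorAlgebra ℂ sl2) c) =
        algebraMap Ch TensorH (PowerSeries.C c) := by
      apply TensorH.toSeries.injective
      rw [TensorH.toSeries_algebraMap, PowerSeries.map_C, TensorH.toSeries_C]
    rw [this, AlgHom.commutes]
    exact Subalgebra.algebraMap_mem _ _
  | ι x => exact ι_mem_adjoin x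
  | mul a b ha hb => rw [map_mul, map_mul]; exact mul_mem ha hb
  | add a b ha hb => rw [map_add, map_add]; exact add_mem ha hb

theorem topGen : TopGen Ch UH.gen := TopGen.of_one fun a => by
  obtain ⟨f, rfl⟩ := mk_surjective a
  obtain ⟨g, hf⟩ := TensorH.exists_eq_constant_add f
  refine ⟨_, mk_C_mem_adjoin (PowerSeries.constantCoeff (TensorH.toSeries f)), ?_⟩
  rw [← map_sub, sub_eq_iff_eq_add'.2 hf, map_smul, mem_adicIdeal, pow_one]
  exact Submodule.smul_mem_smul X_mem_maximalIdeal Submodule.mem_top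

/-- The coproduct on truncations. -/
def comulLevel (n : ℕ) : UH →ₐ[Ch] Trunc Ch UH n ⊗[Ch] Trunc Ch UH n :=
  lift (killedBy_tensor n)
    (AddMonoidHom.mk' (fun x => Trunc.mk Ch UH n (UH.ι x) ⊗ₜ 1 + 1 ⊗ₜ Trunc.mk Ch UH n (UH.ι x))
      (fun x y => by
        simp only [ι_add, map_add, TensorProduct.add_tmul, TensorProduct.tmul_add]; abel))
    (fun c x => by
      simp only [AddMonoidHom.mk'_apply, ι_smul, map_smul, TensorProduct.smul_tmul',
        TensorProduct.tmul_smul, smul_add])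
    (fun x y => by
      have h : Trunc.mk Ch UH n (UH.ι x) * Trunc.mk Ch UH n (UH.ι y) =
          (PowerSeries.X : Ch) • Trunc.mk Ch UH n (UH.ι ⁅x, y⁆) +
            Trunc.mk Ch UH n (UH.ι y) * Trunc.mk Ch UH n (UH.ι x) := by
        rw [← map_mul, ← map_mul, ← map_smul, ← rel, ← map_add, sub_add_cancel]
      simp only [AddMonoidHom.mk'_apply, add_mul, mul_add, Algebra.TensorProduct.tmul_mul_tmul,
        one_mul, mul_one, h, TensorProduct.add_tmul, TensorProduct.tmul_add, smul_add,
        TensorProduct.smul_tmul', TensorProduct.tmul_smul]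
      abel)

/-- The coproduct `Δ₀` of `U^ħ(sl₂)`. -/
def comul : UH →ₐ[Ch] CTensor Ch UH :=
  comulOfFamily comulLevel fun n => topGen.algHom_ext (killedBy_tensor n) fun g => by
    rw [AlgHom.comp_apply, comulLevel, comulLevel, gen, lift_ι, lift_ι]
    simp [transition_mk]

theorem comul_ι (x : sl2) : comul (UH.ι x) = ctmul Ch (UH.ι x) 1 + ctmul Ch 1 (UH.ι x) :=
  CTensor.ext fun n => by
    rw [comul, comulOfFamily_val, comulLevel, lift_ι, CTensor.add_val, ctmul_val, ctmul_val,
      map_one]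
    rfl

/-- The untwisted case: with trivial group-likes, twisted primitive means primitive. -/
theorem isTwistedCoproduct : IsTwistedCoproduct comul UH.gen 1 1 where
  inv := one_mul 1
  inv' := one_mul 1
  pos := by rw [map_one]; rfl
  neg := by rw [map_one]; rfl
  H := comul_ι _
  E := comul_ι _
  F := comul_ι _

section

variable (α : ℂ →+* ℂ) (l : sl2 →+ sl2) (hl : ∀ c x, l (c • x) = α c • l x)
  (hlie : ∀ x y, l ⁅x, y⁆ = ⁅l y, l x⁆)

/-- The antimultiplicative maps of `U^ħ(sl₂)`, with values in the opposite algebra. -/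
def antiOp : UH →ₛₗ[PowerSeries.map α] UHᵐᵒᵖ :=
  desc ((mk : TensorH →+* UH).op.comp (TensorH.anti α l hl))
    (fun c a => MulOpposite.unop_injective (by
      change mk (TensorH.anti α l hl (c • a)).unop = _
      rw [TensorH.anti_smul, map_smul]; rfl))
    (fun a ha => MulOpposite.unop_injective (by
      change mk (TensorH.anti α l hl a).unop = 0
      obtain ⟨x, y, rfl⟩ := ha
      simp only [map_sub, map_mul, MulOpposite.unop_sub, MulOpposite.unop_mul, TensorH.anti_smul,
        TensorH.anti_ι, MulOpposite.unop_op, map_smul, mk_ι, PowerSeries.map_X, rel, hlie,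
        sub_self]))

/-- The antimultiplicative maps of `U^ħ(sl₂)`. -/
def anti : UH →ₛₗ[PowerSeries.map α] UH where
  toFun a := (antiOp α l hl hlie a).unop
  map_add' a b := by rw [map_add, MulOpposite.unop_add]
  map_smul' c a := by rw [map_smulₛₗ, MulOpposite.unop_smul]

theorem anti_mk (a : TensorH) : anti α l hl hlie (mk a) = mk (TensorH.anti α l hl a).unop := rfl

theorem anti_one : anti α l hl hlie 1 = 1 := by
  change (antiOp α l hl hlie 1).unop = 1
  rw [antiOp, desc_one, MulOpposite.unop_one]

theorem anti_mul (a b : UH) :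
    anti α l hl hlie (a * b) = anti α l hl hlie b * anti α l hl hlie a := by
  change (antiOp α l hl hlie (a * b)).unop =
    (antiOp α l hl hlie b).unop * (antiOp α l hl hlie a).unop
  rw [antiOp, desc_mul, MulOpposite.unop_mul]

theorem anti_ι (x : sl2) : anti α l hl hlie (UH.ι x) = UH.ι (l x) := by
  rw [← mk_ι, anti_mk, TensorH.anti_ι]; rfl

end

/-- The involution `†` of `U^ħ(sl₂)`. -/
def dag : UH →ₛₗ[conj₁] UH := anti (starRingEnd ℂ) sl2Dag sl2Dag_smul sl2Dag_lie

theorem dag_gen (g : Gen) : dag (UH.gen g) = UH.gen g.dag := by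
  rw [dag, gen, anti_ι, sl2Dag_gen]; rfl

/-- The map `x ↦ -x` extended antimultiplicatively. -/
def negAnti : UH →ₛₗ[PowerSeries.map (RingHom.id ℂ)] UH :=
  anti (RingHom.id ℂ) (-AddMonoidHom.id sl2) (fun c x => by simp) (fun x y => by simp)

/-- The antipode of `U^ħ(sl₂)`. -/
def antipode : UH →ₗ[Ch] UH where
  toFun a := negAnti a
  map_add' a b := map_add _ a b
  map_smul' c a := by
    have h : PowerSeries.map (RingHom.id ℂ) c = c := by
      ext i
      simp
    rw [map_smulₛₗ, h, RingHom.id_apply]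

theorem antipode_apply (a : UH) : antipode a = negAnti a := rfl

theorem antipode_ι (x : sl2) : antipode (UH.ι x) = -UH.ι x := by
  rw [antipode_apply, negAnti, anti_ι, ← ι_neg]; rfl

/-- The counit of `U^ħ(sl₂)`. -/
def counit : UH →ₐ[Ch] Ch :=
  AlgHom.ofLinearMap (desc (σ := RingHom.id Ch)
    ((PowerSeries.map
      (TensorAlgebra.lift ℂ (0 : sl2 →ₗ[ℂ] ℂ) : TensorAlgebra ℂ sl2 →+* ℂ)).comp
        (TensorH.toSeries : TensorH →+* _))
    (fun c a => by
      rw [RingHom.comp_apply, RingHom.comp_apply]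
      change PowerSeries.map _ (TensorH.toSeries (c • a)) = _
      rw [TensorH.toSeries_smul, map_mul, RingHom.id_apply, smul_eq_mul]
      congr 1
      ext i
      simp)
    (by
      rintro a ⟨x, y, rfl⟩
      simp [TensorH.toSeries_smul, TensorH.toSeries_ι]))
    (desc_one _ _ _) (desc_mul _ _ _)

theorem counit_ι (x : sl2) : counit (UH.ι x) = 0 := by
  change PowerSeries.map (TensorAlgebra.lift ℂ (0 : sl2 →ₗ[ℂ] ℂ) : TensorAlgebra ℂ sl2 →+* ℂ)
    (PowerSeries.C (TensorAlgebra.ι ℂ x)) = 0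
  simp

theorem isTwistedAntipode : IsTwistedAntipode counit antipode UH.gen 1 1 where
  counit_gen _ := counit_ι _
  counit_pos := map_one _
  counit_neg := map_one _
  one := anti_one _ _ _ _
  antimul := anti_mul _ _ _ _
  H := antipode_ι _
  E := by rw [one_mul, mul_one]; exact antipode_ι _
  F := by rw [one_mul, mul_one]; exact antipode_ι _
  pos := anti_one _ _ _ _
  neg := anti_one _ _ _ _

end UH

/-! ### The commutative algebras -/

section Commutative

variable {B : Type*} [Ring B] (hB : ∀ a b : B, a * b = b * a)

/-- The ring map from the polynomial ring with given values on scalars and generators. -/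
def polyHom (α : ℂ →+* B) (x : Gen → B) : Flat →+* B :=
  letI : CommRing B := { (inferInstance : Ring B) with mul_comm := hB }
  MvPolynomial.eval₂Hom α x

theorem polyHom_C (α : ℂ →+* B) (x : Gen → B) (c : ℂ) :
    polyHom hB α x (MvPolynomial.C c) = α c :=
  letI : CommRing B := { (inferInstance : Ring B) with mul_comm := hB }
  MvPolynomial.eval₂Hom_C α x c

theorem polyHom_X (α : ℂ →+* B) (x : Gen → B) (g : Gen) :
    polyHom hB α x (MvPolynomial.X g) = x g :=
  letI : CommRing B := { (inferInstance : Ring B) with mul_comm := hB }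
  MvPolynomial.eval₂Hom_X' α x g

theorem tensor_mul_comm {R T : Type*} [CommRing R] [Ring T] [Algebra R T]
    (hT : ∀ a b : T, a * b = b * a) (u v : T ⊗[R] T) : u * v = v * u := by
  induction u with
  | zero => simp
  | add u w hu hw => rw [add_mul, mul_add, hu, hw]
  | tmul a b =>
    induction v with
    | zero => simp
    | add v w hv hw => rw [add_mul, mul_add, hv, hw]
    | tmul c d =>
      rw [Algebra.TensorProduct.tmul_mul_tmul, Algebra.TensorProduct.tmul_mul_tmul, hT a, hT b]

theorem trunc_mul_comm {R A : Type*} [CommRing R] [IsLocalRing R] [CommRing A] [Algebra R A] (n : ℕ)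
    (a b : Trunc R A n) : a * b = b * a := by
  obtain ⟨a, rfl⟩ := Trunc.mk_surjective n a
  obtain ⟨b, rfl⟩ := Trunc.mk_surjective n b
  rw [← map_mul, ← map_mul, mul_comm]

theorem trunc_tensor_mul_comm {R A : Type*} [CommRing R] [IsLocalRing R] [CommRing A] [Algebra R A]
    (n : ℕ) (u v : Trunc R A n ⊗[R] Trunc R A n) : u * v = v * u :=
  tensor_mul_comm (trunc_mul_comm n) u v

end Commutative

/-! ### The flat algebra `ℂ[su₂*]` -/

namespace Flat

theorem topGen : TopGen ℂ (MvPolynomial.X : Gen → Flat) := fun n a =>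
  ⟨a, by rw [MvPolynomial.adjoin_range_X]; trivial, by rw [sub_self]; exact zero_mem _⟩

/-- The coproduct on truncations. -/
def comulLevel (n : ℕ) : Flat →ₐ[ℂ] Trunc ℂ Flat n ⊗[ℂ] Trunc ℂ Flat n :=
  { polyHom (trunc_tensor_mul_comm n) (algebraMap ℂ _)
      (twistedTensor (fun g => Trunc.mk ℂ Flat n (MvPolynomial.X g)) 1 1) with
    commutes' := polyHom_C _ _ _ }

theorem comulLevel_X (n : ℕ) (g : Gen) : comulLevel n (MvPolynomial.X g) =
    twistedTensor (fun g => Trunc.mk ℂ Flat n (MvPolynomial.X g)) 1 1 g :=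
  polyHom_X _ _ _ _

/-- The coproduct `Δ₀` of `ℂ[su₂*]`. -/
def comul : Flat →ₐ[ℂ] CTensor ℂ Flat :=
  comulOfFamily comulLevel fun n => topGen.algHom_ext (killedBy_tensor n) fun g => by
    rw [AlgHom.comp_apply, comulLevel_X, comulLevel_X]
    cases g <;> simp [twistedTensor, transition_mk]

theorem comul_X (g : Gen) : comul (MvPolynomial.X g) =
    ctmul ℂ (MvPolynomial.X g) 1 + ctmul ℂ 1 (MvPolynomial.X g) :=
  CTensor.ext fun n => by
    rw [comul, comulOfFamily_val, comulLevel_X, CTensor.add_val, ctmul_val, ctmul_val, map_one]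
    cases g <;> rfl

theorem isTwistedCoproduct : IsTwistedCoproduct comul (MvPolynomial.X : Gen → Flat) 1 1 where
  inv := one_mul 1
  inv' := one_mul 1
  pos := by rw [map_one]; rfl
  neg := by rw [map_one]; rfl
  H := comul_X _
  E := comul_X _
  F := comul_X _

theorem linear_eq (x : sl2) : Flat.linear x = x.1 0 0 • MvPolynomial.X .H +
    x.1 0 1 • MvPolynomial.X .E + x.1 1 0 • MvPolynomial.X .F := by
  simp only [Flat.linear, MvPolynomial.smul_eq_C_mul]

theorem linear_sl2Gen (g : Gen) : Flat.linear (sl2Gen g) = MvPolynomial.X g := by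
  cases g <;> simp [Flat.linear, sl2Gen]

theorem comul_linear (x : sl2) : comul (Flat.linear x) =
    ctmul ℂ (Flat.linear x) 1 + ctmul ℂ 1 (Flat.linear x) := by
  simp only [linear_eq, map_add, map_smul, comul_X, ctmul_add, add_ctmul, smul_ctmul, ctmul_smul,
    smul_add]
  abel

theorem isTwistedAntipode : IsTwistedAntipode (MvPolynomial.aeval (fun _ => (0 : ℂ)))
    (MvPolynomial.aeval (fun g => -MvPolynomial.X g) : Flat →ₐ[ℂ] Flat).toLinearMap
    (MvPolynomial.X : Gen → Flat) 1 1 where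
  counit_gen _ := by simp
  counit_pos := by simp
  counit_neg := by simp
  one := by simp
  antimul _ _ := by simp [mul_comm]
  H := by simp
  E := by simp
  F := by simp
  pos := by simp
  neg := by simp

/-- The involution `†` as a ring map. -/
def dagHom : Flat →+* Flat :=
  MvPolynomial.eval₂Hom (MvPolynomial.C.comp (starRingEnd ℂ)) fun g => MvPolynomial.X g.dag

theorem dagHom_X (g : Gen) : dagHom (MvPolynomial.X g) = MvPolynomial.X g.dag := by
  simp [dagHom]

theorem dagHom_smul (c : ℂ) (a : Flat) : dagHom (c • a) = starRingEnd ℂ c • dagHom a := by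
  rw [MvPolynomial.smul_eq_C_mul, MvPolynomial.smul_eq_C_mul, map_mul]
  simp [dagHom]

/-- The involution `†` of `ℂ[su₂*]`. -/
def dag : Flat →ₛₗ[starRingEnd ℂ] Flat := { dagHom with map_smul' := dagHom_smul }

theorem dag_apply (a : Flat) : dag a = dagHom a := rfl

/-- The bracket `{·,·}₀`. -/
def bracket : Flat →ₗ[ℂ] Flat →ₗ[ℂ] Flat :=
  derivBracket (MvPolynomial.pderiv .H) (MvPolynomial.pderiv .E) (MvPolynomial.pderiv .F)
    (MvPolynomial.X .E) (MvPolynomial.X .F) (MvPolynomial.X .H)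

/-- The commutator of the two derivations is a derivation that vanishes on the variables. -/
theorem pderiv_comm (i j : Gen) (a : Flat) : MvPolynomial.pderiv i (MvPolynomial.pderiv j a) =
    MvPolynomial.pderiv j (MvPolynomial.pderiv i a) := by
  classical
  have h : ⁅(MvPolynomial.pderiv i : Derivation ℂ Flat Flat),
      (MvPolynomial.pderiv j : Derivation ℂ Flat Flat)⁆ = 0 := by
    refine MvPolynomial.derivation_ext fun k => ?_
    rw [Derivation.commutator_apply]
    rw [MvPolynomial.pderiv_X, MvPolynomial.pderiv_X, Pi.single_apply, Pi.single_apply]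
    split <;> split <;> simp
  rw [← sub_eq_zero, ← Derivation.commutator_apply, h, Derivation.zero_apply]

theorem isPoissonBracket : IsPoissonBracket bracket :=
  isPoissonBracket_derivBracket (pderiv_comm _ _) (pderiv_comm _ _) (pderiv_comm _ _)
    (MvPolynomial.pderiv_X_of_ne (by simp)) (MvPolynomial.pderiv_X_self _)
    (MvPolynomial.pderiv_X_of_ne (by simp)) (MvPolynomial.pderiv_X_of_ne (by simp))
    (MvPolynomial.pderiv_X_of_ne (by simp)) (MvPolynomial.pderiv_X_self _)
    (MvPolynomial.pderiv_X_of_ne (by simp)) (MvPolynomial.pderiv_X_of_ne (by simp))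

theorem pderiv_linear (x : sl2) :
    MvPolynomial.pderiv Gen.H (Flat.linear x) = MvPolynomial.C (x.1 0 0) ∧
    MvPolynomial.pderiv Gen.E (Flat.linear x) = MvPolynomial.C (x.1 0 1) ∧
    MvPolynomial.pderiv Gen.F (Flat.linear x) = MvPolynomial.C (x.1 1 0) := by
  refine ⟨?_, ?_, ?_⟩ <;>
  simp [Flat.linear, MvPolynomial.pderiv_X_of_ne, Derivation.leibniz]

theorem bracket_linear (x y : sl2) :
    bracket (Flat.linear x) (Flat.linear y) = Flat.linear ⁅x, y⁆ := by
  obtain ⟨h1, h2, h3⟩ := pderiv_linear x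
  obtain ⟨h4, h5, h6⟩ := pderiv_linear y
  rw [bracket, derivBracket_apply, h1, h2, h3, h4, h5, h6, Flat.linear,
    LieAlgebra.SpecialLinear.sl_bracket]
  simp only [Matrix.sub_apply, Matrix.mul_apply, Fin.sum_univ_two, sl2_trace, map_sub, map_add,
    map_mul, map_neg]
  ring

end Flat

/-! ### The curved algebra `ℂ[(SU₂*)_r]` -/

namespace Curved

theorem algebraMap_eq (c : Cr) :
    algebraMap Cr Curved c = PowerSeries.map (algebraMap ℂ Flat) c := rfl

theorem exists_eq_constant_add (f : Curved) : ∃ g : Curved,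
    f = PowerSeries.C (PowerSeries.constantCoeff f) + (PowerSeries.X : Cr) • g := by
  refine ⟨PowerSeries.mk fun p => PowerSeries.coeff (p + 1) f, ?_⟩
  rw [Algebra.smul_def, algebraMap_eq, PowerSeries.map_X, add_comm,
    ← PowerSeries.eq_X_mul_shift_add_const]

theorem C_mem_adjoin (a : Flat) :
    (PowerSeries.C a : Curved) ∈ Algebra.adjoin Cr (Set.range Curved.gen) := by
  induction a using MvPolynomial.induction_on with
  | C c =>
    have : (PowerSeries.C (MvPolynomial.C c) : Curved) = algebraMap Cr Curved (PowerSeries.C c) := by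
      rw [algebraMap_eq, PowerSeries.map_C]; rfl
    rw [this]
    exact Subalgebra.algebraMap_mem _ _
  | add a b ha hb => rw [map_add]; exact add_mem ha hb
  | mul_X a g ha => rw [map_mul]; exact mul_mem ha (Algebra.subset_adjoin ⟨g, rfl⟩)

theorem topGen : TopGen Cr Curved.gen := TopGen.of_one fun f => by
  obtain ⟨g, hf⟩ := exists_eq_constant_add f
  refine ⟨_, C_mem_adjoin (PowerSeries.constantCoeff f), ?_⟩
  rw [sub_eq_iff_eq_add'.2 hf, mem_adicIdeal, pow_one]
  exact Submodule.smul_mem_smul X_mem_maximalIdeal Submodule.mem_top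

section Lift

variable {B : Type*} [Ring B] [Algebra Cr B] {n : ℕ} (hB : KilledBy Cr B n)
  (hc : ∀ a b : B, a * b = b * a)

/-- The universal property of `ℂ[(SU₂*)_r]` for commutative algebras killed by `𝔪ⁿ`. -/
def lift (x : Gen → B) : Curved →ₐ[Cr] B :=
  { evSeries (PowerSeries.X : Cr) n (hB.pow_smul X_mem_maximalIdeal)
      (polyHom hc ((algebraMap Cr B).comp (algebraMap ℂ Cr)) x) with
    commutes' := fun c => by
      change evSeries (PowerSeries.X : Cr) n (hB.pow_smul X_mem_maximalIdeal) _
        (algebraMap Cr Curved c) = _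
      rw [algebraMap_eq, evSeries_map, ← evSeries_ringHom (hB.pow_smul X_mem_maximalIdeal)
        (algebraMap Cr B) rfl]
      refine congrArg (fun F : ℂ →+* B =>
        evSeries (PowerSeries.X : Cr) n (hB.pow_smul X_mem_maximalIdeal) F c)
        (RingHom.ext fun d => ?_)
      refine (polyHom_C hc ((algebraMap Cr B).comp (algebraMap ℂ Cr)) x d).trans ?_
      rw [RingHom.comp_apply, PowerSeries.algebraMap_apply]
      rfl }

theorem lift_gen (x : Gen → B) (g : Gen) : lift hB hc x (Curved.gen g) = x g :=
  (evSeries_C (hB.pow_smul X_mem_maximalIdeal) _ _).trans (polyHom_X _ _ _ _)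

theorem lift_exp (x : Gen → B) (t : ℂ) :
    lift hB hc x (Curved.exp t) = texp (PowerSeries.X : Cr) n t (x .H) := by
  refine (evSeries_map_expS (hB.pow_smul X_mem_maximalIdeal) _ (polyHom_C _ _ _) t _).trans ?_
  rw [polyHom_X]

end Lift

/-- By uniqueness on generators, truncation is itself an evaluation; the truncated form of e^{trH}
then follows from the value of evaluations on exponentials. -/
theorem lift_mk_gen (n : ℕ) : lift (killedBy_trunc n) (trunc_mul_comm n)
    (fun g => Trunc.mk Cr Curved n (Curved.gen g)) = Trunc.mk Cr Curved n :=
  topGen.algHom_ext (killedBy_trunc n) fun g => lift_gen _ _ _ g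

theorem trunc_mk_exp (n : ℕ) (t : ℂ) : Trunc.mk Cr Curved n (Curved.exp t) =
    texp (PowerSeries.X : Cr) n t (Trunc.mk Cr Curved n (Curved.gen .H)) := by
  conv_lhs => rw [← lift_mk_gen n]
  rw [lift_exp]

theorem exp_mul_exp (s t : ℂ) : Curved.exp s * Curved.exp t = Curved.exp (s + t) :=
  expS_mul_expS _ _ _

theorem exp_zero : Curved.exp 0 = 1 := expS_zero _

theorem pos_mul_neg : Curved.exp (1 / 2) * Curved.exp (-1 / 2) = 1 := by
  rw [exp_mul_exp, ← exp_zero]; norm_num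

/-- The coproduct on truncations. -/
def comulLevel (n : ℕ) : Curved →ₐ[Cr] Trunc Cr Curved n ⊗[Cr] Trunc Cr Curved n :=
  lift (killedBy_tensor n) (trunc_tensor_mul_comm n)
    (twistedTensor (fun g => Trunc.mk Cr Curved n (Curved.gen g))
    (Trunc.mk Cr Curved n (Curved.exp (1 / 2))) (Trunc.mk Cr Curved n (Curved.exp (-1 / 2))))

/-- The coproduct `Δ_r` of `ℂ[(SU₂*)_r]`. -/
def comul : Curved →ₐ[Cr] CTensor Cr Curved :=
  comulOfFamily comulLevel fun n => topGen.algHom_ext (killedBy_tensor n) fun g => by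
    rw [AlgHom.comp_apply, comulLevel, comulLevel, lift_gen, lift_gen]
    cases g <;> simp [twistedTensor, transition_mk]

theorem comul_gen_val (g : Gen) (n : ℕ) : (comul (Curved.gen g)).1 n =
    twistedTensor (fun g => Trunc.mk Cr Curved n (Curved.gen g))
    (Trunc.mk Cr Curved n (Curved.exp (1 / 2))) (Trunc.mk Cr Curved n (Curved.exp (-1 / 2))) g := by
  rw [comul, comulOfFamily_val, comulLevel, lift_gen]

theorem comul_exp (t : ℂ) : comul (Curved.exp t) = ctmul Cr (Curved.exp t) (Curved.exp t) :=
  CTensor.ext fun n => by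
    rw [comul, comulOfFamily_val, comulLevel, lift_exp, ctmul_val, trunc_mk_exp n t]
    exact texp_primitive ((killedBy_tensor (R := Cr) (A := Curved) n).pow_smul X_mem_maximalIdeal)
      t _

theorem isTwistedCoproduct :
    IsTwistedCoproduct comul Curved.gen (Curved.exp (1 / 2)) (Curved.exp (-1 / 2)) where
  inv := pos_mul_neg
  inv' := by rw [mul_comm, pos_mul_neg]
  pos := comul_exp _
  neg := comul_exp _
  H := CTensor.ext fun n => by
    rw [comul_gen_val, CTensor.add_val, ctmul_val, ctmul_val, map_one]; rfl
  E := CTensor.ext fun n => comul_gen_val _ n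
  F := CTensor.ext fun n => comul_gen_val _ n

theorem map_smul_of_algHom {A : Type*} [CommRing A] [Algebra ℂ A] (f : Flat →ₐ[ℂ] A) (c : Cr)
    (a : Curved) : PowerSeries.map (f : Flat →+* A) (c • a) =
      PowerSeries.map (algebraMap ℂ A) c * PowerSeries.map (f : Flat →+* A) a := by
  rw [Algebra.smul_def, map_mul, algebraMap_eq]
  congr 1
  ext i
  simp

/-- The evaluation of polynomials at the origin. -/
abbrev evalZero : Flat →ₐ[ℂ] ℂ := MvPolynomial.aeval (fun _ : Gen => (0 : ℂ))

/-- The inversion of the additive group `su₂*`. -/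
abbrev negHom : Flat →ₐ[ℂ] Flat := MvPolynomial.aeval (fun g : Gen => -MvPolynomial.X g)

/-- The counit of `ℂ[(SU₂*)_r]`. -/
def counit : Curved →ₐ[Cr] Cr :=
  AlgHom.ofLinearMap
    { PowerSeries.map (evalZero : Flat →+* ℂ) with
      map_smul' := fun c a => (map_smul_of_algHom evalZero c a).trans (by congr 1) }
    (map_one (PowerSeries.map (evalZero : Flat →+* ℂ)))
    (map_mul (PowerSeries.map (evalZero : Flat →+* ℂ)))

theorem counit_apply (a : Curved) :
    counit a = PowerSeries.map (evalZero : Flat →+* ℂ) a := rfl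

theorem counit_gen (g : Gen) : counit (Curved.gen g) = 0 := by
  rw [counit_apply, Curved.gen, PowerSeries.map_C]
  simp

theorem counit_exp (t : ℂ) : counit (Curved.exp t) = 1 := by
  rw [counit_apply, Curved.exp, map_expS, MvPolynomial.aeval_X, expS_zero_right]

/-- The antipode of `ℂ[(SU₂*)_r]`. -/
def antipode : Curved →ₗ[Cr] Curved :=
  { PowerSeries.map (negHom : Flat →+* Flat) with
    map_smul' := fun c a => (map_smul_of_algHom negHom c a).trans (by
      rw [RingHom.id_apply, Algebra.smul_def, algebraMap_eq]; rfl) }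

theorem antipode_apply (a : Curved) :
    antipode a = PowerSeries.map (negHom : Flat →+* Flat) a := rfl

theorem antipode_gen (g : Gen) : antipode (Curved.gen g) = -Curved.gen g := by
  rw [antipode_apply, Curved.gen, PowerSeries.map_C]
  simp

theorem antipode_exp (t : ℂ) : antipode (Curved.exp t) = Curved.exp (-t) := by
  rw [antipode_apply, Curved.exp, map_expS, MvPolynomial.aeval_X, ← neg_one_smul ℂ, expS_smul,
    mul_neg, mul_one, Curved.exp]

theorem isTwistedAntipode :
    IsTwistedAntipode counit antipode Curved.gen (Curved.exp (1 / 2)) (Curved.exp (-1 / 2)) where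
  counit_gen := counit_gen
  counit_pos := counit_exp _
  counit_neg := counit_exp _
  one := by rw [antipode_apply, map_one]
  antimul a b := by rw [antipode_apply, map_mul, mul_comm]; rfl
  H := antipode_gen _
  E := by rw [antipode_gen, mul_right_comm, pos_mul_neg, one_mul]
  F := by rw [antipode_gen, mul_right_comm, pos_mul_neg, one_mul]
  pos := by rw [antipode_exp]; norm_num
  neg := by rw [antipode_exp]; norm_num

/-- The involution `†` of `ℂ[(SU₂*)_r]`. -/
def dag : Curved →ₛₗ[conj₁] Curved :=
  { PowerSeries.map Flat.dagHom with
    map_smul' := fun c a => by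
      change PowerSeries.map Flat.dagHom (c • a) = conj₁ c • PowerSeries.map Flat.dagHom a
      rw [Algebra.smul_def, Algebra.smul_def, map_mul, algebraMap_eq, algebraMap_eq]
      congr 1
      ext i : 1
      simp only [PowerSeries.coeff_map]
      rw [Algebra.algebraMap_eq_smul_one, Flat.dagHom_smul, map_one,
        ← Algebra.algebraMap_eq_smul_one] }

theorem dag_apply (a : Curved) : dag a = PowerSeries.map Flat.dagHom a := rfl

theorem dag_gen (g : Gen) : dag (Curved.gen g) = Curved.gen g.dag := by
  rw [dag_apply, Curved.gen, PowerSeries.map_C, Flat.dagHom_X, Curved.gen]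

theorem dag_exp (t : ℂ) : dag (Curved.exp t) = Curved.exp (starRingEnd ℂ t) := by
  rw [dag_apply, Curved.exp, Curved.exp]
  ext k : 1
  rw [PowerSeries.coeff_map, coeff_expS, coeff_expS, Flat.dagHom_smul, map_pow, Flat.dagHom_X,
    map_div₀, map_pow, map_natCast]
  rfl

/-- The extension of a derivation to power series. -/
def seriesDeriv (d : Derivation ℂ Flat Flat) : Derivation Cr Curved Curved :=
  Derivation.mk'
    { toFun := fun f => PowerSeries.mk fun k => d (PowerSeries.coeff k f)
      map_add' := fun f g => by ext k : 1; simp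
      map_smul' := fun c f => by
        ext k : 1
        simp only [PowerSeries.coeff_mk, RingHom.id_apply]
        rw [coeff_smul_powerSeries, coeff_smul_powerSeries]
        simp only [map_sum, PowerSeries.coeff_mk, Derivation.map_smul] }
    (fun f g => by
      ext k : 1
      simp only [LinearMap.coe_mk, AddHom.coe_mk, PowerSeries.coeff_mk, smul_eq_mul, map_add,
        PowerSeries.coeff_mul, map_sum, Derivation.leibniz, Finset.sum_add_distrib]
      congr 1
      rw [← Finset.Nat.sum_antidiagonal_swap]
      rfl)

theorem coeff_seriesDeriv (d : Derivation ℂ Flat Flat) (f : Curved) (k : ℕ) :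
    PowerSeries.coeff k (seriesDeriv d f) = d (PowerSeries.coeff k f) :=
  PowerSeries.coeff_mk k fun k => d (PowerSeries.coeff k f)

theorem seriesDeriv_C (d : Derivation ℂ Flat Flat) (a : Flat) :
    seriesDeriv d (PowerSeries.C a) = PowerSeries.C (d a) := by
  ext k : 1
  rw [coeff_seriesDeriv, PowerSeries.coeff_C, PowerSeries.coeff_C]
  split <;> simp

/-- The bracket `{·,·}_r`. -/
def bracket : Curved →ₗ[Cr] Curved →ₗ[Cr] Curved :=
  derivBracket (seriesDeriv (MvPolynomial.pderiv .H)) (seriesDeriv (MvPolynomial.pderiv .E))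
    (seriesDeriv (MvPolynomial.pderiv .F)) (Curved.gen .E) (Curved.gen .F)
    (sinhDiv (MvPolynomial.X .H))

theorem seriesDeriv_comm (i j : Gen) (a : Curved) :
    seriesDeriv (MvPolynomial.pderiv i) (seriesDeriv (MvPolynomial.pderiv j) a) =
    seriesDeriv (MvPolynomial.pderiv j) (seriesDeriv (MvPolynomial.pderiv i) a) := by
  ext k : 1
  simp only [coeff_seriesDeriv, Flat.pderiv_comm i j]

theorem seriesDeriv_gen_self (i : Gen) :
    seriesDeriv (MvPolynomial.pderiv i) (Curved.gen i) = 1 := by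
  rw [Curved.gen, seriesDeriv_C, MvPolynomial.pderiv_X_self, map_one]

theorem seriesDeriv_gen_of_ne {i j : Gen} (h : j ≠ i) :
    seriesDeriv (MvPolynomial.pderiv i) (Curved.gen j) = 0 := by
  rw [Curved.gen, seriesDeriv_C, MvPolynomial.pderiv_X_of_ne h, map_zero]

theorem seriesDeriv_sinhDiv {i : Gen} (h : Gen.H ≠ i) :
    seriesDeriv (MvPolynomial.pderiv i) (sinhDiv (MvPolynomial.X Gen.H)) = 0 := by
  ext k : 1
  rw [coeff_seriesDeriv, coeff_sinhDiv, Derivation.map_smul, Derivation.leibniz_pow,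
    MvPolynomial.pderiv_X_of_ne h, smul_zero, smul_zero, smul_zero, map_zero]

theorem isPoissonBracket : IsPoissonBracket bracket :=
  isPoissonBracket_derivBracket (seriesDeriv_comm _ _) (seriesDeriv_comm _ _)
    (seriesDeriv_comm _ _) (seriesDeriv_gen_of_ne (by simp)) (seriesDeriv_gen_self _)
    (seriesDeriv_gen_of_ne (by simp)) (seriesDeriv_gen_of_ne (by simp))
    (seriesDeriv_gen_of_ne (by simp)) (seriesDeriv_gen_self _)
    (seriesDeriv_sinhDiv (by simp)) (seriesDeriv_sinhDiv (by simp))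

theorem bracket_HE : bracket (Curved.gen .H) (Curved.gen .E) = 2 * Curved.gen .E := by
  simp [bracket, derivBracket_apply, seriesDeriv_gen_self, seriesDeriv_gen_of_ne]

theorem bracket_HF : bracket (Curved.gen .H) (Curved.gen .F) = -2 * Curved.gen .F := by
  simp [bracket, derivBracket_apply, seriesDeriv_gen_self, seriesDeriv_gen_of_ne]

theorem bracket_EF :
    bracket (Curved.gen .E) (Curved.gen .F) = sinhDiv (MvPolynomial.X Gen.H) := by
  simp [bracket, derivBracket_apply, seriesDeriv_gen_self, seriesDeriv_gen_of_ne]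

theorem two_X_mul (a : Curved) : 2 * PowerSeries.X * a = (2 * PowerSeries.X : Cr) • a := by
  rw [Algebra.smul_def, algebraMap_eq, map_mul, PowerSeries.map_X, map_ofNat]

/-- The off-diagonal entry is 2rF; the factor 2r is a scalar and moves through the tensor sign,
leaving the twisted primitive formula for F. -/
theorem comul_lower (i j : Fin 2) : comul (Curved.lower i j) =
    ∑ k, ctmul Cr (Curved.lower i k) (Curved.lower k j) := by
  fin_cases i <;> fin_cases j <;>
    simp [Curved.lower, Fin.sum_univ_two, zero_ctmul, ctmul_zero, two_X_mul, smul_ctmul, ctmul_smul,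
      isTwistedCoproduct.F, comul_exp]

theorem comul_upper (i j : Fin 2) : comul (Curved.upper i j) =
    ∑ k, ctmul Cr (Curved.upper i k) (Curved.upper k j) := by
  fin_cases i <;> fin_cases j <;>
    simp [Curved.upper, Fin.sum_univ_two, zero_ctmul, ctmul_zero, two_X_mul, smul_ctmul, ctmul_smul,
      isTwistedCoproduct.E, comul_exp, add_comm]

end Curved

/-! ### Coefficientwise additive maps of power series -/

section CoeffMap

variable {V W : Type*} [Ring V] [Ring W]

/-- The additive map of power series that acts on each coefficient. -/
def coeffMap (g : V →+ W) : V⟦X⟧ →+ W⟦X⟧ where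
  toFun f := PowerSeries.mk fun k => g (PowerSeries.coeff k f)
  map_zero' := by ext k; simp
  map_add' f f' := by ext k; simp

theorem coeff_coeffMap (g : V →+ W) (f : V⟦X⟧) (k : ℕ) :
    PowerSeries.coeff k (coeffMap g f) = g (PowerSeries.coeff k f) :=
  PowerSeries.coeff_mk k fun k => g (PowerSeries.coeff k f)

theorem constantCoeff_coeffMap (g : V →+ W) (f : V⟦X⟧) :
    PowerSeries.constantCoeff (coeffMap g f) = g (PowerSeries.constantCoeff f) := by
  simpa using coeff_coeffMap g f 0

theorem coeffMap_C (g : V →+ W) (v : V) :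
    coeffMap g (PowerSeries.C v) = PowerSeries.C (g v) := by
  ext k
  rw [coeff_coeffMap, PowerSeries.coeff_C, PowerSeries.coeff_C]
  split <;> simp

/-- Iterating this once gives linearity over double power series. -/
theorem coeffMap_map_mul {k : Type*} [Ring k] {g : V →+ W} {α : k →+* V} {β : k →+* W}
    (h : ∀ c v, g (α c * v) = β c * g v) (c : k⟦X⟧) (f : V⟦X⟧) :
    coeffMap g (PowerSeries.map α c * f) = PowerSeries.map β c * coeffMap g f := by
  ext i
  simp only [coeff_coeffMap, PowerSeries.coeff_mul, map_sum, PowerSeries.coeff_map, h]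

theorem coeffMap_bijective {g : V →+ W} (hg : Function.Bijective g) :
    Function.Bijective (coeffMap g) := by
  refine ⟨fun f f' h => ?_, fun f => ?_⟩
  · ext i
    apply hg.1
    rw [← coeff_coeffMap, h, coeff_coeffMap]
  · choose u hu using hg.2
    refine ⟨PowerSeries.mk fun i => u (PowerSeries.coeff i f), ?_⟩
    ext i
    rw [coeff_coeffMap, PowerSeries.coeff_mk, hu]

end CoeffMap

/-! ### Ordered monomials -/

section Ordered

theorem monomial_gen (e : Gen →₀ ℕ) (c : ℂ) : (MvPolynomial.monomial e c : Flat) =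
    MvPolynomial.C c * (MvPolynomial.X .F ^ e .F * MvPolynomial.X .E ^ e .E *
      MvPolynomial.X .H ^ e .H) := by
  classical
  have he : e = Finsupp.single .F (e .F) + Finsupp.single .E (e .E) + Finsupp.single .H (e .H) := by
    ext g
    cases g <;> simp
  simp only [MvPolynomial.X_pow_eq_monomial, MvPolynomial.monomial_mul, MvPolynomial.C_apply,
    mul_one, zero_add]
  rw [← he]

/-- The linear map sending a monomial to the ordered product of powers of `F`, `E` and `H`. -/
def ordered {A : Type*} [Ring A] [Algebra ℂ A] (x : Gen → A) : Flat →ₗ[ℂ] A :=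
  (MvPolynomial.basisMonomials Gen ℂ).constr ℂ fun e => x .F ^ e .F * x .E ^ e .E * x .H ^ e .H

theorem constr_monomial {A : Type*} [AddCommGroup A] [Module ℂ A] (u : (Gen →₀ ℕ) → A)
    (e : Gen →₀ ℕ) (c : ℂ) : (MvPolynomial.basisMonomials Gen ℂ).constr ℂ u
      (MvPolynomial.monomial e c) = c • u e := by
  have h : (MvPolynomial.monomial e c : Flat) = c • MvPolynomial.basisMonomials Gen ℂ e := by
    simp [MvPolynomial.smul_monomial]
  rw [h, map_smul, Module.Basis.constr_basis]

theorem ordered_monomial {A : Type*} [Ring A] [Algebra ℂ A] (x : Gen → A) (e : Gen →₀ ℕ) (c : ℂ) :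
    ordered x (MvPolynomial.monomial e c) = c • (x .F ^ e .F * x .E ^ e .E * x .H ^ e .H) :=
  constr_monomial _ e c

/-- In a commutative target the chosen order of F, E, H no longer matters, so the ordered product
becomes ordinary evaluation. -/
theorem map_ordered_eq_polyHom {A B : Type*} [Ring A] [Algebra ℂ A] [Ring B]
    (hB : ∀ a b : B, a * b = b * a) (T : A →+* B) (x : Gen → A) (p : Flat) :
    T (ordered x p) = polyHom hB (T.comp (algebraMap ℂ A)) (fun g => T (x g)) p := by
  induction p using MvPolynomial.induction_on' with
  | monomial e c =>
    rw [ordered_monomial, monomial_gen, Algebra.smul_def]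
    simp only [map_mul, map_pow, polyHom_C, polyHom_X, RingHom.comp_apply]
  | add p q hp hq => rw [map_add, map_add, map_add, hp, hq]

/-- The part of a polynomial of degree `a` in `F` and `c` in `E`, as a polynomial in `H`. -/
def weightPart (a c : ℕ) : Flat →ₗ[ℂ] Polynomial ℂ :=
  (MvPolynomial.basisMonomials Gen ℂ).constr ℂ fun e =>
    if e .F = a ∧ e .E = c then Polynomial.X ^ e .H else 0

theorem coeff_weightPart (e : Gen →₀ ℕ) (p : Flat) :
    (weightPart (e .F) (e .E) p).coeff (e .H) = p.coeff e := by
  classical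
  induction p using MvPolynomial.induction_on' with
  | monomial d c =>
    rw [weightPart, constr_monomial, MvPolynomial.coeff_monomial]
    by_cases h : d = e
    · subst h; simp
    · rw [if_neg h]
      split
      · next h' =>
        rw [Polynomial.coeff_smul, Polynomial.coeff_X_pow, if_neg, smul_zero]
        intro hH
        exact h (Finsupp.ext fun g => by cases g; exacts [hH.symm, h'.2, h'.1])
      · simp
  | add p q hp hq => rw [map_add, Polynomial.coeff_add, MvPolynomial.coeff_add, hp, hq]

/-- A complex polynomial in H that vanishes at every l is zero, and the polynomials of fixed degrees
in F and E contain all coefficients of p. -/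
theorem eq_zero_of_eval_weightPart {p : Flat}
    (h : ∀ a c l, (weightPart a c p).eval l = 0) : p = 0 := by
  ext e
  have : weightPart (e .F) (e .E) p = 0 := Polynomial.funext fun l => by
    rw [h, Polynomial.eval_zero]
  rw [← coeff_weightPart, this]
  simp

end Ordered

/-! ### Verma-type representations -/

namespace Verma

variable {R K : Type*} [CommRing R] [AddCommGroup K] [Module R K] (z l : R) (s : R → R)

/-- The weight of the basis vector with index `(a, c)`. -/
def weight (a c : ℕ) : R := l + 2 * z * ((c : R) - a)

/-- The structure constants of the action of `E`. -/
def str (a c : ℕ) : R := ∑ j ∈ Finset.range a, s (weight z l j c)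

variable (K) in
/-- The diagonal operator with given eigenvalues. -/
def diag (d : ℕ → ℕ → R) : Module.End R (ℕ → ℕ → K) where
  toFun f a c := d a c • f a c
  map_add' f g := by ext a c; simp
  map_smul' t f := by ext a c; simp [smul_comm t]

variable (R K) in
/-- The operator `F`. -/
def opF : Module.End R (ℕ → ℕ → K) where
  toFun f a c := match a with
    | 0 => 0
    | a + 1 => f a c
  map_add' f g := by ext a c; cases a <;> simp
  map_smul' t f := by ext a c; cases a <;> simp

variable (R K) in
/-- Multiplication by `E` on the left of a power of `E`. -/
def shift : Module.End R (ℕ → ℕ → K) where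
  toFun f a c := match c with
    | 0 => 0
    | c + 1 => f a c
  map_add' f g := by ext a c; cases c <;> simp
  map_smul' t f := by ext a c; cases c <;> simp

variable (K) in
/-- The operator `E`. -/
def opE : Module.End R (ℕ → ℕ → K) where
  toFun f a c := shift R K f a c + (z * str z l s (a + 1) c) • f (a + 1) c
  map_add' f g := by ext a c; simp; abel
  map_smul' t f := by ext a c; simp [smul_comm t]

variable (K) in
/-- The generators as operators. -/
def op : Gen → Module.End R (ℕ → ℕ → K)
  | .H => diag K (weight z l)
  | .E => opE K z l s
  | .F => opF R K

theorem diag_apply (d : ℕ → ℕ → R) (f : ℕ → ℕ → K) (a c : ℕ) :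
    diag K d f a c = d a c • f a c := rfl

theorem diag_pow_apply (d : ℕ → ℕ → R) (k : ℕ) (f : ℕ → ℕ → K) (a c : ℕ) :
    (diag K d ^ k) f a c = d a c ^ k • f a c := by
  induction k generalizing f with
  | zero => simp
  | succ k ih => rw [pow_succ, Module.End.mul_apply, ih, diag_apply, smul_smul, ← pow_succ]

/-- Both terms of E raise the weight by 2z: one increases c by one, the other decreases a by one. -/
theorem rel_HE : op K z l s .H * op K z l s .E - op K z l s .E * op K z l s .H =
    (2 * z) • op K z l s .E := by
  ext f a c
  simp only [op, LinearMap.sub_apply, Module.End.mul_apply, LinearMap.smul_apply, Pi.sub_apply,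
    Pi.smul_apply, diag_apply]
  cases c with
  | zero =>
    change weight z l a 0 • (0 + (z * str z l s (a + 1) 0) • f (a + 1) 0) -
      (0 + (z * str z l s (a + 1) 0) • (weight z l (a + 1) 0 • f (a + 1) 0)) =
      (2 * z) • (0 + (z * str z l s (a + 1) 0) • f (a + 1) 0)
    simp only [zero_add, smul_smul, ← sub_smul]
    congr 1
    simp only [weight]
    push_cast
    ring
  | succ c =>
    change weight z l a (c + 1) • (f a c + (z * str z l s (a + 1) (c + 1)) • f (a + 1) (c + 1)) -
      (weight z l a c • f a c +
        (z * str z l s (a + 1) (c + 1)) • (weight z l (a + 1) (c + 1) • f (a + 1) (c + 1))) =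
      (2 * z) • (f a c + (z * str z l s (a + 1) (c + 1)) • f (a + 1) (c + 1))
    simp only [smul_add, smul_smul]
    rw [add_sub_add_comm, ← sub_smul, ← sub_smul]
    congr 2 <;> simp only [weight] <;> push_cast <;> ring

theorem rel_HF : op K z l s .H * op K z l s .F - op K z l s .F * op K z l s .H =
    -((2 * z) • op K z l s .F) := by
  ext f a c
  simp only [op, LinearMap.sub_apply, Module.End.mul_apply, LinearMap.smul_apply, Pi.sub_apply,
    Pi.smul_apply, diag_apply, LinearMap.neg_apply, Pi.neg_apply]
  cases a with
  | zero =>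
    change weight z l 0 c • (0 : K) - 0 = -((2 * z) • (0 : K))
    simp
  | succ a =>
    change weight z l (a + 1) c • f a c - weight z l a c • f a c = -((2 * z) • f a c)
    rw [← sub_smul, ← neg_smul]
    congr 1
    simp only [weight]
    push_cast
    ring

/-- Reading f(a, c) as the coefficient of F^a E^c v, the structure constants come from [E, F^a] = Σ
F^{a−1−j}[E, F]F^j, and consecutive partial sums differ by s at one weight. The function s is
arbitrary, so the same modules serve both quantum algebras. -/
theorem rel_EF : op K z l s .E * op K z l s .F - op K z l s .F * op K z l s .E =
    z • diag K (fun a c => s (weight z l a c)) := by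
  ext f a c
  simp only [op, LinearMap.sub_apply, Module.End.mul_apply, LinearMap.smul_apply, Pi.sub_apply,
    Pi.smul_apply, diag_apply]
  have hs : ∀ a, str z l s (a + 1) c = str z l s a c + s (weight z l a c) := fun a =>
    Finset.sum_range_succ _ _
  cases a with
  | zero =>
    have h0 : str z l s 0 c = 0 := rfl
    cases c with
    | zero =>
      change 0 + (z * str z l s 1 0) • f 0 0 - 0 = _
      rw [hs, h0, zero_add, zero_add, sub_zero, mul_smul]
    | succ c =>
      change 0 + (z * str z l s 1 (c + 1)) • f 0 (c + 1) - 0 = _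
      rw [hs, h0, zero_add, zero_add, sub_zero, mul_smul]
  | succ a =>
    cases c with
    | zero =>
      change 0 + (z * str z l s (a + 1 + 1) 0) • f (a + 1) 0 -
        (0 + (z * str z l s (a + 1) 0) • f (a + 1) 0) = _
      rw [hs (a + 1), zero_add, zero_add, ← sub_smul, smul_smul]
      congr 1
      ring
    | succ c =>
      change f a c + (z * str z l s (a + 1 + 1) (c + 1)) • f (a + 1) (c + 1) -
        (f a c + (z * str z l s (a + 1) (c + 1)) • f (a + 1) (c + 1)) = _
      rw [hs (a + 1), add_sub_add_left_eq_sub, ← sub_smul, smul_smul]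
      congr 1
      ring

/-- The vector supported at a single index. -/
def vec (a c : ℕ) (v : K) : ℕ → ℕ → K := fun a' c' => if a' = a ∧ c' = c then v else 0

theorem opF_vec (a c : ℕ) (v : K) : op K z l s .F (vec a c v) = vec (a + 1) c v := by
  ext a' c'
  cases a' with
  | zero => exact (if_neg (by omega)).symm
  | succ a' => simp [op, opF, vec]

/-- On the row a = 0 there is no F for E to be commuted past, so the correction term is absent. -/
theorem opE_vec (c : ℕ) (v : K) : op K z l s .E (vec 0 c v) = vec 0 (c + 1) v := by
  ext a' c'
  cases c' with
  | zero => simp [op, opE, shift, vec]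
  | succ c' => simp [op, opE, shift, vec]

theorem opH_vec (v : K) : op K z l s .H (vec 0 0 v) = vec 0 0 (l • v) := by
  ext a' c'
  simp only [op, diag_apply, vec]
  split
  · next h => rw [h.1, h.2]; simp [weight]
  · simp

/-- The ordering F, E, H is adapted to the module: H acts first and by the scalar l, then E moves
freely along the row a = 0, then F raises a. No correction term ever appears. -/
theorem word_vec (a c b : ℕ) (v : K) :
    (op K z l s .F ^ a * op K z l s .E ^ c * op K z l s .H ^ b) (vec 0 0 v) =
      vec a c (l ^ b • v) := by
  have hH : ∀ (b : ℕ) (v : K), (op K z l s .H ^ b) (vec 0 0 v) = vec 0 0 (l ^ b • v) := fun b => by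
    induction b with
    | zero => simp
    | succ b ih => intro v; rw [pow_succ, Module.End.mul_apply, opH_vec, ih, smul_smul, ← pow_succ]
  have hE : ∀ (c : ℕ) (v : K), (op K z l s .E ^ c) (vec 0 0 v) = vec 0 c v := fun c => by
    induction c with
    | zero => simp
    | succ c ih => intro v; rw [pow_succ', Module.End.mul_apply, ih, opE_vec]
  have hF : ∀ (a : ℕ) (v : K), (op K z l s .F ^ a) (vec 0 c v) = vec a c v := fun a => by
    induction a with
    | zero => simp
    | succ a ih => intro v; rw [pow_succ', Module.End.mul_apply, ih, opF_vec]
  rw [Module.End.mul_apply, Module.End.mul_apply, hH, hE, hF]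

theorem tsinh_diag [Algebra ℂ R] (r : R) (n : ℕ) (d : ℕ → ℕ → R) :
    tsinh r n (diag K d) = diag K fun a c => tsinh r n (d a c) := by
  ext f a c
  simp only [tsinh, LinearMap.sum_apply, Finset.sum_apply, LinearMap.smul_apply, Pi.smul_apply,
    diag_pow_apply, diag_apply, Finset.sum_smul, smul_assoc]

theorem killedBy [IsLocalRing R] {n : ℕ} (hK : KilledBy R K n) :
    KilledBy R (Module.End R (ℕ → ℕ → K)) n := fun c hc f => by
  ext g a b
  exact hK c hc _

variable {z l s}

/-- The matrix coefficients of an ordered polynomial in the operators. -/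
theorem ordered_vec {A : Type*} [Ring A] [Algebra ℂ A] [Algebra ℂ R] {l : ℂ} {x : Gen → A}
    (T : A →+* Module.End R (ℕ → ℕ → K))
    (hT : ∀ c, T (algebraMap ℂ A c) =
      algebraMap R (Module.End R (ℕ → ℕ → K)) (algebraMap ℂ R c))
    (hx : ∀ g, T (x g) = op K z (algebraMap ℂ R l) s g) (p : Flat) (a c : ℕ) (v : K) :
    T (ordered x p) (vec 0 0 v) a c = algebraMap ℂ R ((weightPart a c p).eval l) • v := by
  induction p using MvPolynomial.induction_on' with
  | monomial e t =>
    rw [ordered_monomial, Algebra.smul_def, map_mul, hT, map_mul, map_mul, map_pow, map_pow,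
      map_pow, hx, hx, hx, Module.End.mul_apply, word_vec, Module.algebraMap_end_apply, weightPart,
      constr_monomial, Polynomial.eval_smul]
    change algebraMap ℂ R t • vec (e .F) (e .E) (algebraMap ℂ R l ^ e .H • v) a c = _
    rw [vec]
    by_cases h : a = e .F ∧ c = e .E
    · rw [if_pos h, if_pos ⟨h.1.symm, h.2.symm⟩]
      simp [smul_smul]
    · rw [if_neg h, if_neg (fun h' => h ⟨h'.1.symm, h'.2.symm⟩)]
      simp
  | add p q hp hq =>
    rw [map_add, map_add, LinearMap.add_apply, map_add, Polynomial.eval_add, map_add, add_smul,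
      ← hp, ← hq]
    rfl

end Verma

/-! ### Density arguments -/

section Density

theorem isAdicComplete_of_linearEquiv {R M N : Type*} [CommRing R] [AddCommGroup M]
    [Module R M] [AddCommGroup N] [Module R N] (e : M ≃ₗ[R] N) (I : Ideal R) [IsAdicComplete I M] :
    IsAdicComplete I N := by
  have hmem : ∀ (n : ℕ) (y : M), e y ∈ (I ^ n • ⊤ : Submodule R N) ↔
      y ∈ (I ^ n • ⊤ : Submodule R M) := fun n y => by
    have : (I ^ n • ⊤ : Submodule R N) = (I ^ n • ⊤ : Submodule R M).map e.toLinearMap := by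
      rw [Submodule.map_smul'', Submodule.map_top, LinearEquiv.range]
    rw [this]
    exact ⟨fun ⟨y', hy', h⟩ => e.injective h ▸ hy', fun h => ⟨y, h, rfl⟩⟩
  have hmem' : ∀ (n : ℕ) (y : N), y ∈ (I ^ n • ⊤ : Submodule R N) ↔
      e.symm y ∈ (I ^ n • ⊤ : Submodule R M) := fun n y => by
    rw [← hmem, e.apply_symm_apply]
  refine { haus' := fun x hx => ?_, prec' := fun f hf => ?_ }
  · have : e.symm x = 0 := IsHausdorff.haus (I := I) inferInstance _ fun n => by
      rw [SModEq.zero, ← hmem', ← SModEq.zero]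
      exact hx n
    simpa using this
  · obtain ⟨L, hL⟩ := IsPrecomplete.prec (I := I) (M := M) inferInstance
      (f := fun n => e.symm (f n)) fun {m n} hmn => by
        rw [SModEq.sub_mem, ← map_sub, ← hmem', ← SModEq.sub_mem]
        exact hf hmn
    refine ⟨e L, fun n => ?_⟩
    rw [SModEq.sub_mem, hmem', map_sub, e.symm_apply_apply, ← SModEq.sub_mem]
    exact hL n

variable {R M N : Type*} [CommRing R] [IsLocalRing R] [AddCommGroup M] [Module R M]
  [AddCommGroup N] [Module R N]

/-- If S represents every class modulo 𝔪M, then f − g sends M into 𝔪N, hence by iteration into 𝔪ⁿN =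
0. No topology on M is used. -/
theorem KilledBy.linearMap_ext {n : ℕ} (hN : KilledBy R N n) {S : Set M}
    (hS : ∀ m, ∃ t ∈ S, m - t ∈ (IsLocalRing.maximalIdeal R • ⊤ : Submodule R M))
    {f g : M →ₗ[R] N} (hfg : ∀ t ∈ S, f t = g t) : f = g := by
  have key : ∀ k m, (f - g) m ∈ (IsLocalRing.maximalIdeal R ^ k • ⊤ : Submodule R N) := fun k => by
    induction k with
    | zero => intro m; simp
    | succ k ih =>
      intro m
      obtain ⟨t, ht, hm⟩ := hS m
      have h0 : (f - g) t = 0 := by rw [LinearMap.sub_apply, hfg t ht, sub_self]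
      rw [← sub_zero ((f - g) m), ← h0, ← map_sub]
      refine Submodule.smul_induction_on (p := fun m => (f - g) m ∈ _) hm (fun r hr y _ => ?_)
        (fun y y' hy hy' => ?_)
      · rw [map_smul, pow_succ', mul_smul]
        exact Submodule.smul_mem_smul hr (ih y)
      · rw [map_add]
        exact add_mem hy hy'
  ext m
  rw [← sub_eq_zero, ← LinearMap.sub_apply]
  refine Submodule.smul_induction_on (p := fun y => y = 0) (key n m) (fun r hr y _ => hN r hr y)
    (fun y z hy hz => ?_)
  rw [hy, hz, add_zero]

/-- What commutes with all generators commutes with everything they generate. Used first for a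
generator, then for an arbitrary element. -/
theorem TopGen.trunc_mul_comm {A : Type*} [Ring A] [Algebra R A] {x : Gen → A} (hx : TopGen R x)
    {n : ℕ} (h : ∀ i j, Trunc.mk R A n (x i) * Trunc.mk R A n (x j) =
      Trunc.mk R A n (x j) * Trunc.mk R A n (x i)) (a b : Trunc R A n) : a * b = b * a := by
  obtain ⟨a, rfl⟩ := Trunc.mk_surjective n a
  obtain ⟨b, rfl⟩ := Trunc.mk_surjective n b
  have key : ∀ y : Trunc R A n, (∀ j, y * Trunc.mk R A n (x j) = Trunc.mk R A n (x j) * y) →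
      ∀ b, y * Trunc.mk R A n b = Trunc.mk R A n b * y := fun y hy b => by
    induction b using hx.induction n with
    | add a b ha hb => rw [map_add, mul_add, add_mul, ha, hb]
    | mul a b ha hb => rw [map_mul, ← mul_assoc, ha, mul_assoc, hb, mul_assoc]
    | alg c => rw [AlgHom.commutes]; exact (Algebra.commutes c y).symm
    | gen g => exact hy g
    | ideal a ha => rw [Trunc.mk_eq_zero.2 ha, mul_zero, zero_mul]
  exact key _ (fun j => (key _ (fun i => h j i) a).symm) b

end Density

/-! ### Poincaré–Birkhoff–Witt bases -/

theorem killedBy_quotient {R : Type*} [CommRing R] [IsLocalRing R] (n : ℕ) :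
    KilledBy R (R ⧸ IsLocalRing.maximalIdeal R ^ n) n := fun c hc b => by
  obtain ⟨b, rfl⟩ := Ideal.Quotient.mk_surjective b
  exact Ideal.Quotient.eq_zero_iff_mem.2 (Ideal.mul_mem_right _ _ hc)

/-- The additive functional picking the coefficient of `F^a E^c` and evaluating it at `H = l`. -/
def weightEval (a c : ℕ) (l : ℂ) : Flat →+ ℂ :=
  ((Polynomial.evalRingHom l : Polynomial ℂ →+* ℂ) : Polynomial ℂ →+ ℂ).comp
    (weightPart a c).toAddMonoidHom

theorem weightEval_apply (a c : ℕ) (l : ℂ) (p : Flat) :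
    weightEval a c l p = (weightPart a c p).eval l := rfl

theorem weightEval_mul (a c : ℕ) (l t : ℂ) (p : Flat) :
    weightEval a c l (algebraMap ℂ Flat t * p) = RingHom.id ℂ t * weightEval a c l p := by
  rw [weightEval_apply, ← Algebra.smul_def, map_smul, Polynomial.eval_smul]
  rfl

theorem map_ringHom_id {k : Type*} [CommRing k] :
    PowerSeries.map (RingHom.id k) = RingHom.id k⟦X⟧ := by
  ext f i
  simp

theorem ordered_mul {A : Type*} [Ring A] [Algebra ℂ A] (x : Gen → A) (t : ℂ) (p : Flat) :
    (ordered x).toAddMonoidHom (algebraMap ℂ Flat t * p) =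
      algebraMap ℂ A t * (ordered x).toAddMonoidHom p := by
  rw [← Algebra.smul_def, ← Algebra.smul_def]
  exact map_smul (ordered x) t p

theorem Curved.exists_sub_mem (m : Curved) : ∃ t ∈ Set.range (PowerSeries.C : Flat → Curved),
    m - t ∈ (IsLocalRing.maximalIdeal Cr • ⊤ : Submodule Cr Curved) := by
  obtain ⟨g, hg⟩ := Curved.exists_eq_constant_add m
  refine ⟨_, ⟨PowerSeries.constantCoeff m, rfl⟩, ?_⟩
  rw [sub_eq_iff_eq_add'.2 hg]
  exact Submodule.smul_mem_smul X_mem_maximalIdeal Submodule.mem_top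

namespace Curved

theorem algebraMap_series (c : Crh) : algebraMap Crh Curved⟦X⟧ c =
    PowerSeries.map (PowerSeries.map (algebraMap ℂ Flat)) c := rfl

theorem exists_sub_mem_series (m : Curved⟦X⟧) :
    ∃ t ∈ Set.range (fun p : Flat => (PowerSeries.C (PowerSeries.C p : Curved) : Curved⟦X⟧)),
      m - t ∈ (IsLocalRing.maximalIdeal Crh • ⊤ : Submodule Crh Curved⟦X⟧) := by
  obtain ⟨g, hg⟩ := Curved.exists_eq_constant_add (PowerSeries.constantCoeff m)
  generalize PowerSeries.constantCoeff (PowerSeries.constantCoeff m) = p at hg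
  refine ⟨_, ⟨p, rfl⟩, ?_⟩
  have h1 : m = PowerSeries.X * (PowerSeries.mk fun p => PowerSeries.coeff (p + 1) m) +
      PowerSeries.C (PowerSeries.constantCoeff m) := PowerSeries.eq_X_mul_shift_add_const m
  have h2 : m - PowerSeries.C (PowerSeries.C p) =
      hh • (PowerSeries.mk fun p => PowerSeries.coeff (p + 1) m) + rr • PowerSeries.C g := by
    rw [Algebra.smul_def, Algebra.smul_def, algebraMap_series, algebraMap_series, hh, rr,
      PowerSeries.map_X, PowerSeries.map_C, PowerSeries.map_X, ← map_mul]
    conv_lhs => rw [h1, hg]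
    rw [map_add, Algebra.smul_def, algebraMap_eq, PowerSeries.map_X, map_mul]
    abel
  rw [h2]
  exact add_mem (Submodule.smul_mem_smul hh_mem Submodule.mem_top)
    (Submodule.smul_mem_smul rr_mem Submodule.mem_top)

end Curved

/-! ### Poincaré–Birkhoff–Witt for the two-parameter quantum group. -/

namespace UQ

/-- The linear map from `ℂ[H, E, F]⟦r, ħ⟧` to `U_q^ħ(sl₂)` given by ordered monomials. -/
def ofPoly : Curved⟦X⟧ →ₗ[Crh] UQ :=
  mk.toLinearMap ∘ₗ
    { (FreeQ.toSeries.symm : (FreeAlgebra ℂ Gen)⟦X⟧⟦X⟧ →+ FreeQ).comp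
        (coeffMap (coeffMap (ordered (FreeAlgebra.ι ℂ)).toAddMonoidHom)) with
      map_smul' := fun c m => FreeQ.toSeries.injective (by
        refine Eq.trans ?_ (FreeQ.toSeries_smul c _).symm
        rw [Algebra.smul_def, Curved.algebraMap_series]
        exact coeffMap_map_mul (coeffMap_map_mul (ordered_mul (FreeAlgebra.ι ℂ))) c m) }

theorem ofPoly_apply (m : Curved⟦X⟧) : ofPoly m = mk (FreeQ.toSeries.symm
    (coeffMap (coeffMap (ordered (FreeAlgebra.ι ℂ)).toAddMonoidHom) m)) := rfl

theorem ofPoly_C (p : Flat) : ofPoly (PowerSeries.C (PowerSeries.C p)) =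
    mk (FreeQ.ofSeries (PowerSeries.C (ordered (FreeAlgebra.ι ℂ) p))) := by
  rw [ofPoly_apply, coeffMap_C, coeffMap_C]
  rfl

/-- The canonical map from the free algebra to `U_q^ħ(sl₂)` modulo `r` and `ħ`. -/
def residue : FreeAlgebra ℂ Gen →+* Trunc Crh UQ 1 :=
  ((Trunc.mk Crh UQ 1).comp mk : FreeQ →+* Trunc Crh UQ 1).comp
    (FreeQ.ofSeries.comp PowerSeries.C)

theorem residue_apply (f : FreeAlgebra ℂ Gen) :
    residue f = Trunc.mk Crh UQ 1 (mk (FreeQ.ofSeries (PowerSeries.C f))) := rfl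

/-- All commutators of generators are multiples of ħ, hence vanish modulo 𝔪. -/
theorem trunc_one_mul_comm (a b : Trunc Crh UQ 1) : a * b = b * a := by
  have hk : ∀ u : UQ, Trunc.mk Crh UQ 1 (hh • u) = 0 := fun u => Trunc.mk_eq_zero.2 (hh_smul_mem u)
  have hk2 : ∀ u : UQ, Trunc.mk Crh UQ 1 ((2 * hh) • u) = 0 := fun u => by
    rw [mul_comm, mul_smul, hk]
  have h1 : Trunc.mk Crh UQ 1 (gen .H * gen .E - gen .E * gen .H) = 0 := by rw [rel_HE, hk2]
  have h2 : Trunc.mk Crh UQ 1 (gen .H * gen .F - gen .F * gen .H) = 0 := by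
    rw [rel_HF, map_neg, hk2, neg_zero]
  have h3 : Trunc.mk Crh UQ 1 (gen .E * gen .F - gen .F * gen .E) = 0 := by rw [rel_EF, hk]
  rw [map_sub, map_mul, map_mul, sub_eq_zero] at h1 h2 h3
  refine topGen.trunc_mul_comm (fun i j => ?_) a b
  cases i <;> cases j
  exacts [rfl, h1, h2, h1.symm, rfl, h3, h2.symm, h3.symm, rfl]

/-- The source is complete and the target Hausdorff, so surjectivity modulo 𝔪 suffices. Modulo 𝔪 a
series is the class of its constant term, and as the quotient is commutative that noncommutative
polynomial may be reordered. -/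
theorem ofPoly_surjective : Function.Surjective ofPoly := by
  refine surjective_of_mkQ_comp_surjective (I := IsLocalRing.maximalIdeal Crh) fun y => ?_
  obtain ⟨y, rfl⟩ := Submodule.mkQ_surjective _ y
  obtain ⟨f, rfl⟩ := mk_surjective y
  obtain ⟨g₁, g₂, hf⟩ := FreeQ.exists_eq_constant_add f
  generalize PowerSeries.constantCoeff (PowerSeries.constantCoeff (FreeQ.toSeries f)) = a at hf
  let sym : FreeAlgebra ℂ Gen →ₐ[ℂ] Flat := FreeAlgebra.lift ℂ MvPolynomial.X
  refine ⟨PowerSeries.C (PowerSeries.C (sym a)), ?_⟩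
  rw [LinearMap.comp_apply, ← sub_eq_zero, ← map_sub, Submodule.mkQ_apply,
    Submodule.Quotient.mk_eq_zero, ofPoly_C]
  have key : Trunc.mk Crh UQ 1 (mk (FreeQ.ofSeries (PowerSeries.C
      (ordered (FreeAlgebra.ι ℂ) (sym a)))) - mk f) = 0 := by
    have h1 : Trunc.mk Crh UQ 1 (mk f) = residue a := by
      rw [hf, map_add, map_add, map_add, map_add, map_smul mk, map_smul mk,
        Trunc.mk_eq_zero.2 (hh_smul_mem _), Trunc.mk_eq_zero.2 (rr_smul_mem _), add_zero, add_zero,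
        residue_apply]
    rw [map_sub, h1, ← residue_apply, map_ordered_eq_polyHom trunc_one_mul_comm, sub_eq_zero]
    clear hf h1
    induction a using FreeAlgebra.induction with
    | grade0 c =>
      rw [AlgHom.commutes]
      exact polyHom_C _ _ _ _
    | grade1 g => rw [FreeAlgebra.lift_ι_apply]; exact polyHom_X _ _ _ _
    | mul a b ha hb => rw [map_mul, map_mul, map_mul, ha, hb]
    | add a b ha hb => rw [map_add, map_add, map_add, ha, hb]
  rw [Trunc.mk_eq_zero, mem_adicIdeal, pow_one] at key
  exact key

/-- With s the truncated hyperbolic quotient, the diagonal operator with entries s(weight) is the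
same quotient applied to the operator H. -/
theorem isUQRel_verma (n : ℕ) (l : ℂ) : IsUQRel n
    (Verma.op (Crh ⧸ IsLocalRing.maximalIdeal Crh ^ n) hh (algebraMap ℂ Crh l)
      fun t => tsinh rr n t) where
  HE := Verma.rel_HE _ _ _
  HF := Verma.rel_HF _ _ _
  EF := by rw [Verma.rel_EF, Verma.op, Verma.tsinh_diag]

/-- Acting on the generating vector of the Verma-type module over Crh/𝔪ⁿ and reading the coordinate
(a, c) recovers, modulo 𝔪ⁿ, the part of degree a in F and c in E evaluated at H = l. An element of
the kernel therefore has all these values in every 𝔪ⁿ, hence zero. -/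
theorem ofPoly_injective : Function.Injective ofPoly := by
  rw [← LinearMap.ker_eq_bot, LinearMap.ker_eq_bot']
  intro m hm
  have key : ∀ a c l, coeffMap (coeffMap (weightEval a c l)) m = (0 : Crh) := fun a c l => by
    refine IsHausdorff.haus (I := IsLocalRing.maximalIdeal Crh) inferInstance _ fun n => ?_
    rw [SModEq.zero, smul_eq_mul, Ideal.mul_top]
    let K := Crh ⧸ IsLocalRing.maximalIdeal Crh ^ n
    let ρ : UQ →ₐ[Crh] Module.End Crh (ℕ → ℕ → K) :=
      lift (Verma.killedBy (killedBy_quotient n)) _ (isUQRel_verma n l)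
    let coord : (ℕ → ℕ → K) →ₗ[Crh] K := LinearMap.proj c ∘ₗ LinearMap.proj a
    let f₁ : Curved⟦X⟧ →ₗ[Crh] K :=
      coord ∘ₗ LinearMap.applyₗ (Verma.vec 0 0 (1 : K)) ∘ₗ ρ.toLinearMap ∘ₗ ofPoly
    let f₂ : Curved⟦X⟧ →ₗ[Crh] K := (Submodule.mkQ (IsLocalRing.maximalIdeal Crh ^ n)) ∘ₗ
      { coeffMap (coeffMap (weightEval a c l)) with
        map_smul' := fun t m => by
          have := coeffMap_map_mul (coeffMap_map_mul (weightEval_mul a c l)) t m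
          rw [map_ringHom_id, map_ringHom_id, RingHom.id_apply] at this
          rw [Algebra.smul_def]
          exact this }
    -- Both functionals are linear into a module killed by 𝔪ⁿ, so they need only be compared on
    -- constant polynomials, where the matrix coefficient is known.
    have h12 : f₁ = f₂ := by
      refine (killedBy_quotient n).linearMap_ext Curved.exists_sub_mem_series ?_
      rintro _ ⟨p, rfl⟩
      have h1 : f₁ (PowerSeries.C (PowerSeries.C p)) =
          ρ (ofPoly (PowerSeries.C (PowerSeries.C p))) (Verma.vec 0 0 (1 : K)) a c := rfl
      have h2 : f₂ (PowerSeries.C (PowerSeries.C p)) = Ideal.Quotient.mk _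
          (coeffMap (coeffMap (weightEval a c l)) (PowerSeries.C (PowerSeries.C p))) := rfl
      rw [h1, h2, coeffMap_C, coeffMap_C, ofPoly_C, weightEval_apply, ← algebraMap_Crh]
      refine (Verma.ordered_vec (z := hh) (l := l) (s := fun t => tsinh rr n t) (((ρ : UQ →+* Module.End Crh (ℕ → ℕ → K)).comp
        (mk : FreeQ →+* UQ)).comp (FreeQ.ofSeries.comp PowerSeries.C)) (fun t => ?_) (fun g => ?_)
        p a c 1).trans ?_
      · have : FreeQ.ofSeries (PowerSeries.C (algebraMap ℂ (FreeAlgebra ℂ Gen) t)) =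
            algebraMap Crh FreeQ (algebraMap ℂ Crh t) := by
          rw [← FreeQ.toSeries.injective.eq_iff, FreeQ.toSeries_algebraMap, algebraMap_Crh,
            PowerSeries.map_C, PowerSeries.map_C]
          rfl
        simp only [RingHom.comp_apply, this]
        exact ((ρ.comp mk).commutes _)
      · exact lift_gen _ _ (isUQRel_verma n l) g
      · rw [← Algebra.algebraMap_eq_smul_one]; rfl
    have h0 : f₁ m = 0 := by
      change coord (ρ (ofPoly m) _) = 0
      rw [hm, map_zero, LinearMap.zero_apply, map_zero]
    rw [h12] at h0
    exact Ideal.Quotient.eq_zero_iff_mem.1 h0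
  -- Each coefficient of m in r and ħ is a polynomial whose weight parts vanish at every complex l.
  refine PowerSeries.ext fun i => PowerSeries.ext fun j => ?_
  refine eq_zero_of_eval_weightPart fun a c l => ?_
  rw [← weightEval_apply, ← coeff_coeffMap, ← coeff_coeffMap, key]
  simp

/-- The Poincaré–Birkhoff–Witt isomorphism. -/
def polyEquiv : Curved⟦X⟧ ≃ₗ[Crh] UQ :=
  LinearEquiv.ofBijective ofPoly ⟨ofPoly_injective, ofPoly_surjective⟩

/-- The quotient construction gave only the Hausdorff property; completeness is transported from
power series. -/
instance isAdicComplete : IsAdicComplete (IsLocalRing.maximalIdeal Crh) UQ :=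
  isAdicComplete_of_linearEquiv polyEquiv _

end UQ

/-! ### Poincaré–Birkhoff–Witt for the completed enveloping algebra. -/

namespace UH

/-- The linear map from `ℂ[H, E, F]⟦ħ⟧` to `U^ħ(sl₂)` given by ordered monomials. -/
def ofPoly : Curved →ₗ[Ch] UH :=
  mk.toLinearMap ∘ₗ
    { (TensorH.toSeries.symm : (TensorAlgebra ℂ sl2)⟦X⟧ →+ TensorH).comp
        (coeffMap (ordered fun g => TensorAlgebra.ι ℂ (sl2Gen g)).toAddMonoidHom) with
      map_smul' := fun c m => TensorH.toSeries.injective (by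
        refine Eq.trans ?_ (TensorH.toSeries_smul c _).symm
        rw [Algebra.smul_def, Curved.algebraMap_eq]
        exact coeffMap_map_mul (ordered_mul fun g => TensorAlgebra.ι ℂ (sl2Gen g)) c m) }

theorem ofPoly_apply (m : Curved) : ofPoly m = mk (TensorH.toSeries.symm
    (coeffMap (ordered fun g => TensorAlgebra.ι ℂ (sl2Gen g)).toAddMonoidHom m)) := rfl

theorem ofPoly_C (p : Flat) : ofPoly (PowerSeries.C p) =
    mk (TensorH.C (ordered (fun g => TensorAlgebra.ι ℂ (sl2Gen g)) p)) := by
  rw [ofPoly_apply, coeffMap_C]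
  rfl

/-- The canonical map from the tensor algebra to `U^ħ(sl₂)` modulo `ħ`. -/
def residue : TensorAlgebra ℂ sl2 →+* Trunc Ch UH 1 :=
  ((Trunc.mk Ch UH 1).comp mk : TensorH →+* Trunc Ch UH 1).comp TensorH.C

theorem residue_apply (f : TensorAlgebra ℂ sl2) :
    residue f = Trunc.mk Ch UH 1 (mk (TensorH.C f)) := rfl

theorem trunc_mk_X_smul (u : UH) : Trunc.mk Ch UH 1 ((PowerSeries.X : Ch) • u) = 0 :=
  Trunc.mk_eq_zero.2 (by
    rw [mem_adicIdeal, pow_one]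
    exact Submodule.smul_mem_smul X_mem_maximalIdeal Submodule.mem_top)

theorem trunc_one_mul_comm (a b : Trunc Ch UH 1) : a * b = b * a := by
  refine topGen.trunc_mul_comm (fun i j => ?_) a b
  rw [← sub_eq_zero, ← map_mul, ← map_mul, ← map_sub]
  exact (congrArg _ (rel _ _)).trans (trunc_mk_X_smul _)

/-- The symmetrization of tensors. -/
def toFlat : TensorAlgebra ℂ sl2 →ₐ[ℂ] Flat :=
  TensorAlgebra.lift ℂ (IsLinearMap.mk' Flat.linear
    ⟨fun x y => by simp [Flat.linear_eq, add_smul]; abel,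
      fun c x => by simp [Flat.linear_eq, smul_smul]⟩)

theorem toFlat_ι (x : sl2) : toFlat (TensorAlgebra.ι ℂ x) = Flat.linear x := by
  rw [toFlat, TensorAlgebra.lift_ι_apply, IsLinearMap.mk'_apply]

theorem residue_eq_polyHom (a : TensorAlgebra ℂ sl2) :
    polyHom trunc_one_mul_comm (residue.comp (algebraMap ℂ (TensorAlgebra ℂ sl2)))
      (fun g => residue (TensorAlgebra.ι ℂ (sl2Gen g))) (toFlat a) =
      residue a := by
  induction a using TensorAlgebra.induction with
  | algebraMap c =>
    rw [AlgHom.commutes]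
    exact polyHom_C _ _ _ _
  | ι x =>
    rw [toFlat_ι, Flat.linear]
    conv_rhs => rw [sl2_eq x]
    simp only [map_add, map_mul, polyHom_C, polyHom_X, RingHom.comp_apply, map_smul,
      Algebra.smul_def]
  | mul a b ha hb => rw [map_mul, map_mul, map_mul, ha, hb]
  | add a b ha hb => rw [map_add, map_add, map_add, ha, hb]

theorem ofPoly_surjective : Function.Surjective ofPoly := by
  refine surjective_of_mkQ_comp_surjective (I := IsLocalRing.maximalIdeal Ch) fun y => ?_
  obtain ⟨y, rfl⟩ := Submodule.mkQ_surjective _ y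
  obtain ⟨f, rfl⟩ := mk_surjective y
  obtain ⟨g, hf⟩ := TensorH.exists_eq_constant_add f
  generalize PowerSeries.constantCoeff (TensorH.toSeries f) = a at hf
  refine ⟨PowerSeries.C (toFlat a), ?_⟩
  rw [LinearMap.comp_apply, ← sub_eq_zero, ← map_sub, Submodule.mkQ_apply,
    Submodule.Quotient.mk_eq_zero, ofPoly_C, ← pow_one (IsLocalRing.maximalIdeal Ch),
    ← mem_adicIdeal, ← Trunc.mk_eq_zero, map_sub, hf, map_add, map_add, map_smul mk,
    trunc_mk_X_smul, add_zero, ← residue_apply, ← residue_apply,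
    map_ordered_eq_polyHom trunc_one_mul_comm, residue_eq_polyHom a, sub_self]

/-- Bilinearity reduces the bracket of arbitrary elements of the span to the three relations between
generators, so the Verma operators represent all of sl₂. -/
theorem bracket_of_rel {R B : Type*} [CommRing R] [Ring B] [Algebra R B] {z : R} {h e f : B}
    (he : h * e - e * h = (2 * z) • e) (hf : h * f - f * h = -((2 * z) • f))
    (ef : e * f - f * e = z • h) (x₀ x₁ x₂ y₀ y₁ y₂ : R) :
    (x₀ • h + x₁ • e + x₂ • f) * (y₀ • h + y₁ • e + y₂ • f) -
      (y₀ • h + y₁ • e + y₂ • f) * (x₀ • h + x₁ • e + x₂ • f) =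
    z • ((x₁ * y₂ - x₂ * y₁) • h + (2 * (x₀ * y₁ - x₁ * y₀)) • e +
      (2 * (x₂ * y₀ - x₀ * y₂)) • f) := by
  rw [sub_eq_iff_eq_add] at he hf ef
  simp only [add_mul, mul_add, smul_mul_smul_comm, he, hf, ef]
  module

/-- The representation of `sl₂` on a Verma module. -/
def vermaHom (K : Type*) [AddCommGroup K] [Module Ch K] (l : ℂ) :
    sl2 →+ Module.End Ch (ℕ → ℕ → K) where
  toFun x := algebraMap ℂ Ch (x.1 0 0) • Verma.op K PowerSeries.X (algebraMap ℂ Ch l) id .H +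
    algebraMap ℂ Ch (x.1 0 1) • Verma.op K PowerSeries.X (algebraMap ℂ Ch l) id .E +
    algebraMap ℂ Ch (x.1 1 0) • Verma.op K PowerSeries.X (algebraMap ℂ Ch l) id .F
  map_zero' := by simp
  map_add' x y := by
    have h : ∀ i j, (x + y).1 i j = x.1 i j + y.1 i j := fun _ _ => rfl
    simp only [h, map_add, add_smul]
    abel

section Verma

variable {K : Type*} [AddCommGroup K] [Module Ch K] {l : ℂ}

theorem vermaHom_gen (g : Gen) :
    vermaHom K l (sl2Gen g) = Verma.op K PowerSeries.X (algebraMap ℂ Ch l) id g := by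
  cases g <;> simp [vermaHom, sl2Gen]

theorem vermaHom_smul (c : ℂ) (x : sl2) :
    vermaHom K l (c • x) = algebraMap ℂ Ch c • vermaHom K l x := by
  have h : ∀ i j, (c • x).1 i j = c * x.1 i j := fun _ _ => rfl
  simp only [vermaHom, AddMonoidHom.coe_mk, ZeroHom.coe_mk, h, map_mul, smul_add, smul_smul]

theorem vermaHom_lie (x y : sl2) :
    vermaHom K l x * vermaHom K l y - vermaHom K l y * vermaHom K l x =
      (PowerSeries.X : Ch) • vermaHom K l ⁅x, y⁆ := by
  refine (bracket_of_rel (Verma.rel_HE (K := K) PowerSeries.X (algebraMap ℂ Ch l) id)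
    (Verma.rel_HF (K := K) PowerSeries.X (algebraMap ℂ Ch l) id)
    (Verma.rel_EF (K := K) PowerSeries.X (algebraMap ℂ Ch l) id) _ _ _ _ _ _).trans ?_
  simp only [vermaHom, AddMonoidHom.coe_mk, ZeroHom.coe_mk, LieAlgebra.SpecialLinear.sl_bracket,
    Matrix.sub_apply, Matrix.mul_apply, Fin.sum_univ_two, sl2_trace, map_sub, map_add, map_mul,
    map_neg]
  congr 4 <;> ring

end Verma

/-- The same separation by matrix coefficients in the single parameter ħ, with s the identity, so
that [E, F] = ħH. -/
theorem ofPoly_injective : Function.Injective ofPoly := by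
  rw [← LinearMap.ker_eq_bot, LinearMap.ker_eq_bot']
  intro m hm
  have key : ∀ a c l, coeffMap (weightEval a c l) m = (0 : Ch) := fun a c l => by
    refine IsHausdorff.haus (I := IsLocalRing.maximalIdeal Ch) inferInstance _ fun n => ?_
    rw [SModEq.zero, smul_eq_mul, Ideal.mul_top]
    let K := Ch ⧸ IsLocalRing.maximalIdeal Ch ^ n
    let ρ : UH →ₐ[Ch] Module.End Ch (ℕ → ℕ → K) :=
      lift (Verma.killedBy (killedBy_quotient n)) (vermaHom K l) vermaHom_smul vermaHom_lie
    let coord : (ℕ → ℕ → K) →ₗ[Ch] K := LinearMap.proj c ∘ₗ LinearMap.proj a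
    let f₁ : Curved →ₗ[Ch] K :=
      coord ∘ₗ LinearMap.applyₗ (Verma.vec 0 0 (1 : K)) ∘ₗ ρ.toLinearMap ∘ₗ ofPoly
    let f₂ : Curved →ₗ[Ch] K := (Submodule.mkQ (IsLocalRing.maximalIdeal Ch ^ n)) ∘ₗ
      { coeffMap (weightEval a c l) with
        map_smul' := fun t m => by
          have := coeffMap_map_mul (weightEval_mul a c l) t m
          rw [map_ringHom_id, RingHom.id_apply] at this
          rw [Algebra.smul_def]
          exact this }
    have h12 : f₁ = f₂ := by
      refine (killedBy_quotient n).linearMap_ext Curved.exists_sub_mem ?_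
      rintro _ ⟨p, rfl⟩
      have h1 : f₁ (PowerSeries.C p) =
          ρ (ofPoly (PowerSeries.C p)) (Verma.vec 0 0 (1 : K)) a c := rfl
      have h2 : f₂ (PowerSeries.C p) = Ideal.Quotient.mk _
          (coeffMap (weightEval a c l) (PowerSeries.C p)) := rfl
      have h3 : ∀ t : ℂ, algebraMap ℂ Ch t = PowerSeries.C t := fun t => by
        rw [PowerSeries.algebraMap_apply]; rfl
      rw [h1, h2, coeffMap_C, ofPoly_C, weightEval_apply, ← h3]
      refine (Verma.ordered_vec (z := PowerSeries.X) (l := l) (s := id)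
        (((ρ : UH →+* Module.End Ch (ℕ → ℕ → K)).comp (mk : TensorH →+* UH)).comp TensorH.C)
        (fun t => ?_) (fun g => ?_) p a c 1).trans ?_
      · have : TensorH.C (algebraMap ℂ (TensorAlgebra ℂ sl2) t) =
            algebraMap Ch TensorH (algebraMap ℂ Ch t) := by
          rw [← TensorH.toSeries.injective.eq_iff, TensorH.toSeries_algebraMap, h3,
            PowerSeries.map_C]
          rfl
        simp only [RingHom.comp_apply, this]
        exact ((ρ.comp mk).commutes _)
      · exact (lift_ι _ _ vermaHom_smul vermaHom_lie _).trans (vermaHom_gen g)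
      · rw [← Algebra.algebraMap_eq_smul_one]; rfl
    have h0 : f₁ m = 0 := by
      change coord (ρ (ofPoly m) _) = 0
      rw [hm, map_zero, LinearMap.zero_apply, map_zero]
    rw [h12] at h0
    exact Ideal.Quotient.eq_zero_iff_mem.1 h0
  refine PowerSeries.ext fun i => ?_
  refine eq_zero_of_eval_weightPart fun a c l => ?_
  rw [← weightEval_apply, ← coeff_coeffMap, key]
  simp

theorem ofPoly_bijective : Function.Bijective ofPoly := ⟨ofPoly_injective, ofPoly_surjective⟩

/-- The Poincaré–Birkhoff–Witt isomorphism. -/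
def polyEquiv : Curved ≃ₗ[Ch] UH := LinearEquiv.ofBijective ofPoly ofPoly_bijective

instance isAdicComplete : IsAdicComplete (IsLocalRing.maximalIdeal Ch) UH :=
  isAdicComplete_of_linearEquiv polyEquiv _

end UH

/-! ### The arrows of the square -/

section Extensionality

variable {R A S B : Type*} [CommRing R] [IsLocalRing R] [Ring A] [Algebra R A] [CommRing S]
  [IsLocalRing S] [Ring B] [Algebra S B]

/-- Two continuous maps that agree on scalars and topological generators and are compatible with
sums and products in the same way are equal. -/
theorem TopGen.map_ext {x : Gen → A} (hx : TopGen R x)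
    (haus : IsHausdorff (IsLocalRing.maximalIdeal S) B) {f g : A →+ B}
    (hf : ∀ n, ∀ a ∈ adicIdeal R A n, f a ∈ adicIdeal S B n)
    (hg : ∀ n, ∀ a ∈ adicIdeal R A n, g a ∈ adicIdeal S B n)
    (hmul : ∀ n a b, Trunc.mk S B n (f a) = Trunc.mk S B n (g a) →
      Trunc.mk S B n (f b) = Trunc.mk S B n (g b) →
      Trunc.mk S B n (f (a * b)) = Trunc.mk S B n (g (a * b)))
    (halg : ∀ c, f (algebraMap R A c) = g (algebraMap R A c))
    (hgen : ∀ i, f (x i) = g (x i)) (a : A) : f a = g a := by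
  rw [← sub_eq_zero]
  refine haus.haus _ fun n => ?_
  rw [SModEq.zero, ← mem_adicIdeal, ← Trunc.mk_eq_zero, map_sub, sub_eq_zero]
  induction a using hx.induction n with
  | add a b ha hb => rw [map_add, map_add, map_add, map_add, ha, hb]
  | mul a b ha hb => exact hmul n a b ha hb
  | alg c => rw [halg]
  | gen i => rw [hgen]
  | ideal a ha => rw [Trunc.mk_eq_zero.2 (hf n a ha), Trunc.mk_eq_zero.2 (hg n a ha)]

end Extensionality

theorem map_algebraMap_of_semilinear {R A S B : Type*} [CommRing R] [Ring A] [Algebra R A]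
    [CommRing S] [Ring B] [Algebra S B] {σ : R →+* S} (f : A →ₛₗ[σ] B) (f_one : f 1 = 1) (c : R) :
    f (algebraMap R A c) = algebraMap S B (σ c) := by
  rw [Algebra.algebraMap_eq_smul_one, map_smulₛₗ, f_one, Algebra.algebraMap_eq_smul_one]

theorem map_ordered {A B : Type*} [Ring A] [Algebra ℂ A] [Ring B] [Algebra ℂ B] (T : A →ₐ[ℂ] B)
    (x : Gen → A) (p : Flat) : T (ordered x p) = ordered (fun g => T (x g)) p := by
  induction p using MvPolynomial.induction_on' with
  | monomial e c => simp only [ordered_monomial, map_smul, map_mul, map_pow]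
  | add p q hp hq => rw [map_add, map_add, map_add, hp, hq]

theorem ordered_X (p : Flat) : ordered (MvPolynomial.X : Gen → Flat) p = p := by
  induction p using MvPolynomial.induction_on' with
  | monomial e c => rw [ordered_monomial, monomial_gen, MvPolynomial.smul_eq_C_mul]
  | add p q hp hq => rw [map_add, hp, hq]

theorem map_sinhDiv {B B' : Type*} [Ring B] [Algebra ℂ B] [Ring B'] [Algebra ℂ B'] (f : B →ₐ[ℂ] B')
    (h : B) : PowerSeries.map (f : B →+* B') (sinhDiv h) = sinhDiv (f h) := by
  ext k
  rw [PowerSeries.coeff_map, coeff_sinhDiv, coeff_sinhDiv]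
  exact (map_smul f _ _).trans (by rw [map_pow])

theorem constantCoeff_map {B B' : Type*} [Ring B] [Ring B'] (f : B →+* B') (g : B⟦X⟧) :
    PowerSeries.constantCoeff (PowerSeries.map f g) = f (PowerSeries.constantCoeff g) := by
  rw [← PowerSeries.coeff_zero_eq_constantCoeff_apply, PowerSeries.coeff_map,
    PowerSeries.coeff_zero_eq_constantCoeff_apply]

theorem redHom_refl_apply {k : Type*} [CommRing k] (c : k⟦X⟧) :
    redHom (RingEquiv.refl k⟦X⟧) c = PowerSeries.constantCoeff c := rfl

/-- The exchange of the variables of double power series. -/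
def swapSeries (B : Type*) [CommRing B] : B⟦X⟧⟦X⟧ ≃+ B⟦X⟧⟦X⟧ where
  toFun f := PowerSeries.mk fun i => PowerSeries.mk fun j => (f.coeff j).coeff i
  invFun f := PowerSeries.mk fun i => PowerSeries.mk fun j => (f.coeff j).coeff i
  left_inv f := by ext; simp
  right_inv f := by ext; simp
  map_add' f g := by ext; simp

theorem coeff_coeff_swapSeries {B : Type*} [CommRing B] (f : B⟦X⟧⟦X⟧) (i j : ℕ) :
    ((swapSeries B f).coeff i).coeff j = (f.coeff j).coeff i := by
  simp [swapSeries]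

theorem coeff_coeff_swapVars (f : ℂ⟦X⟧⟦X⟧) (i j : ℕ) :
    ((swapVars f).coeff i).coeff j = (f.coeff j).coeff i := by
  change ((PowerSeries.mk fun i => PowerSeries.mk fun j => (f.coeff j).coeff i).coeff i).coeff j = _
  simp

theorem swapSeries_map_mul (c : ℂ⟦X⟧⟦X⟧) (f : Flat⟦X⟧⟦X⟧) :
    swapSeries Flat (PowerSeries.map (PowerSeries.map (algebraMap ℂ Flat)) c * f) =
      PowerSeries.map (PowerSeries.map (algebraMap ℂ Flat)) (swapVars c) * swapSeries Flat f := by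
  ext i j : 2
  simp only [coeff_coeff_swapSeries, PowerSeries.coeff_mul, map_sum, PowerSeries.coeff_map,
    coeff_coeff_swapVars]
  exact Finset.sum_comm

/-- Since r is the inner variable, reduction modulo r is taking the constant term in each
coefficient of ħ. -/
theorem redHom_swapVars (c : Crh) :
    redHom swapVars c = PowerSeries.map PowerSeries.constantCoeff c := by
  ext j
  change PowerSeries.coeff j (PowerSeries.constantCoeff (swapVars c)) = _
  rw [← PowerSeries.coeff_zero_eq_constantCoeff_apply, coeff_coeff_swapVars, PowerSeries.coeff_map,
    PowerSeries.coeff_zero_eq_constantCoeff_apply]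

/-- The map from noncommutative to commutative polynomials. -/
def freeToFlat : FreeAlgebra ℂ Gen →ₐ[ℂ] Flat := FreeAlgebra.lift ℂ MvPolynomial.X

theorem freeToFlat_ι (g : Gen) : freeToFlat (FreeAlgebra.ι ℂ g) = MvPolynomial.X g :=
  FreeAlgebra.lift_ι_apply _ _

/-- The map from noncommutative polynomials to tensors. -/
def freeToTensor : FreeAlgebra ℂ Gen →ₐ[ℂ] TensorAlgebra ℂ sl2 :=
  FreeAlgebra.lift ℂ fun g => TensorAlgebra.ι ℂ (sl2Gen g)

theorem freeToTensor_ι (g : Gen) :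
    freeToTensor (FreeAlgebra.ι ℂ g) = TensorAlgebra.ι ℂ (sl2Gen g) :=
  FreeAlgebra.lift_ι_apply _ _

/-! #### The top arrow -/

namespace UQ

/-- Reduction modulo `ħ` before passing to the quotient. -/
def modHbarFree : FreeQ →+* Curved :=
  (PowerSeries.map (freeToFlat : FreeAlgebra ℂ Gen →+* Flat)).comp
    (PowerSeries.constantCoeff.comp (FreeQ.toSeries : FreeQ →+* (FreeAlgebra ℂ Gen)⟦X⟧⟦X⟧))

theorem modHbarFree_apply (f : FreeQ) : modHbarFree f =
    PowerSeries.map (freeToFlat : FreeAlgebra ℂ Gen →+* Flat)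
      (PowerSeries.constantCoeff (FreeQ.toSeries f)) := rfl

theorem modHbarFree_ofSeries (f : (FreeAlgebra ℂ Gen)⟦X⟧) : modHbarFree (FreeQ.ofSeries f) =
    PowerSeries.map (freeToFlat : FreeAlgebra ℂ Gen →+* Flat) f := by
  rw [modHbarFree_apply, FreeQ.toSeries_ofSeries, PowerSeries.constantCoeff_C]

theorem modHbarFree_gen (g : Gen) : modHbarFree (FreeQ.gen g) = Curved.gen g := by
  rw [FreeQ.gen, modHbarFree_ofSeries, PowerSeries.map_C]
  exact congrArg _ (freeToFlat_ι g)

theorem modHbarFree_smul (c : Crh) (f : FreeQ) :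
    modHbarFree (c • f) = redHom (RingEquiv.refl Crh) c • modHbarFree f := by
  rw [modHbarFree_apply, FreeQ.toSeries_smul, map_mul, map_mul, ← modHbarFree_apply,
    Algebra.smul_def, Curved.algebraMap_eq, redHom_refl_apply]
  congr 1
  ext i : 1
  rw [constantCoeff_map, PowerSeries.coeff_map, PowerSeries.coeff_map, PowerSeries.coeff_map]
  exact freeToFlat.commutes _

theorem redHom_hh : redHom (RingEquiv.refl Crh) hh = 0 := by
  rw [redHom_refl_apply, hh, PowerSeries.constantCoeff_X]

/-- Reduction modulo `ħ`. -/
def modHbar : UQ →ₛₗ[redHom (RingEquiv.refl Crh)] Curved :=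
  desc modHbarFree modHbarFree_smul fun x hx => by
    rcases hx with rfl | rfl | rfl <;>
    simp only [map_sub, map_add, map_mul, modHbarFree_smul, redHom_hh, mul_zero, zero_smul,
      modHbarFree_gen, sub_zero, add_zero] <;>
    ring

theorem modHbar_mk (f : FreeQ) : modHbar (mk f) = modHbarFree f := rfl

theorem modHbar_one : modHbar 1 = 1 := desc_one _ _ _

theorem modHbar_mul (a b : UQ) : modHbar (a * b) = modHbar a * modHbar b := desc_mul _ _ _ a b

theorem modHbar_gen (g : Gen) : modHbar (gen g) = Curved.gen g := modHbarFree_gen g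

theorem modHbar_exp (t : ℂ) : modHbar (exp t) = Curved.exp t := by
  rw [← mk_ofSeries_expS, modHbar_mk, modHbarFree_ofSeries, map_expS freeToFlat, freeToFlat_ι]
  rfl

theorem modHbar_sinh : modHbar sinh = sinhDiv (MvPolynomial.X Gen.H) := by
  rw [sinh, modHbar_mk, modHbarFree_ofSeries, map_sinhDiv freeToFlat, freeToFlat_ι]

/-- Commuting variables undo the ordering of monomials, so in Poincaré–Birkhoff–Witt coordinates the
arrow is the constant term in ħ, as freeness requires. -/
theorem modHbar_ofPoly (m : Curved⟦X⟧) : modHbar (ofPoly m) = PowerSeries.constantCoeff m := by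
  rw [ofPoly_apply, modHbar_mk, modHbarFree_apply, RingEquiv.apply_symm_apply,
    constantCoeff_coeffMap]
  ext i : 1
  rw [PowerSeries.coeff_map, coeff_coeffMap]
  refine (map_ordered freeToFlat (FreeAlgebra.ι ℂ) _).trans ?_
  simp only [freeToFlat_ι]
  exact ordered_X _

theorem modHbar_free : ∃ φ : UQ ≃+ Curved⟦X⟧,
    (∀ s a, φ (s • a) = PowerSeries.map (algebraMap Cr Curved) (RingEquiv.refl Crh s) * φ a) ∧
      ∀ a, PowerSeries.constantCoeff (φ a) = modHbar a := by
  refine ⟨polyEquiv.symm.toAddEquiv, fun s a => ?_, fun a => ?_⟩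
  · exact (map_smul polyEquiv.symm s a).trans (Algebra.smul_def _ _)
  · obtain ⟨m, rfl⟩ := polyEquiv.surjective a
    exact (congrArg _ (polyEquiv.symm_apply_apply m)).trans (modHbar_ofPoly m).symm

/-! #### The left arrow -/

/-- Reduction modulo `r` before passing to the quotient. -/
def modRFree : FreeQ →+* UH :=
  (UH.mk : TensorH →+* UH).comp ((TensorH.toSeries.symm : (TensorAlgebra ℂ sl2)⟦X⟧ →+* TensorH).comp
    ((PowerSeries.map ((freeToTensor : FreeAlgebra ℂ Gen →+* TensorAlgebra ℂ sl2).comp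
      PowerSeries.constantCoeff)).comp (FreeQ.toSeries : FreeQ →+* (FreeAlgebra ℂ Gen)⟦X⟧⟦X⟧)))

theorem modRFree_apply (f : FreeQ) : modRFree f = UH.mk (TensorH.toSeries.symm
    (PowerSeries.map ((freeToTensor : FreeAlgebra ℂ Gen →+* TensorAlgebra ℂ sl2).comp
      PowerSeries.constantCoeff) (FreeQ.toSeries f))) := rfl

theorem modRFree_ofSeries (f : (FreeAlgebra ℂ Gen)⟦X⟧) : modRFree (FreeQ.ofSeries f) =
    UH.mk (TensorH.C (freeToTensor (PowerSeries.constantCoeff f))) := by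
  rw [modRFree_apply, FreeQ.toSeries_ofSeries, PowerSeries.map_C]
  rfl

theorem modRFree_gen (g : Gen) : modRFree (FreeQ.gen g) = UH.gen g := by
  rw [FreeQ.gen, modRFree_ofSeries, PowerSeries.constantCoeff_C, freeToTensor_ι]
  rfl

theorem modRFree_smul (c : Crh) (f : FreeQ) :
    modRFree (c • f) = redHom swapVars c • modRFree f := by
  rw [modRFree_apply, modRFree_apply, FreeQ.toSeries_smul, map_mul, ← map_smul UH.mk]
  congr 1
  apply TensorH.toSeries.injective
  rw [TensorH.toSeries_smul, RingEquiv.apply_symm_apply, RingEquiv.apply_symm_apply,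
    redHom_swapVars]
  congr 1
  ext j : 1
  rw [PowerSeries.coeff_map, PowerSeries.coeff_map, PowerSeries.coeff_map, PowerSeries.coeff_map,
    RingHom.comp_apply, constantCoeff_map]
  exact freeToTensor.commutes _

theorem redHom_swapVars_hh : redHom swapVars hh = PowerSeries.X := by
  rw [redHom_swapVars, hh, PowerSeries.map_X]

theorem constantCoeff_sinhDiv {B : Type*} [Ring B] [Algebra ℂ B] (h : B) :
    PowerSeries.constantCoeff (sinhDiv h) = h := by
  rw [← PowerSeries.coeff_zero_eq_constantCoeff_apply, coeff_sinhDiv]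
  norm_num

theorem UH_gen_HE : UH.gen .H * UH.gen .E - UH.gen .E * UH.gen .H =
    (2 * PowerSeries.X : Ch) • UH.gen .E := by
  have h : ⁅sl2Gen .H, sl2Gen .E⁆ = sl2Gen .E + sl2Gen .E := by
    ext i j
    fin_cases i <;> fin_cases j <;> norm_num [sl2Gen, Ring.lie_def]
  refine (UH.rel _ _).trans ?_
  rw [h, UH.ι_add, two_mul, add_smul, smul_add]
  rfl

theorem UH_gen_HF : UH.gen .H * UH.gen .F - UH.gen .F * UH.gen .H =
    -((2 * PowerSeries.X : Ch) • UH.gen .F) := by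
  have h : ⁅sl2Gen .H, sl2Gen .F⁆ = -(sl2Gen .F + sl2Gen .F) := by
    ext i j
    fin_cases i <;> fin_cases j <;> norm_num [sl2Gen, Ring.lie_def]
  refine (UH.rel _ _).trans ?_
  rw [h, UH.ι_neg, UH.ι_add, two_mul, add_smul, smul_neg, smul_add]
  rfl

theorem UH_gen_EF : UH.gen .E * UH.gen .F - UH.gen .F * UH.gen .E =
    (PowerSeries.X : Ch) • UH.gen .H := by
  have h : ⁅sl2Gen .E, sl2Gen .F⁆ = sl2Gen .H := by
    ext i j
    fin_cases i <;> fin_cases j <;> norm_num [sl2Gen, Ring.lie_def]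
  refine (UH.rel _ _).trans ?_
  rw [h]
  rfl

/-- Reduction modulo `r`. -/
def modR : UQ →ₛₗ[redHom swapVars] UH :=
  desc modRFree modRFree_smul fun x hx => by
    rcases hx with rfl | rfl | rfl
    · rw [map_sub, map_sub, map_mul, map_mul, modRFree_smul, modRFree_gen, modRFree_gen,
        map_mul, redHom_swapVars_hh, map_ofNat, UH_gen_HE, sub_self]
    · rw [map_add, map_sub, map_mul, map_mul, modRFree_smul, modRFree_gen, modRFree_gen,
        map_mul, redHom_swapVars_hh, map_ofNat, UH_gen_HF, neg_add_cancel]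
    · rw [map_sub, map_sub, map_mul, map_mul, modRFree_smul, modRFree_gen, modRFree_gen,
        redHom_swapVars_hh, UH_gen_EF, modRFree_ofSeries, constantCoeff_sinhDiv, freeToTensor_ι]
      exact sub_self _

theorem modR_mk (f : FreeQ) : modR (mk f) = modRFree f := rfl

theorem modR_one : modR 1 = 1 := desc_one _ _ _

theorem modR_mul (a b : UQ) : modR (a * b) = modR a * modR b := desc_mul _ _ _ a b

theorem modR_gen (g : Gen) : modR (gen g) = UH.gen g := modRFree_gen g

theorem modR_exp (t : ℂ) : modR (exp t) = 1 := by
  rw [← mk_ofSeries_expS, modR_mk, modRFree_ofSeries,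
    ← PowerSeries.coeff_zero_eq_constantCoeff_apply, coeff_expS]
  simp

theorem modR_ofPoly (m : Curved⟦X⟧) : modR (ofPoly m) =
    UH.ofPoly (PowerSeries.constantCoeff (swapSeries Flat m)) := by
  rw [ofPoly_apply, modR_mk, modRFree_apply, RingEquiv.apply_symm_apply, UH.ofPoly_apply]
  congr 2
  ext j : 1
  rw [PowerSeries.coeff_map, coeff_coeffMap, coeff_coeffMap, RingHom.comp_apply,
    constantCoeff_coeffMap, ← PowerSeries.coeff_zero_eq_constantCoeff_apply (swapSeries Flat m),
    coeff_coeff_swapSeries, PowerSeries.coeff_zero_eq_constantCoeff_apply]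
  refine (map_ordered freeToTensor (FreeAlgebra.ι ℂ) _).trans ?_
  simp only [freeToTensor_ι]
  rfl

/-- The chain is U_q^ħ ≅ ℂ[H, E, F]⟦r⟧⟦ħ⟧ ≅ ℂ[H, E, F]⟦ħ⟧⟦r⟧ ≅ U^ħ⟦r⟧: ordered monomials, exchange
of the variables, and ordered monomials again in each coefficient of r. -/
theorem modR_free : ∃ φ : UQ ≃+ UH⟦X⟧,
    (∀ s a, φ (s • a) = PowerSeries.map (algebraMap Ch UH) (swapVars s) * φ a) ∧
      ∀ a, PowerSeries.constantCoeff (φ a) = modR a := by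
  let ψ : Flat⟦X⟧⟦X⟧ ≃+ UH⟦X⟧ := AddEquiv.ofBijective
    (coeffMap (UH.ofPoly.toAddMonoidHom : Curved →+ UH)) (coeffMap_bijective UH.ofPoly_bijective)
  refine ⟨(polyEquiv.symm.toAddEquiv.trans (swapSeries Flat)).trans ψ, fun s a => ?_,
    fun a => ?_⟩
  · change ψ (swapSeries Flat (polyEquiv.symm (s • a))) =
      _ * ψ (swapSeries Flat (polyEquiv.symm a))
    rw [map_smul, Algebra.smul_def, Curved.algebraMap_series, swapSeries_map_mul]
    refine coeffMap_map_mul (g := (UH.ofPoly.toAddMonoidHom : Curved →+ UH))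
      (α := PowerSeries.map (algebraMap ℂ Flat)) (fun c v => ?_) _ _
    rw [← Curved.algebraMap_eq, ← Algebra.smul_def, ← Algebra.smul_def]
    exact map_smul UH.ofPoly c v
  · obtain ⟨m, rfl⟩ := polyEquiv.surjective a
    change PowerSeries.constantCoeff (ψ (swapSeries Flat (polyEquiv.symm (polyEquiv m)))) = _
    rw [LinearEquiv.symm_apply_apply]
    exact (constantCoeff_coeffMap (UH.ofPoly.toAddMonoidHom : Curved →+ UH)
      (swapSeries Flat m)).trans (modR_ofPoly m).symm

end UQ

/-! #### The right arrow -/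

namespace Curved

/-- Reduction modulo `r`. -/
def modR : Curved →ₛₗ[redHom (RingEquiv.refl Cr)] Flat :=
  { (PowerSeries.constantCoeff : Curved →+* Flat) with
    map_smul' := fun c f => by
      change PowerSeries.constantCoeff (c • f) = redHom _ c • PowerSeries.constantCoeff f
      rw [Algebra.smul_def, map_mul, Curved.algebraMap_eq, constantCoeff_map,
        Algebra.smul_def, redHom_refl_apply] }

theorem modR_apply (f : Curved) : modR f = PowerSeries.constantCoeff f := rfl

theorem modR_gen (g : Gen) : modR (gen g) = MvPolynomial.X g := PowerSeries.constantCoeff_C _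

theorem modR_exp (t : ℂ) : modR (exp t) = 1 := by
  rw [modR_apply, exp, ← PowerSeries.coeff_zero_eq_constantCoeff_apply, coeff_expS]
  simp

theorem modR_free : ∃ φ : Curved ≃+ Flat⟦X⟧,
    (∀ s a, φ (s • a) = PowerSeries.map (algebraMap ℂ Flat) (RingEquiv.refl Cr s) * φ a) ∧
      ∀ a, PowerSeries.constantCoeff (φ a) = modR a :=
  ⟨AddEquiv.refl _, fun s a => Algebra.smul_def s a, fun _ => rfl⟩

end Curved

/-! #### The bottom arrow -/

namespace UH

/-- Reduction modulo `ħ` before passing to the quotient. -/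
def modHbarTensor : TensorH →+* Flat :=
  (toFlat : TensorAlgebra ℂ sl2 →+* Flat).comp
    (PowerSeries.constantCoeff.comp (TensorH.toSeries : TensorH →+* (TensorAlgebra ℂ sl2)⟦X⟧))

theorem modHbarTensor_apply (f : TensorH) :
    modHbarTensor f = toFlat (PowerSeries.constantCoeff (TensorH.toSeries f)) := rfl

theorem modHbarTensor_ι (x : sl2) : modHbarTensor (TensorH.ι x) = Flat.linear x := by
  rw [modHbarTensor_apply, TensorH.toSeries_ι, PowerSeries.constantCoeff_C, toFlat_ι]

theorem modHbarTensor_smul (c : Ch) (f : TensorH) :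
    modHbarTensor (c • f) = redHom (RingEquiv.refl Ch) c • modHbarTensor f := by
  rw [modHbarTensor_apply, TensorH.toSeries_smul, map_mul, map_mul, constantCoeff_map,
    AlgHom.commutes, Algebra.smul_def, redHom_refl_apply, modHbarTensor_apply]

/-- Reduction modulo `ħ`. -/
def modHbar : UH →ₛₗ[redHom (RingEquiv.refl Ch)] Flat :=
  desc modHbarTensor modHbarTensor_smul fun t ht => by
    obtain ⟨x, y, rfl⟩ := ht
    rw [map_sub, map_sub, map_mul, map_mul, modHbarTensor_smul, redHom_refl_apply,
      PowerSeries.constantCoeff_X, zero_smul, sub_zero, mul_comm, sub_self]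

theorem modHbar_mk (f : TensorH) : modHbar (mk f) = modHbarTensor f := rfl

theorem modHbar_one : modHbar 1 = 1 := desc_one _ _ _

theorem modHbar_mul (a b : UH) : modHbar (a * b) = modHbar a * modHbar b := desc_mul _ _ _ a b

theorem modHbar_ι (x : sl2) : modHbar (ι x) = Flat.linear x := modHbarTensor_ι x

theorem modHbar_gen (g : Gen) : modHbar (gen g) = MvPolynomial.X g :=
  (modHbar_ι _).trans (Flat.linear_sl2Gen g)

theorem modHbar_ofPoly (m : Curved) : modHbar (ofPoly m) = PowerSeries.constantCoeff m := by
  rw [ofPoly_apply, modHbar_mk, modHbarTensor_apply, RingEquiv.apply_symm_apply,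
    constantCoeff_coeffMap]
  refine (map_ordered toFlat (fun g => TensorAlgebra.ι ℂ (sl2Gen g))
    (PowerSeries.constantCoeff m)).trans ?_
  simp only [toFlat_ι, Flat.linear_sl2Gen]
  exact ordered_X _

theorem modHbar_free : ∃ φ : UH ≃+ Flat⟦X⟧,
    (∀ s a, φ (s • a) = PowerSeries.map (algebraMap ℂ Flat) (RingEquiv.refl Ch s) * φ a) ∧
      ∀ a, PowerSeries.constantCoeff (φ a) = modHbar a := by
  refine ⟨polyEquiv.symm.toAddEquiv, fun s a => ?_, fun a => ?_⟩
  · exact (map_smul polyEquiv.symm s a).trans (Algebra.smul_def _ _)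
  · obtain ⟨m, rfl⟩ := polyEquiv.surjective a
    exact (congrArg _ (polyEquiv.symm_apply_apply m)).trans (modHbar_ofPoly m).symm

end UH

/-! ### Hopf algebras and involutions -/

/-- The Hopf algebra `U_q^ħ(sl₂)`. -/
def UQ.hopf : AdicHopf Crh UQ :=
  twistedHopf UQ.isAdicComplete UQ.topGen UQ.isTwistedCoproduct UQ.isTwistedAntipode

/-- The Hopf algebra `U^ħ(sl₂)`. -/
def UH.hopf : AdicHopf Ch UH :=
  twistedHopf UH.isAdicComplete UH.topGen UH.isTwistedCoproduct UH.isTwistedAntipode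

/-- The Hopf algebra `ℂ[(SU₂*)_r]`. -/
def Curved.hopf : AdicHopf Cr Curved :=
  twistedHopf inferInstance Curved.topGen Curved.isTwistedCoproduct Curved.isTwistedAntipode

/-- The Hopf algebra `ℂ[su₂*]`. -/
def Flat.hopf : AdicHopf ℂ Flat :=
  twistedHopf inferInstance Flat.topGen Flat.isTwistedCoproduct Flat.isTwistedAntipode

theorem conj₁_conj₁ (c : Cr) : conj₁ (conj₁ c) = c := by
  ext i
  rw [PowerSeries.coeff_map, PowerSeries.coeff_map, Complex.conj_conj]

theorem conj₂_conj₂ (c : Crh) : conj₂ (conj₂ c) = c := by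
  ext i : 1
  rw [PowerSeries.coeff_map, PowerSeries.coeff_map, conj₁_conj₁]

theorem conj_half : starRingEnd ℂ (1 / 2) = 1 / 2 := by
  rw [map_div₀, map_one, map_ofNat]

theorem conj_neg_half : starRingEnd ℂ (-1 / 2) = -1 / 2 := by
  rw [map_div₀, map_neg, map_one, map_ofNat]

theorem UQ.dag_one : UQ.dag 1 = 1 := UQ.anti_one _

theorem UQ.dag_mul (a b : UQ) : UQ.dag (a * b) = UQ.dag b * UQ.dag a := UQ.anti_mul _ a b

theorem UH.dag_one : UH.dag 1 = 1 :=
  UH.anti_one _ _ _ sl2Dag_lie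

theorem UH.dag_mul (a b : UH) : UH.dag (a * b) = UH.dag b * UH.dag a := 
  UH.anti_mul _ _ _ sl2Dag_lie a b

theorem Curved.dag_one : Curved.dag 1 = 1 := map_one (PowerSeries.map Flat.dagHom)

theorem Curved.dag_mul (a b : Curved) : Curved.dag (a * b) = Curved.dag b * Curved.dag a :=
  (map_mul (PowerSeries.map Flat.dagHom) a b).trans (mul_comm _ _)

theorem Flat.dag_one : Flat.dag 1 = 1 := map_one Flat.dagHom

theorem Flat.dag_mul (a b : Flat) : Flat.dag (a * b) = Flat.dag b * Flat.dag a :=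
  (map_mul Flat.dagHom a b).trans (mul_comm _ _)

theorem UQ.isHopfStar : IsHopfStar UQ.hopf UQ.dag :=
  twisted_isHopfStar UQ.hopf UQ.topGen UQ.isTwistedCoproduct UQ.counit_gen conj₂_conj₂
    inferInstance UQ.dag UQ.dag_one UQ.dag_mul UQ.dag_gen
    (by rw [UQ.dag_exp, conj_half]) (by rw [UQ.dag_exp, conj_neg_half])

theorem UH.isHopfStar : IsHopfStar UH.hopf UH.dag :=
  twisted_isHopfStar UH.hopf UH.topGen UH.isTwistedCoproduct (fun _ => UH.counit_ι _) conj₁_conj₁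
    inferInstance UH.dag UH.dag_one UH.dag_mul UH.dag_gen UH.dag_one UH.dag_one

theorem Curved.isHopfStar : IsHopfStar Curved.hopf Curved.dag :=
  twisted_isHopfStar Curved.hopf Curved.topGen Curved.isTwistedCoproduct Curved.counit_gen
    conj₁_conj₁ inferInstance Curved.dag Curved.dag_one Curved.dag_mul Curved.dag_gen
    (by rw [Curved.dag_exp, conj_half]) (by rw [Curved.dag_exp, conj_neg_half])

theorem Flat.isHopfStar : IsHopfStar Flat.hopf Flat.dag :=
  twisted_isHopfStar Flat.hopf Flat.topGen Flat.isTwistedCoproduct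
    Flat.isTwistedAntipode.counit_gen Complex.conj_conj
    inferInstance Flat.dag Flat.dag_one Flat.dag_mul Flat.dagHom_X Flat.dag_one Flat.dag_one

theorem IsTwistedCoproduct.isCurvedCoproduct {R A : Type*} [CommRing R] [IsLocalRing R] [Ring A]
    [Algebra R A] {hA : AdicHopf R A} {x : Gen → A} {ex : ℂ → A}
    (h : IsTwistedCoproduct hA.comul x (ex (1 / 2)) (ex (-1 / 2))) :
    IsCurvedCoproduct hA x ex where
  exp_pos := h.pos
  exp_neg := h.neg
  H := h.H
  E := h.E
  F := h.F

/-! ### Deformations and quantizations -/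

theorem UQ.isHopfDeformation_modR : IsHopfDeformation swapVars UQ.hopf UH.hopf UQ.modR where
  free := UQ.modR_free
  map_one := UQ.modR_one
  map_mul := UQ.modR_mul
  map_comul := twisted_map_comul UQ.modR UQ.modR_one UQ.modR_mul UQ.topGen UQ.isTwistedCoproduct
    UH.isTwistedCoproduct UQ.modR_gen (UQ.modR_exp _) (UQ.modR_exp _)

theorem Curved.isHopfDeformation_modR :
    IsHopfDeformation (RingEquiv.refl Cr) Curved.hopf Flat.hopf Curved.modR where
  free := Curved.modR_free
  map_one := map_one PowerSeries.constantCoeff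
  map_mul := map_mul PowerSeries.constantCoeff
  map_comul := twisted_map_comul Curved.modR (map_one PowerSeries.constantCoeff)
    (map_mul PowerSeries.constantCoeff) Curved.topGen Curved.isTwistedCoproduct
    Flat.isTwistedCoproduct Curved.modR_gen (Curved.modR_exp _) (Curved.modR_exp _)

/-- Both sides are antisymmetric, so the nine pairs of generators reduce to three. -/
theorem IsPoissonBracket.commutator_of_pairs {k R A B : Type*} [CommRing k] [CommRing R] [Ring A]
    [Algebra R A] [CommRing B] [Algebra k B] {σ : R →+* k} {br : B →ₗ[k] B →ₗ[k] B}
    (hbr : IsPoissonBracket br) (z : R) (π : A →ₛₗ[σ] B) {x : Gen → A}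
    (he : ∃ c, x .H * x .E - x .E * x .H = z • c ∧ π c = br (π (x .H)) (π (x .E)))
    (hf : ∃ c, x .H * x .F - x .F * x .H = z • c ∧ π c = br (π (x .H)) (π (x .F)))
    (ef : ∃ c, x .E * x .F - x .F * x .E = z • c ∧ π c = br (π (x .E)) (π (x .F))) (i j : Gen) :
    ∃ c, x i * x j - x j * x i = z • c ∧ π c = br (π (x i)) (π (x j)) := by
  have self : ∀ i, ∃ c, x i * x i - x i * x i = z • c ∧ π c = br (π (x i)) (π (x i)) := fun i =>
    ⟨0, by rw [sub_self, smul_zero], by rw [map_zero, hbr.self]⟩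
  have symm : ∀ i j, (∃ c, x i * x j - x j * x i = z • c ∧ π c = br (π (x i)) (π (x j))) →
      ∃ c, x j * x i - x i * x j = z • c ∧ π c = br (π (x j)) (π (x i)) := by
    rintro i j ⟨c, hc, hc'⟩
    exact ⟨-c, by rw [smul_neg, ← hc, neg_sub], by rw [map_neg, hc', hbr.antisymm (π (x j))]⟩
  cases i <;> cases j
  exacts [self _, he, hf, symm _ _ he, self _, ef, symm _ _ hf, symm _ _ ef, self _]

theorem UQ.isQuantization_modHbar :
    IsQuantization (RingEquiv.refl Crh) UQ.hopf Curved.hopf Curved.bracket UQ.modHbar where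
  free := UQ.modHbar_free
  map_one := UQ.modHbar_one
  map_mul := UQ.modHbar_mul
  map_comul := twisted_map_comul UQ.modHbar UQ.modHbar_one UQ.modHbar_mul UQ.topGen
    UQ.isTwistedCoproduct Curved.isTwistedCoproduct UQ.modHbar_gen (UQ.modHbar_exp _)
    (UQ.modHbar_exp _)
  poisson := Curved.isPoissonBracket
  commutator := commutator_of_gens (RingEquiv.refl Crh) inferInstance Curved.isPoissonBracket
    UQ.modHbar UQ.modHbar_one UQ.modHbar_mul UQ.modHbar_free UQ.topGen
    (Curved.isPoissonBracket.commutator_of_pairs hh UQ.modHbar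
      ⟨UQ.gen .E + UQ.gen .E, by rw [UQ.rel_HE, two_mul, add_smul, smul_add], by
        rw [map_add, UQ.modHbar_gen, UQ.modHbar_gen, Curved.bracket_HE, two_mul]⟩
      ⟨-(UQ.gen .F + UQ.gen .F), by rw [UQ.rel_HF, two_mul, add_smul, smul_neg, smul_add], by
        rw [map_neg, map_add, UQ.modHbar_gen, UQ.modHbar_gen, Curved.bracket_HF, neg_mul, two_mul]⟩
      ⟨UQ.sinh, UQ.rel_EF, by
        rw [UQ.modHbar_sinh, UQ.modHbar_gen, UQ.modHbar_gen, Curved.bracket_EF]⟩)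

theorem UH.isQuantization_modHbar :
    IsQuantization (RingEquiv.refl Ch) UH.hopf Flat.hopf Flat.bracket UH.modHbar where
  free := UH.modHbar_free
  map_one := UH.modHbar_one
  map_mul := UH.modHbar_mul
  map_comul := twisted_map_comul UH.modHbar UH.modHbar_one UH.modHbar_mul UH.topGen
    UH.isTwistedCoproduct Flat.isTwistedCoproduct UH.modHbar_gen UH.modHbar_one UH.modHbar_one
  poisson := Flat.isPoissonBracket
  commutator := commutator_of_gens (RingEquiv.refl Ch) inferInstance Flat.isPoissonBracket
    UH.modHbar UH.modHbar_one UH.modHbar_mul UH.modHbar_free UH.topGen fun i j =>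
      ⟨_, UH.rel (sl2Gen i) (sl2Gen j), by
        rw [UH.modHbar_ι, UH.gen, UH.gen, UH.modHbar_ι, UH.modHbar_ι, Flat.bracket_linear]⟩

/-! ### Compatibilities of the arrows -/

theorem redHom_refl_conj₂ (c : Crh) :
    redHom (RingEquiv.refl Crh) (conj₂ c) = conj₁ (redHom (RingEquiv.refl Crh) c) :=
  constantCoeff_map conj₁ c

theorem redHom_refl_conj₁ (c : Cr) : redHom (RingEquiv.refl Cr) (conj₁ c) =
    starRingEnd ℂ (redHom (RingEquiv.refl Cr) c) :=
  constantCoeff_map (starRingEnd ℂ) c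

theorem redHom_swapVars_conj₂ (c : Crh) :
    redHom swapVars (conj₂ c) = conj₁ (redHom swapVars c) := by
  rw [redHom_swapVars, redHom_swapVars]
  ext i
  simp only [PowerSeries.coeff_map]
  exact constantCoeff_map (starRingEnd ℂ) _

theorem redHom_redHom_swapVars (c : Crh) : redHom (RingEquiv.refl Ch) (redHom swapVars c) =
    redHom (RingEquiv.refl Cr) (redHom (RingEquiv.refl Crh) c) := by
  rw [redHom_swapVars]
  exact constantCoeff_map PowerSeries.constantCoeff c

section Dag

variable {R A S B : Type*} [CommRing R] [IsLocalRing R] [Ring A] [Algebra R A] [CommRing S]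
  [IsLocalRing S] [Ring B] [Algebra S B]

/-- A multiplicative map that respects the involutions on generators respects them. -/
theorem TopGen.map_dag {cR : R →+* R} {cS : S →+* S} {σ : R →+* S} [IsLocalHom cR] [IsLocalHom cS]
    [IsLocalHom σ] {x : Gen → A} (hx : TopGen R x)
    (haus : IsHausdorff (IsLocalRing.maximalIdeal S) B) (π : A →ₛₗ[σ] B) (dA : A →ₛₗ[cR] A)
    (dB : B →ₛₗ[cS] B) (hσ : ∀ c, σ (cR c) = cS (σ c)) (π_one : π 1 = 1) (dA_one : dA 1 = 1)
    (dB_one : dB 1 = 1) (π_mul : ∀ a b, π (a * b) = π a * π b)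
    (dA_mul : ∀ a b, dA (a * b) = dA b * dA a) (dB_mul : ∀ a b, dB (a * b) = dB b * dB a)
    (hgen : ∀ g, π (dA (x g)) = dB (π (x g))) (a : A) : π (dA a) = dB (π a) :=
  hx.map_ext haus (f := π.toAddMonoidHom.comp dA.toAddMonoidHom)
    (g := dB.toAddMonoidHom.comp π.toAddMonoidHom)
    (fun n _ ha => map_mem_adicIdeal π n (map_mem_adicIdeal dA n ha))
    (fun n _ ha => map_mem_adicIdeal dB n (map_mem_adicIdeal π n ha))
    (fun n a b (ha : Trunc.mk S B n (π (dA a)) = Trunc.mk S B n (dB (π a)))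
        (hb : Trunc.mk S B n (π (dA b)) = Trunc.mk S B n (dB (π b))) => by
      change Trunc.mk S B n (π (dA (a * b))) = Trunc.mk S B n (dB (π (a * b)))
      rw [dA_mul, π_mul, π_mul, dB_mul, map_mul, map_mul, ha, hb])
    (fun c => by
      change π (dA (algebraMap R A c)) = dB (π (algebraMap R A c))
      rw [map_algebraMap_of_semilinear dA dA_one, map_algebraMap_of_semilinear π π_one,
        map_algebraMap_of_semilinear π π_one, map_algebraMap_of_semilinear dB dB_one, hσ])
    hgen a

end Dag

theorem UQ.modR_dag (a : UQ) : UQ.modR (UQ.dag a) = UH.dag (UQ.modR a) :=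
  UQ.topGen.map_dag inferInstance UQ.modR UQ.dag UH.dag redHom_swapVars_conj₂ UQ.modR_one
    UQ.dag_one UH.dag_one UQ.modR_mul UQ.dag_mul UH.dag_mul
    (fun g => by rw [UQ.dag_gen, UQ.modR_gen, UQ.modR_gen, UH.dag_gen]) a

theorem UQ.modHbar_dag (a : UQ) : UQ.modHbar (UQ.dag a) = Curved.dag (UQ.modHbar a) :=
  UQ.topGen.map_dag inferInstance UQ.modHbar UQ.dag Curved.dag redHom_refl_conj₂ UQ.modHbar_one
    UQ.dag_one Curved.dag_one UQ.modHbar_mul UQ.dag_mul Curved.dag_mul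
    (fun g => by rw [UQ.dag_gen, UQ.modHbar_gen, UQ.modHbar_gen, Curved.dag_gen]) a

theorem Curved.modR_dag (a : Curved) : Curved.modR (Curved.dag a) = Flat.dag (Curved.modR a) :=
  constantCoeff_map Flat.dagHom a

theorem UH.modHbar_dag (a : UH) : UH.modHbar (UH.dag a) = Flat.dag (UH.modHbar a) :=
  UH.topGen.map_dag inferInstance UH.modHbar UH.dag Flat.dag redHom_refl_conj₁ UH.modHbar_one
    UH.dag_one Flat.dag_one UH.modHbar_mul UH.dag_mul Flat.dag_mul
    (fun g => by
      rw [UH.dag_gen, UH.modHbar_gen, UH.modHbar_gen, Flat.dag_apply, Flat.dagHom_X]) a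

/-- Both composites are multiplicative and continuous, set both parameters to zero on scalars, and
agree on H, E, F. -/
theorem modHbar_modR (a : UQ) : UH.modHbar (UQ.modR a) = Curved.modR (UQ.modHbar a) :=
  UQ.topGen.map_ext inferInstance (f := UH.modHbar.toAddMonoidHom.comp UQ.modR.toAddMonoidHom)
    (g := Curved.modR.toAddMonoidHom.comp UQ.modHbar.toAddMonoidHom)
    (fun n _ ha => map_mem_adicIdeal UH.modHbar n (map_mem_adicIdeal UQ.modR n ha))
    (fun n _ ha => map_mem_adicIdeal Curved.modR n (map_mem_adicIdeal UQ.modHbar n ha))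
    (fun n a b (ha : Trunc.mk ℂ Flat n (UH.modHbar (UQ.modR a)) =
          Trunc.mk ℂ Flat n (Curved.modR (UQ.modHbar a)))
        (hb : Trunc.mk ℂ Flat n (UH.modHbar (UQ.modR b)) =
          Trunc.mk ℂ Flat n (Curved.modR (UQ.modHbar b))) => by
      change Trunc.mk ℂ Flat n (UH.modHbar (UQ.modR (a * b))) =
        Trunc.mk ℂ Flat n (Curved.modR (UQ.modHbar (a * b)))
      rw [UQ.modR_mul, UH.modHbar_mul, UQ.modHbar_mul, Curved.isHopfDeformation_modR.map_mul,
        map_mul, map_mul, ha, hb])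
    (fun c => by
      change UH.modHbar (UQ.modR (algebraMap Crh UQ c)) =
        Curved.modR (UQ.modHbar (algebraMap Crh UQ c))
      rw [map_algebraMap_of_semilinear UQ.modR UQ.modR_one,
        map_algebraMap_of_semilinear UH.modHbar UH.modHbar_one,
        map_algebraMap_of_semilinear UQ.modHbar UQ.modHbar_one,
        map_algebraMap_of_semilinear Curved.modR Curved.isHopfDeformation_modR.map_one,
        redHom_redHom_swapVars])
    (fun g => by
      change UH.modHbar (UQ.modR (UQ.gen g)) = Curved.modR (UQ.modHbar (UQ.gen g))
      rw [UQ.modR_gen, UH.modHbar_gen, UQ.modHbar_gen, Curved.modR_gen]) a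

end CurvedQuantum

end

/-! ### Assembly of the commuting square. -/

theorem mainTheorem5 :
    ∃ -- the four Hopf algebra structures, with coproducts `Δ_r`, `Δ₀`, `Δ_r`, `Δ₀`
      (hQ : AdicHopf Crh UQ) (hH : AdicHopf Ch UH)
      (hC : AdicHopf Cr Curved) (hF : AdicHopf ℂ Flat)
      -- the involutions `†`
      (dQ : UQ →ₛₗ[conj₂] UQ) (dH : UH →ₛₗ[conj₁] UH)
      (dC : Curved →ₛₗ[conj₁] Curved) (dF : Flat →ₛₗ[starRingEnd ℂ] Flat)
      -- the Poisson brackets `{·,·}_r` and `{·,·}₀`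
      (brC : Curved →ₗ[Cr] Curved →ₗ[Cr] Curved) (brF : Flat →ₗ[ℂ] Flat →ₗ[ℂ] Flat)
      -- the left, top, right and bottom arrows
      (πL : UQ →ₛₗ[redHom swapVars] UH)
      (πT : UQ →ₛₗ[redHom (RingEquiv.refl Crh)] Curved)
      (πR : Curved →ₛₗ[redHom (RingEquiv.refl Cr)] Flat)
      (πB : UH →ₛₗ[redHom (RingEquiv.refl Ch)] Flat),
      -- with `K^{1/2} = e^{-rH/2}` and `q = e^{-r}`, the defining relations of `U_q^ħ(sl₂)`
      (UQ.exp (1 / 2) * UQ.exp (-1 / 2) = 1 ∧ UQ.exp (-1 / 2) * UQ.exp (1 / 2) = 1 ∧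
        UQ.exp (-1 / 2) * UQ.gen .E * UQ.exp (1 / 2) =
          expS (-1) (PowerSeries.X : Cr) • UQ.gen .E ∧
        UQ.exp (-1 / 2) * UQ.gen .F * UQ.exp (1 / 2) =
          expS 1 (PowerSeries.X : Cr) • UQ.gen .F ∧
        (2 * rr) • (UQ.gen .E * UQ.gen .F - UQ.gen .F * UQ.gen .E) =
          hh • (UQ.exp (1 / 2) ^ 2 - UQ.exp (-1 / 2) ^ 2)) ∧
      -- the coproducts
      IsCurvedCoproduct hQ UQ.gen UQ.exp ∧
      IsTrivialCoproduct hH UH.ι ∧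
      IsCurvedCoproduct hC Curved.gen Curved.exp ∧
      IsTrivialCoproduct hF Flat.linear ∧
      -- on `ℂ[(SU₂*)_r]` it is dual to the multiplication of pairs of triangular matrices
      (∀ i j, hC.comul (Curved.lower i j) =
        ∑ k, ctmul Cr (Curved.lower i k) (Curved.lower k j)) ∧
      (∀ i j, hC.comul (Curved.upper i j) =
        ∑ k, ctmul Cr (Curved.upper i k) (Curved.upper k j)) ∧
      -- the involutions
      (IsHopfStar hQ dQ ∧ (∀ g, dQ (UQ.gen g) = UQ.gen g.dag) ∧
        dQ (UQ.exp (-1)) = UQ.exp (-1)) ∧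
      (IsHopfStar hH dH ∧ ∀ g, dH (UH.ι (sl2Gen g)) = UH.ι (sl2Gen g.dag)) ∧
      (IsHopfStar hC dC ∧ ∀ g, dC (Curved.gen g) = Curved.gen g.dag) ∧
      (IsHopfStar hF dF ∧ ∀ g, dF (MvPolynomial.X g) = MvPolynomial.X g.dag) ∧
      -- the Poisson brackets
      (IsPoissonBracket brC ∧
        brC (Curved.gen .H) (Curved.gen .E) = 2 * Curved.gen .E ∧
        brC (Curved.gen .H) (Curved.gen .F) = -2 * Curved.gen .F ∧
        brC (Curved.gen .E) (Curved.gen .F) = sinhDiv (MvPolynomial.X Gen.H)) ∧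
      (IsPoissonBracket brF ∧
        ∀ x y, brF (Flat.linear x) (Flat.linear y) = Flat.linear ⁅x, y⁆) ∧
      -- the arrows on generators, and their compatibility with the involutions
      (∀ g, πL (UQ.gen g) = UH.ι (sl2Gen g)) ∧
      ((∀ g, πT (UQ.gen g) = Curved.gen g) ∧ ∀ t, πT (UQ.exp t) = Curved.exp t) ∧
      (∀ g, πR (Curved.gen g) = MvPolynomial.X g) ∧
      (∀ x, πB (UH.ι x) = Flat.linear x) ∧
      (∀ a, πL (dQ a) = dH (πL a)) ∧ (∀ a, πT (dQ a) = dC (πT a)) ∧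
      (∀ a, πR (dC a) = dF (πR a)) ∧ (∀ a, πB (dH a) = dF (πB a)) ∧
      -- the square commutes
      (∀ a, πB (πL a) = πR (πT a)) ∧
      -- the vertical arrows are Hopf deformations (parameter `r`)
      IsHopfDeformation swapVars hQ hH πL ∧
      IsHopfDeformation (RingEquiv.refl Cr) hC hF πR ∧
      -- the horizontal arrows are quantizations of Poisson algebras (parameter `ħ`)
      IsQuantization (RingEquiv.refl Crh) hQ hC brC πT ∧
      IsQuantization (RingEquiv.refl Ch) hH hF brF πB := by
  exact ⟨UQ.hopf, UH.hopf, Curved.hopf, Flat.hopf, UQ.dag, UH.dag, Curved.dag, Flat.dag,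
    Curved.bracket, Flat.bracket, UQ.modR, UQ.modHbar, Curved.modR, UH.modHbar,
    ⟨UQ.pos_mul_neg, UQ.neg_mul_pos, UQ.conj_E, UQ.conj_F, UQ.two_rr_smul_commutator⟩,
    IsTwistedCoproduct.isCurvedCoproduct UQ.isTwistedCoproduct, UH.comul_ι,
    IsTwistedCoproduct.isCurvedCoproduct Curved.isTwistedCoproduct, Flat.comul_linear,
    Curved.comul_lower, Curved.comul_upper,
    ⟨UQ.isHopfStar, UQ.dag_gen, by rw [UQ.dag_exp, map_neg, map_one]⟩,
    ⟨UH.isHopfStar, UH.dag_gen⟩, ⟨Curved.isHopfStar, Curved.dag_gen⟩,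
    ⟨Flat.isHopfStar, Flat.dagHom_X⟩,
    ⟨Curved.isPoissonBracket, Curved.bracket_HE, Curved.bracket_HF, Curved.bracket_EF⟩,
    ⟨Flat.isPoissonBracket, Flat.bracket_linear⟩,
    UQ.modR_gen, ⟨UQ.modHbar_gen, UQ.modHbar_exp⟩, Curved.modR_gen, UH.modHbar_ι,
    UQ.modR_dag, UQ.modHbar_dag, Curved.modR_dag, UH.modHbar_dag, modHbar_modR,
    UQ.isHopfDeformation_modR, Curved.isHopfDeformation_modR,
    UQ.isQuantization_modHbar, UH.isQuantization_modHbar⟩
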